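/- **Conventions.** All graphs are finite, undirected and simple. $\sigma_{col}=\{V,E,\in,B,R,C_0,C_1\}$ has one binary symbol $\in$ and unary symbols $V,E,B,R,C_0,C_1$; a $\sigma_{col}$-structure $\mathfrak A$ is always finite and its $\{V,E,\in\}$-reduct is the incidence representation of a graph (universe: vertices $V$ and edges $E$, disjoint; $x\in e$ means incidence). MSO is monadic second-order logic over $\sigma_{col}$, with quantification over elements and over subsets of the universe. A path has at least one edge; paths are disjoint if they share no vertex. Words are over $\{0,1\}$. **Simple pseudo-wall of order $k\ge 2$.** A $\sigma_{col}$-structure whose universe consists of the vertices and edges of a path $L=(v_1,e_1,\dots,e_s,v_{s+1})$ and of $\binom k2$ pairwise disjoint paths $P_{i,j}$ $(1\le i<j\le k)$, which may meet $L$. There are indices $1=i_1<\dots<i_k<s$ with $B=\{e_{i_1},\dots,e_{i_k}\}$ and $R=\{e_1,\dots,e_s\}\setminus B$. With $\mathcal I_j=\{v_{i_j+1},\dots,v_{i_{j+1}}\}$ and $i_{k+1}:=s+1$, the path $P_{i,j}$ has one endpoint in $\mathcal I_i$ and the other in $\mathcal I_j$. The sets $C_0,C_1\subseteq\{v_1,\dots,v_{s+1}\}$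 are disjoint, every $\mathcal I_j$ is contained in or disjoint from $C_0$, and likewise for $C_1$, and the intervals contained in $C_0\cup C_1$ are the first $l$ ones, for some $0\le l\le k$. The encoded word is $w_1\dots w_l$ with $w_j=1$ if $\mathcal I_j\subseteq C_1$ and $w_j=0$ if $\mathcal I_j\subseteq C_0$. **Complex pseudo-wall of order $k$.** A $\sigma_{col}$-structure whose universe consists of the vertices and edges of a path $L=(v_1,e_1,\dots,e_s,v_{s+1})$ with $s\ge 2$, of the paths in a nonempty set $\mathcal P$ of pairwise disjoint paths, and of the paths in a nonempty set $\mathcal Q$ of pairwise disjoint paths; $B=\{e_1\}$, $R=\{e_2,\dots,e_s\}$; $C_0,C_1\subseteq\{v_1,\dots,v_{s+1}\}$ are disjoint; every $P\in\mathcal P$ has exactly one vertex in common with $L$, and it is an endpoint of $P$. Let $\mathcal I(\mathcal P,\mathcal Q)$ be the graph with vertex set $\mathcal P\mathbin{\dot\cup}\mathcal Q$ in which $P\in\mathcal P$ and $Q\in\mathcal Q$ are adjacent if they share a vertex. It contains a subdivision of $K_{k^2}$, each of whose subdivided edges is cut at one of its edges, so that its vertices fall into $k^2$ branch sets (one around each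 branch vertex), such that to every $u\in C_0\cup C_1$ one can assign a branch set containing a path $P\in\mathcal P$ with endpoint $u$, with different branch sets for different $u$. The encoded word is obtained by reading the vertices in $C_0\cup C_1$ in their order along $v_1,\dots,v_{s+1}$, with letter $1$ for $C_1$ and $0$ for $C_0$. A $\sigma_{col}$-structure $\mathfrak A$ *contains* a pseudo-wall if it has an induced substructure that is this pseudo-wall and to which all elements of $B^{\mathfrak A}$ and $R^{\mathfrak A}$ belong. **Machines.** Turing machines have one tape. A machine is $n^d$-time bounded if on every input $w$ every computation has at most $|w|^d$ steps. An alternating machine has at most $m$ alternations if on every input every computation switches at most $m$ times between existential and universal states. **Statement.** There is an algorithm that constructs from every nondeterministic Turing machine $M$ an MSO-sentence $\varphi_M$ such that, for all $d\in\mathbb N$, if $M$ is $n^d$-time bounded, then for every word $w\in\{0,1\}^*$ and every $\sigma_{col}$-structure $\mathfrak A$ that contains a simple or complex pseudo-wall of order $|w|^d$ encoding $w$, $$\mathfrak A\models\varphi_M\iff M\text{ accepts }w.$$ The same holds for alternating machines with a bounded number of alternations: there is an algorithm that constructs from every alternating Turing machine $M$ and every $m\in\mathbb N$ an MSO-sentence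 $\varphi_{M,m}$ such that, for all $d$, if $M$ is $n^d$-time bounded and has at most $m$ alternations, then for all $w$ and $\mathfrak A$ as above, $\mathfrak A\models\varphi_{M,m}$ if and only if $M$ accepts $w$. -/

import Mathlib

universe u

namespace PW

/-! ### Structures over the signature `{V, E, ∈, B, R, C₀, C₁}` -/

/-- A structure with universe `A` over the signature with the binary relation symbol `∈`
(here `inc`) and the unary relation symbols `V, E, B, R, C₀, C₁`. -/
structure ColStructure (A : Type u) where
  V : Set A
  E : Set A
  inc : A → A → Prop
  B : Set A
  R : Set A
  C0 : Set A
  C1 : Set A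

namespace ColStructure

variable {A : Type u}

/-- The reduct to `{V, E, ∈}` is the incidence representation of a simple undirected graph:
the universe is the disjoint union of the vertices and the edges, every edge has exactly two
(distinct) endpoints, and different edges have different sets of endpoints. -/
structure IsGraph (M : ColStructure A) : Prop where
  cover : M.V ∪ M.E = Set.univ
  disjoint : Disjoint M.V M.E
  inc_mem : ∀ x e, M.inc x e → x ∈ M.V ∧ e ∈ M.E
  two_ends : ∀ e ∈ M.E, ∃ x y, x ≠ y ∧ ∀ z, M.inc z e ↔ z = x ∨ z = y
  simple : ∀ e ∈ M.E, ∀ e' ∈ M.E, (∀ z, M.inc z e ↔ M.inc z e') → e = e'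

/-- The (induced) substructure with universe `S`. -/
def induce (M : ColStructure A) (S : Set A) : ColStructure S where
  V := {x | (x : A) ∈ M.V}
  E := {x | (x : A) ∈ M.E}
  inc x e := M.inc x e
  B := {x | (x : A) ∈ M.B}
  R := {x | (x : A) ∈ M.R}
  C0 := {x | (x : A) ∈ M.C0}
  C1 := {x | (x : A) ∈ M.C1}

end ColStructure

/-! ### Paths, intersection graphs, topological clique minors -/

/-- A path `(vert 0, edge 0, vert 1, …, edge (len - 1), vert len)` of positive length. -/
structure GPath {A : Type u} (M : ColStructure A) where
  len : ℕ
  len_pos : 0 < len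
  vert : Fin (len + 1) → A
  edge : Fin len → A
  vert_injective : Function.Injective vert
  inc_left : ∀ t : Fin len, M.inc (vert t.castSucc) (edge t)
  inc_right : ∀ t : Fin len, M.inc (vert t.succ) (edge t)

namespace GPath

variable {A : Type u} {M : ColStructure A}

def first (P : GPath M) : A := P.vert 0

def last (P : GPath M) : A := P.vert (Fin.last P.len)

def verts (P : GPath M) : Set A := Set.range P.vert

def edges (P : GPath M) : Set A := Set.range P.edge

/-- All elements of the universe lying on the path. -/
def elems (P : GPath M) : Set A := P.verts ∪ P.edges

/-- Given positions `i 0 < … < i (k - 1)` of edges on a path, the `j`-th interval consists of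
the vertices strictly behind the edge `i j` and in front of the edge `i (j + 1)` (resp. up to the
end of the path, if `j = k - 1`). -/
def interval (L : GPath M) {k : ℕ} (i : Fin k → Fin L.len) (j : Fin k) : Set A :=
  {x | ∃ t : Fin (L.len + 1),
    (i j : ℕ) < t ∧ (∀ j', j < j' → (t : ℕ) ≤ i j') ∧ L.vert t = x}

/-- Pairwise vertex-disjoint paths. -/
def PairwiseDisjoint {ι : Type*} (P : ι → GPath M) : Prop :=
  ∀ a b, a ≠ b → Disjoint (P a).verts (P b).verts

/-- The intersection graph of two families of pairwise disjoint paths: its vertex set is the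
disjoint union of the two families, and two members of different families are adjacent if they
have a vertex in common. -/
def intersectionGraph {ι κ : Type*} (P : ι → GPath M) (Q : κ → GPath M) :
    SimpleGraph (ι ⊕ κ) where
  Adj
    | .inl a, .inr b => ((P a).verts ∩ (Q b).verts).Nonempty
    | .inr b, .inl a => ((P a).verts ∩ (Q b).verts).Nonempty
    | _, _ => False
  symm := ⟨by rintro (a | a) (b | b) h <;> exact h⟩
  loopless := ⟨by rintro (a | a) h <;> exact h⟩

end GPath

/-- An image of the complete graph `K_n` as a topological minor of `H`, i.e. a subgraph of `H` which
is a subdivision of `K_n`, cut into branch sets. The branch vertices are `center i`, and the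
subdivided edge between `center i` and `center j` is the path that runs along `arm i j` to
`tip i j`, through the edge from `tip i j` to `tip j i`, and back along `arm j i` to `center j`.
The values of `tip` and `arm` on the diagonal are irrelevant. -/
structure TopCliqueImage {X : Type*} (H : SimpleGraph X) (n : ℕ) where
  center : Fin n → X
  tip : Fin n → Fin n → X
  arm : ∀ i j, H.Walk (center i) (tip i j)
  arm_isPath : ∀ i j, i ≠ j → (arm i j).IsPath
  arm_inter : ∀ i j j', i ≠ j → i ≠ j' → j ≠ j' →
    ∀ x, x ∈ (arm i j).support → x ∈ (arm i j').support → x = center i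
  tip_adj : ∀ i j, i ≠ j → H.Adj (tip i j) (tip j i)
  branch_disjoint : ∀ i i', i ≠ i' → Disjoint
    ({x | x = center i ∨ ∃ j, i ≠ j ∧ x ∈ (arm i j).support} : Set X)
    {x | x = center i' ∨ ∃ j, i' ≠ j ∧ x ∈ (arm i' j).support}

/-- The branch set of the `i`-th vertex of the clique. -/
def TopCliqueImage.branch {X : Type*} {H : SimpleGraph X} {n : ℕ} (μ : TopCliqueImage H n)
    (i : Fin n) : Set X :=
  {x | x = μ.center i ∨ ∃ j, i ≠ j ∧ x ∈ (μ.arm i j).support}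

/-! ### Pseudo-walls -/

namespace ColStructure

variable {A : Type u}

/-- `W` is a simple pseudo-wall of order `k` (where `k ≥ 2`) encoding the word `w`
(`true` is the letter `1`, `false` the letter `0`). -/
def IsSimplePseudoWall (W : ColStructure A) (k : ℕ) (w : List Bool) : Prop :=
  2 ≤ k ∧ W.IsGraph ∧
  ∃ (L : GPath W) (i : Fin k → Fin L.len)
    (Q : {p : Fin k × Fin k // p.1 < p.2} → GPath W),
    -- the universe consists of the long path and the linking paths
    L.elems ∪ (⋃ p, (Q p).elems) = Set.univ ∧
    -- the blue edges: the first edge is blue, the last one is not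
    StrictMono i ∧ (∀ j : Fin k, (j : ℕ) = 0 → (i j : ℕ) = 0) ∧
    (∀ j : Fin k, (i j : ℕ) + 1 < L.len) ∧
    W.B = {e | ∃ j, e = L.edge (i j)} ∧
    W.R = L.edges \ W.B ∧
    -- the colours of the intervals
    W.C0 ⊆ L.verts ∧ W.C1 ⊆ L.verts ∧ Disjoint W.C0 W.C1 ∧
    (∀ j, L.interval i j ⊆ W.C0 ∨ Disjoint (L.interval i j) W.C0) ∧
    (∀ j, L.interval i j ⊆ W.C1 ∨ Disjoint (L.interval i j) W.C1) ∧
    (∀ j j', j' < j → L.interval i j ⊆ W.C0 ∪ W.C1 → L.interval i j' ⊆ W.C0 ∪ W.C1) ∧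
    -- the linking paths
    GPath.PairwiseDisjoint Q ∧
    (∀ p, (Q p).first ∈ L.interval i p.1.1 ∧ (Q p).last ∈ L.interval i p.1.2) ∧
    -- the encoded word
    w.length ≤ k ∧
    (∀ j : Fin k, L.interval i j ⊆ W.C0 ∪ W.C1 ↔ (j : ℕ) < w.length) ∧
    (∀ j : Fin k, ∀ h : (j : ℕ) < w.length,
      (w[(j : ℕ)] = true → L.interval i j ⊆ W.C1) ∧
      (w[(j : ℕ)] = false → L.interval i j ⊆ W.C0))

/-- `W` is a complex pseudo-wall of order `k` encoding the word `w`. -/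
def IsComplexPseudoWall (W : ColStructure A) (k : ℕ) (w : List Bool) : Prop :=
  W.IsGraph ∧
  ∃ (L : GPath W) (r₁ r₂ : ℕ) (P : Fin r₁ → GPath W) (Q : Fin r₂ → GPath W),
    0 < r₁ ∧ 0 < r₂ ∧
    L.elems ∪ (⋃ a, (P a).elems) ∪ (⋃ b, (Q b).elems) = Set.univ ∧
    -- the first edge of the long path is blue, the others (at least one) are red
    2 ≤ L.len ∧
    W.B = {e | ∃ t : Fin L.len, (t : ℕ) = 0 ∧ e = L.edge t} ∧
    W.R = {e | ∃ t : Fin L.len, (t : ℕ) ≠ 0 ∧ e = L.edge t} ∧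
    W.C0 ⊆ L.verts ∧ W.C1 ⊆ L.verts ∧ Disjoint W.C0 W.C1 ∧
    GPath.PairwiseDisjoint P ∧ GPath.PairwiseDisjoint Q ∧
    (∀ a, ∃ x, (x = (P a).first ∨ x = (P a).last) ∧ (P a).verts ∩ L.verts = {x}) ∧
    -- the clique, with the coloured vertices in different branch sets
    (∃ (μ : TopCliqueImage (GPath.intersectionGraph P Q) (k ^ 2))
      (β : (W.C0 ∪ W.C1 : Set A) → Fin (k ^ 2)), Function.Injective β ∧
      ∀ x : (W.C0 ∪ W.C1 : Set A),
        ∃ a, ((x : A) = (P a).first ∨ (x : A) = (P a).last) ∧ Sum.inl a ∈ μ.branch (β x)) ∧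
    -- the encoded word
    ∃ p : Fin w.length → Fin (L.len + 1), StrictMono p ∧
      Set.range (fun j => L.vert (p j)) = W.C0 ∪ W.C1 ∧
      ∀ j, (w.get j = true → L.vert (p j) ∈ W.C1) ∧ (w.get j = false → L.vert (p j) ∈ W.C0)

/-- `M` contains a pseudo-wall, simple or complex, of order `k` encoding `w`: some substructure is
such a pseudo-wall, and the blue and red elements of `M` all belong to it. -/
def ContainsPseudoWall (M : ColStructure A) (k : ℕ) (w : List Bool) : Prop :=
  ∃ S : Set A, M.B ∪ M.R ⊆ S ∧
    ((M.induce S).IsSimplePseudoWall k w ∨ (M.induce S).IsComplexPseudoWall k w)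

end ColStructure

/-! ### Monadic second-order logic -/

/-- The unary relation symbols. -/
inductive UnarySym
  | V | E | B | R | C0 | C1

/-- Formulas of monadic second-order logic. First-order variables and set variables are each
numbered by natural numbers. -/
inductive MSO
  | eq (x y : ℕ)
  | unary (U : UnarySym) (x : ℕ)
  | inc (x y : ℕ)
  | mem (x X : ℕ)
  | not (φ : MSO)
  | and (φ ψ : MSO)
  | or (φ ψ : MSO)
  | ex (x : ℕ) (φ : MSO)
  | all (x : ℕ) (φ : MSO)
  | exSet (X : ℕ) (φ : MSO)
  | allSet (X : ℕ) (φ : MSO)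

def ColStructure.interp {A : Type u} (M : ColStructure A) : UnarySym → Set A
  | .V => M.V
  | .E => M.E
  | .B => M.B
  | .R => M.R
  | .C0 => M.C0
  | .C1 => M.C1

namespace MSO

/-- Satisfaction under an assignment `s` of the first-order variables and `S` of the
set variables. -/
def Sat {A : Type u} (M : ColStructure A) : MSO → (ℕ → A) → (ℕ → Set A) → Prop
  | eq x y, s, _ => s x = s y
  | unary U x, s, _ => s x ∈ M.interp U
  | inc x y, s, _ => M.inc (s x) (s y)
  | mem x X, s, S => s x ∈ S X
  | not φ, s, S => ¬ Sat M φ s S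
  | and φ ψ, s, S => Sat M φ s S ∧ Sat M ψ s S
  | or φ ψ, s, S => Sat M φ s S ∨ Sat M ψ s S
  | ex x φ, s, S => ∃ a : A, Sat M φ (Function.update s x a) S
  | all x φ, s, S => ∀ a : A, Sat M φ (Function.update s x a) S
  | exSet X φ, s, S => ∃ U : Set A, Sat M φ s (Function.update S X U)
  | allSet X φ, s, S => ∀ U : Set A, Sat M φ s (Function.update S X U)

/-- The free first-order variables. -/
def free : MSO → Finset ℕ
  | eq x y => {x, y}
  | unary _ x => {x}
  | inc x y => {x, y}
  | mem x _ => {x}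
  | not φ => free φ
  | and φ ψ => free φ ∪ free ψ
  | or φ ψ => free φ ∪ free ψ
  | ex x φ => (free φ).erase x
  | all x φ => (free φ).erase x
  | exSet _ φ => free φ
  | allSet _ φ => free φ

/-- The free set variables. -/
def freeSet : MSO → Finset ℕ
  | eq _ _ => ∅
  | unary _ _ => ∅
  | inc _ _ => ∅
  | mem _ X => {X}
  | not φ => freeSet φ
  | and φ ψ => freeSet φ ∪ freeSet ψ
  | or φ ψ => freeSet φ ∪ freeSet ψ
  | ex _ φ => freeSet φ
  | all _ φ => freeSet φ
  | exSet X φ => (freeSet φ).erase X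
  | allSet X φ => (freeSet φ).erase X

/-- A sentence: a formula without free variables. -/
def IsSentence (φ : MSO) : Prop := φ.free = ∅ ∧ φ.freeSet = ∅

end MSO

/-- `M ⊨ φ`, for a sentence `φ` (whose truth does not depend on the assignment). -/
def ColStructure.Models {A : Type u} (M : ColStructure A) (φ : MSO) : Prop :=
  ∀ (s : ℕ → A) (S : ℕ → Set A), φ.Sat M s S

def UnarySym.code : UnarySym → ℕ
  | .V => 0
  | .E => 1
  | .B => 2
  | .R => 3
  | .C0 => 4
  | .C1 => 5

/-- A formula written out as a word (in prefix notation) over the natural numbers. -/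
def MSO.code : MSO → List ℕ
  | .eq x y => [0, x, y]
  | .unary U x => [1, U.code, x]
  | .inc x y => [2, x, y]
  | .mem x X => [3, x, X]
  | .not φ => 4 :: φ.code
  | .and φ ψ => 5 :: (φ.code ++ ψ.code)
  | .or φ ψ => 6 :: (φ.code ++ ψ.code)
  | .ex x φ => 7 :: x :: φ.code
  | .all x φ => 8 :: x :: φ.code
  | .exSet X φ => 9 :: X :: φ.code
  | .allSet X φ => 10 :: X :: φ.code

theorem UnarySym.code_injective : Function.Injective UnarySym.code := by
  intro U U' h
  cases U <;> cases U' <;> simp_all [UnarySym.code]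

/-- Unique readability. -/
theorem MSO.code_append_inj (φ ψ : MSO) (l l' : List ℕ) (h : φ.code ++ l = ψ.code ++ l') :
    φ = ψ ∧ l = l' := by
  induction φ generalizing ψ l l' <;> cases ψ <;> simp [MSO.code, List.append_assoc] at h ⊢ <;>
    grind [UnarySym.code_injective, Function.Injective]

/-- Different formulas are written differently. -/
theorem MSO.code_injective : Function.Injective MSO.code := fun φ ψ h =>
  (MSO.code_append_inj φ ψ [] [] (by rw [h])).1

/-! ### Turing machines -/

/-- A nondeterministic Turing machine with one two-way infinite tape, given by its finite set of
instructions. States and tape symbols are natural numbers; `0` is the blank, `1` is the input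
letter `0`, and `2` is the input letter `1`. The instruction `(q, a, q', a', m)` means: in state `q`
reading `a`, one may write `a'`, go to state `q'`, and move the head as `m` says
(`some false`: left, `none`: no move, `some true`: right). -/
structure TM where
  start : ℕ
  accept : List ℕ
  instr : List (ℕ × ℕ × ℕ × ℕ × Option Bool)

/-- A configuration. -/
structure Cfg where
  state : ℕ
  head : ℤ
  tape : ℤ → ℕ

def moveBy : Option Bool → ℤ
  | some false => -1
  | none => 0
  | some true => 1

def letter : Bool → ℕ
  | false => 1
  | true => 2

namespace TM

/-- The initial configuration on input `w`: the cells `0, …, |w| - 1` contain `w`, all others are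
blank, and the head is on the cell `0`. -/
def init (M : TM) (w : List Bool) : Cfg where
  state := M.start
  head := 0
  tape
    | Int.ofNat i => (w[i]?.map letter).getD 0
    | Int.negSucc _ => 0

/-- One computation step. -/
def Step (M : TM) (c c' : Cfg) : Prop :=
  ∃ q' a' m, (c.state, c.tape c.head, q', a', m) ∈ M.instr ∧
    c' = ⟨q', c.head + moveBy m, Function.update c.tape c.head a'⟩

def Halted (M : TM) (c : Cfg) : Prop := ∀ c', ¬ M.Step c c'

/-- `r 0, …, r n` is a computation with `n` steps on input `w`. -/
def IsRun (M : TM) (w : List Bool) (n : ℕ) (r : ℕ → Cfg) : Prop :=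
  r 0 = M.init w ∧ ∀ t < n, M.Step (r t) (r (t + 1))

/-- `n ^ d`-time bounded: every computation on every input `w` has at most `|w| ^ d` steps. -/
def TimeBounded (M : TM) (d : ℕ) : Prop :=
  ∀ w n r, M.IsRun w n r → n ≤ w.length ^ d

/-- Nondeterministic acceptance: some computation on `w` halts in an accepting state. -/
def Accepts (M : TM) (w : List Bool) : Prop :=
  ∃ n r, M.IsRun w n r ∧ M.Halted (r n) ∧ (r n).state ∈ M.accept

/-- A machine as a tuple of finite objects. -/
def equiv : TM ≃ ℕ × List ℕ × List (ℕ × ℕ × ℕ × ℕ × Option Bool) where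
  toFun M := (M.start, M.accept, M.instr)
  invFun p := ⟨p.1, p.2.1, p.2.2⟩
  left_inv _ := rfl
  right_inv _ := rfl

instance : Primcodable TM := Primcodable.ofEquiv _ equiv

end TM

/-- An alternating Turing machine: the states in the list `universal` are universal, all others
are existential. -/
structure ATM where
  machine : TM
  universal : List ℕ

namespace ATM

/-- The accepting configurations of an alternating machine: the halted ones with an accepting
state, the existential ones with some accepting successor, and the universal ones which have a
successor and all of whose successors are accepting. -/
inductive AcceptsFrom (N : ATM) : Cfg → Prop
  | halt (c : Cfg) : N.machine.Halted c → c.state ∈ N.machine.accept → AcceptsFrom N c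
  | existential (c c' : Cfg) : c.state ∉ N.universal → N.machine.Step c c' →
      AcceptsFrom N c' → AcceptsFrom N c
  | forall_succ (c : Cfg) : c.state ∈ N.universal → ¬ N.machine.Halted c →
      (∀ c', N.machine.Step c c' → AcceptsFrom N c') → AcceptsFrom N c

def Accepts (N : ATM) (w : List Bool) : Prop := N.AcceptsFrom (N.machine.init w)

/-- On every computation, the machine changes between existential and universal states at
most `m` times. -/
def AlternationBounded (N : ATM) (m : ℕ) : Prop :=
  ∀ w n r, N.machine.IsRun w n r →
    ((Finset.range n).filter
      (fun t => ¬ ((r t).state ∈ N.universal ↔ (r (t + 1)).state ∈ N.universal))).card ≤ m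

/-- A machine as a tuple of finite objects. -/
def equiv : ATM ≃ TM × List ℕ where
  toFun N := (N.machine, N.universal)
  invFun p := ⟨p.1, p.2⟩
  left_inv _ := rfl
  right_inv _ := rfl

instance : Primcodable ATM := Primcodable.ofEquiv _ equiv

end ATM

end PW

open PW

namespace PW

/-! ### Abbreviations for formulas -/

namespace MSO

/-! A pseudo-wall allows MSO to quantify over binary relations on a set of at least |w|^d points,
and with such relations a computation of at most |w|^d steps can be written down and checked.

Interpretation. Paths of the two families may cross, so plain connectivity would merge pieces that
have to stay apart. Therefore one family is walked on vertices and the other one on edges, with a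
change between the two only at vertices of a guessed set (`LayerAdj`, `LayerConn`). Both kinds of
pseudo-wall yield disjoint pieces, connected in this sense, any two of which are linked by a vertex
that lies on one piece while its second-layer edges lie on the other (`isCliqueModel_of_intervals`,
`isCliqueModel_of_topCliqueImage`). Such a vertex determines an ordered pair of pieces, so a binary
relation becomes a few sets of elements (`codesAll_of_isLink`). The word is read along the coloured
path, whose direction is definable because its first edge is blue and its last edge is not.

Frames. The sentence guesses the layers, a domain with one element for each piece, and a coded
linear order on it, and requires that the letters occupy an initial segment. Every such frame, of
whatever size n, is a copy of {0, …, n - 1} carrying w (`exists_isEnum`). Only for completeness does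
one need the frame that comes from the pseudo-wall and has n ≥ |w|^d (`IsCliqueModel.exists_frame`).

Computations. A computation is a sequence of instructions. Elements of the domain number the steps
as well as the cells on either side of cell 0; what is stored is the instruction and the head
position of each step. The tape is not stored: the symbol under the head is the one written at the
last earlier visit, or else the initial one (`TM.tape_conf_eq_iff`).

Alternation. Acceptance is a game in which the players prolong a common computation in turn
(`ATM.Round`). A universal prolongation that is unfinished when all n steps are used up counts
against acceptance; this makes the sentence sound even for frames that are too small
(`ATM.acceptsFrom_of_rounds`). A round that is passed on to the next one contains a switch, so m + 1
rounds suffice (`ATM.rounds_of_acceptsFrom`). A nondeterministic machine is an alternating one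
without universal states, with m = 0.

Computability. The code of the sentence is primitive recursive in the machine and m; the iteration
of rounds works because one round only puts a fixed word in front of the code of the remaining
formula. -/

def imp (φ ψ : MSO) : MSO := or (not φ) ψ

def falsum : MSO := ex 0 (not (eq 0 0))

/-- The disjunction of `f 0, …, f (r - 1)`. -/
def bigOr (r : ℕ) (f : ℕ → MSO) : MSO := Nat.rec falsum (fun q φ => or (f q) φ) r

def bigAnd (r : ℕ) (f : ℕ → MSO) : MSO := not (bigOr r fun q => not (f q))

/-- Existential quantification over the set variables `g 0, …, g (r - 1)`. -/
def exSets (r : ℕ) (g : ℕ → ℕ) (φ : MSO) : MSO := Nat.rec φ (fun k ψ => exSet (g k) ψ) r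

/-- Universal quantification over the set variables `g 0, …, g (r - 1)`. -/
def allSets (r : ℕ) (g : ℕ → ℕ) (φ : MSO) : MSO := Nat.rec φ (fun k ψ => allSet (g k) ψ) r

/-- Existential quantification over the variables `0, …, r - 1`. -/
def exVars (r : ℕ) (φ : MSO) : MSO := Nat.rec φ (fun k ψ => ex k ψ) r

/-- A closed formula obtained by existential quantification over all variables that may occur. -/
def close (φ : MSO) : MSO :=
  exVars (φ.code.sum + 1) (exSets (φ.code.sum + 1) id φ)

/-! ### Semantics of the abbreviations -/

section Semantics

variable {A : Type u} {M : ColStructure A} {s : ℕ → A} {S : ℕ → Set A}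

@[simp] theorem sat_eq {x y} : Sat M (eq x y) s S ↔ s x = s y := Iff.rfl
@[simp] theorem sat_unary {U x} : Sat M (unary U x) s S ↔ s x ∈ M.interp U := Iff.rfl
@[simp] theorem sat_inc {x y} : Sat M (inc x y) s S ↔ M.inc (s x) (s y) := Iff.rfl
@[simp] theorem sat_mem {x X} : Sat M (mem x X) s S ↔ s x ∈ S X := Iff.rfl
@[simp] theorem sat_not {φ} : Sat M (not φ) s S ↔ ¬ Sat M φ s S := Iff.rfl
@[simp] theorem sat_and {φ ψ} : Sat M (and φ ψ) s S ↔ Sat M φ s S ∧ Sat M ψ s S := Iff.rfl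
@[simp] theorem sat_or {φ ψ} : Sat M (or φ ψ) s S ↔ Sat M φ s S ∨ Sat M ψ s S := Iff.rfl
@[simp] theorem sat_ex {x φ} :
    Sat M (ex x φ) s S ↔ ∃ a : A, Sat M φ (Function.update s x a) S := Iff.rfl
@[simp] theorem sat_all {x φ} :
    Sat M (all x φ) s S ↔ ∀ a : A, Sat M φ (Function.update s x a) S := Iff.rfl
@[simp] theorem sat_exSet {X φ} :
    Sat M (exSet X φ) s S ↔ ∃ U : Set A, Sat M φ s (Function.update S X U) := Iff.rfl
@[simp] theorem sat_allSet {X φ} :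
    Sat M (allSet X φ) s S ↔ ∀ U : Set A, Sat M φ s (Function.update S X U) := Iff.rfl

@[simp] theorem sat_imp {φ ψ} : Sat M (imp φ ψ) s S ↔ (Sat M φ s S → Sat M ψ s S) := by
  simp only [imp, sat_or, sat_not]; tauto

@[simp] theorem sat_falsum : ¬ Sat M falsum s S := by
  simp [falsum]

@[simp] theorem sat_bigOr {r f} : Sat M (bigOr r f) s S ↔ ∃ q < r, Sat M (f q) s S := by
  induction r with
  | zero => simp [bigOr]
  | succ r ih =>
    have : bigOr (r + 1) f = or (f r) (bigOr r f) := rfl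
    rw [this, sat_or, ih]
    constructor
    · rintro (h | ⟨q, hq, h⟩)
      · exact ⟨r, by omega, h⟩
      · exact ⟨q, by omega, h⟩
    · rintro ⟨q, hq, h⟩
      rcases Nat.lt_succ_iff_lt_or_eq.1 hq with h' | rfl
      · exact Or.inr ⟨q, h', h⟩
      · exact Or.inl h

@[simp] theorem sat_bigAnd {r f} : Sat M (bigAnd r f) s S ↔ ∀ q < r, Sat M (f q) s S := by
  simp [bigAnd]

/-- A block of set quantifiers may reassign its variables in any way, so it acts as a single
quantifier over assignments that agree off the block. Later on, the block consists of all sets that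
encode one computation. -/
theorem sat_exSets {r g φ} : Sat M (exSets r g φ) s S ↔
    ∃ S', (∀ X, (∀ k < r, X ≠ g k) → S' X = S X) ∧ Sat M φ s S' := by
  induction r generalizing S with
  | zero =>
    constructor
    · exact fun h => ⟨S, fun _ _ => rfl, h⟩
    · rintro ⟨S', h, h'⟩
      have : S' = S := funext fun X => h X (by simp)
      exact this ▸ h'
  | succ r ih =>
    have : exSets (r + 1) g φ = exSet (g r) (exSets r g φ) := rfl
    rw [this, sat_exSet]
    simp only [ih]
    constructor
    · rintro ⟨U, S', h, h'⟩
      refine ⟨S', fun X hX => ?_, h'⟩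
      rw [h X fun k hk => hX k (by omega), Function.update_of_ne (hX r (by omega))]
    · rintro ⟨S', h, h'⟩
      refine ⟨S' (g r), S', fun X hX => ?_, h'⟩
      by_cases hr : X = g r
      · subst hr; simp
      · rw [Function.update_of_ne hr]
        refine h X fun k hk => ?_
        rcases Nat.lt_succ_iff_lt_or_eq.1 hk with h' | rfl
        · exact hX k h'
        · exact hr

theorem sat_allSets {r g φ} : Sat M (allSets r g φ) s S ↔
    ∀ S', (∀ X, (∀ k < r, X ≠ g k) → S' X = S X) → Sat M φ s S' := by
  have key : Sat M (allSets r g φ) s S ↔ ¬ Sat M (exSets r g (not φ)) s S := by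
    induction r generalizing S with
    | zero => exact (not_not).symm
    | succ r ih =>
      have h1 : allSets (r + 1) g φ = allSet (g r) (allSets r g φ) := rfl
      have h2 : exSets (r + 1) g (not φ) = exSet (g r) (exSets r g (not φ)) := rfl
      rw [h1, h2, sat_allSet, sat_exSet]
      simp only [ih, not_exists]
  rw [key, sat_exSets]
  simp

theorem sat_exVars_of {r φ} (h : ∀ s, Sat M φ s S) : Sat M (exVars r φ) s S := by
  induction r generalizing s with
  | zero => exact h s
  | succ r ih => exact ⟨s r, ih⟩

theorem exists_of_sat_exVars {r φ} (h : Sat M (exVars r φ) s S) : ∃ s', Sat M φ s' S := by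
  induction r generalizing s with
  | zero => exact ⟨s, h⟩
  | succ r ih => exact ih h.choose_spec

/-- Closing changes nothing if the truth value does not depend on the assignment. This replaces any
bookkeeping of bound variables; the universe has to be nonempty for an assignment to exist. -/
theorem models_close_iff [Nonempty A] {φ : MSO} {p : Prop} (h : ∀ s S, Sat M φ s S ↔ p) :
    M.Models (close φ) ↔ p := by
  constructor
  · intro hm
    obtain ⟨s', hs⟩ := exists_of_sat_exVars (hm (fun _ => Classical.arbitrary A) fun _ => ∅)
    obtain ⟨S', -, hS⟩ := sat_exSets.1 hs
    exact (h s' S').1 hS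
  · intro hp s S
    exact sat_exVars_of fun s => sat_exSets.2 ⟨S, fun _ _ => rfl, (h s S).2 hp⟩

end Semantics

/-! ### Free variables and sentences -/

section Free

/-- The number of a free variable is an entry of the code, hence at most the sum of its entries.
This is where the bound in `close` comes from. -/
theorem free_le_sum (φ : MSO) : ∀ x ∈ φ.free, x ≤ φ.code.sum := by
  induction φ <;> simp only [free, code, List.sum_cons, List.sum_append, List.sum_nil,
    Finset.mem_insert, Finset.mem_singleton, Finset.mem_union, Finset.mem_erase] <;>
    intro x hx <;> grind

theorem freeSet_le_sum (φ : MSO) : ∀ x ∈ φ.freeSet, x ≤ φ.code.sum := by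
  induction φ <;> simp only [freeSet, code, List.sum_cons, List.sum_append, List.sum_nil,
    Finset.notMem_empty, Finset.mem_singleton, Finset.mem_union, Finset.mem_erase] <;>
    intro x hx <;> grind

theorem free_exSets (r g φ) : (exSets r g φ).free = φ.free := by
  induction r with
  | zero => rfl
  | succ r ih => exact ih

theorem mem_freeSet_exSets {r g φ X} :
    X ∈ (exSets r g φ).freeSet ↔ X ∈ φ.freeSet ∧ ∀ k < r, X ≠ g k := by
  induction r with
  | zero => simp [exSets]
  | succ r ih =>
    have : (exSets (r + 1) g φ).freeSet = (exSets r g φ).freeSet.erase (g r) := rfl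
    rw [this, Finset.mem_erase, ih]
    simp only [Nat.lt_succ_iff_lt_or_eq]
    grind

theorem freeSet_exVars (r φ) : (exVars r φ).freeSet = φ.freeSet := by
  induction r with
  | zero => rfl
  | succ r ih => exact ih

theorem mem_free_exVars {r φ x} : x ∈ (exVars r φ).free ↔ x ∈ φ.free ∧ r ≤ x := by
  induction r with
  | zero => simp [exVars]
  | succ r ih =>
    have : (exVars (r + 1) φ).free = (exVars r φ).free.erase r := rfl
    rw [this, Finset.mem_erase, ih]
    grind

theorem isSentence_close (φ : MSO) : (close φ).IsSentence := by
  constructor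
  · ext x
    simp only [close, mem_free_exVars, free_exSets, Finset.notMem_empty, iff_false, not_and]
    intro h
    have := free_le_sum φ x h
    omega
  · ext X
    simp only [close, freeSet_exVars, mem_freeSet_exSets, Finset.notMem_empty, iff_false, not_and,
      id]
    intro h h'
    exact h' X (by have := freeSet_le_sum φ X h; omega) rfl

end Free

/-! ### Primitive recursive families of formulas -/

section Computability

variable {α : Type*} [Primcodable α]

/-- A family of formulas the code of which is a primitive recursive function of the parameter. -/
def PrimFam (φ : α → MSO) : Prop := Primrec fun a => (φ a).code

theorem PrimFam.const (φ : MSO) : PrimFam fun _ : α => φ := Primrec.const _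

theorem PrimFam.mem {x X : α → ℕ} (hx : Primrec x) (hX : Primrec X) :
    PrimFam fun a => MSO.mem (x a) (X a) :=
  Primrec.list_cons.comp (Primrec.const 3)
    (Primrec.list_cons.comp hx (Primrec.list_cons.comp hX (Primrec.const [])))

theorem PrimFam.not {φ : α → MSO} (h : PrimFam φ) : PrimFam fun a => MSO.not (φ a) :=
  Primrec.list_cons.comp (Primrec.const 4) h

theorem PrimFam.and {φ ψ : α → MSO} (h : PrimFam φ) (h' : PrimFam ψ) :
    PrimFam fun a => MSO.and (φ a) (ψ a) :=
  Primrec.list_cons.comp (Primrec.const 5) (Primrec.list_append.comp h h')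

theorem PrimFam.or {φ ψ : α → MSO} (h : PrimFam φ) (h' : PrimFam ψ) :
    PrimFam fun a => MSO.or (φ a) (ψ a) :=
  Primrec.list_cons.comp (Primrec.const 6) (Primrec.list_append.comp h h')

theorem PrimFam.imp {φ ψ : α → MSO} (h : PrimFam φ) (h' : PrimFam ψ) :
    PrimFam fun a => MSO.imp (φ a) (ψ a) := h.not.or h'

theorem PrimFam.ex {φ : α → MSO} (x : ℕ) (h : PrimFam φ) : PrimFam fun a => MSO.ex x (φ a) :=
  Primrec.list_cons.comp (Primrec.const 7) (Primrec.list_cons.comp (Primrec.const x) h)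

theorem PrimFam.all {φ : α → MSO} (x : ℕ) (h : PrimFam φ) : PrimFam fun a => MSO.all x (φ a) :=
  Primrec.list_cons.comp (Primrec.const 8) (Primrec.list_cons.comp (Primrec.const x) h)

theorem PrimFam.ite {c : α → Prop} [DecidablePred c] {φ ψ : α → MSO} (hc : PrimrecPred c)
    (h : PrimFam φ) (h' : PrimFam ψ) : PrimFam fun a => if c a then φ a else ψ a :=
  (Primrec.ite hc h h').of_eq fun a => by dsimp only; split <;> rfl

theorem PrimFam.bigOr {r : α → ℕ} {f : α → ℕ → MSO} (hr : Primrec r)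
    (h : PrimFam fun p : α × ℕ => f p.1 p.2) : PrimFam fun a => MSO.bigOr (r a) (f a) := by
  have := Primrec.nat_rec' (f := r) (g := fun _ => falsum.code)
    (h := fun a (p : ℕ × List ℕ) => 6 :: ((f a p.1).code ++ p.2)) hr (Primrec.const _)
    (Primrec.list_cons.comp (Primrec.const 6) (Primrec.list_append.comp
      (h.comp (Primrec.pair Primrec.fst (Primrec.fst.comp Primrec.snd)))
      (Primrec.snd.comp Primrec.snd)))
  refine this.of_eq fun a => ?_
  dsimp only
  generalize r a = m
  induction m with
  | zero => rfl
  | succ n ih => simp only [ih]; rfl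

theorem PrimFam.bigAnd {r : α → ℕ} {f : α → ℕ → MSO} (hr : Primrec r)
    (h : PrimFam fun p : α × ℕ => f p.1 p.2) : PrimFam fun a => MSO.bigAnd (r a) (f a) :=
  (PrimFam.bigOr hr h.not).not

theorem PrimFam.exSets {r : α → ℕ} {g : ℕ → ℕ} {φ : α → MSO} (hr : Primrec r) (hg : Primrec g)
    (h : PrimFam φ) : PrimFam fun a => MSO.exSets (r a) g (φ a) := by
  have := Primrec.nat_rec' (f := r) (g := fun a => (φ a).code)
    (h := fun _ (p : ℕ × List ℕ) => 9 :: g p.1 :: p.2) hr h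
    (Primrec.list_cons.comp (Primrec.const 9) (Primrec.list_cons.comp
      (hg.comp (Primrec.fst.comp Primrec.snd)) (Primrec.snd.comp Primrec.snd)))
  refine this.of_eq fun a => ?_
  dsimp only
  generalize r a = m
  induction m with
  | zero => rfl
  | succ n ih => simp only [ih]; rfl

theorem PrimFam.allSets {r : α → ℕ} {g : ℕ → ℕ} {φ : α → MSO} (hr : Primrec r) (hg : Primrec g)
    (h : PrimFam φ) : PrimFam fun a => MSO.allSets (r a) g (φ a) := by
  have := Primrec.nat_rec' (f := r) (g := fun a => (φ a).code)
    (h := fun _ (p : ℕ × List ℕ) => 10 :: g p.1 :: p.2) hr h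
    (Primrec.list_cons.comp (Primrec.const 10) (Primrec.list_cons.comp
      (hg.comp (Primrec.fst.comp Primrec.snd)) (Primrec.snd.comp Primrec.snd)))
  refine this.of_eq fun a => ?_
  dsimp only
  generalize r a = m
  induction m with
  | zero => rfl
  | succ n ih => simp only [ih]; rfl

theorem PrimFam.exVars {r : α → ℕ} {φ : α → MSO} (hr : Primrec r) (h : PrimFam φ) :
    PrimFam fun a => MSO.exVars (r a) (φ a) := by
  have := Primrec.nat_rec' (f := r) (g := fun a => (φ a).code)
    (h := fun _ (p : ℕ × List ℕ) => 7 :: p.1 :: p.2) hr h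
    (Primrec.list_cons.comp (Primrec.const 7) (Primrec.list_cons.comp
      (Primrec.fst.comp Primrec.snd) (Primrec.snd.comp Primrec.snd)))
  refine this.of_eq fun a => ?_
  dsimp only
  generalize r a = m
  induction m with
  | zero => rfl
  | succ n ih => simp only [ih]; rfl

theorem PrimFam.close {φ : α → MSO} (h : PrimFam φ) : PrimFam fun a => MSO.close (φ a) := by
  have hs : Primrec fun a => (φ a).code.sum + 1 := by
    have := Primrec.list_foldr (f := fun a => (φ a).code) (g := fun _ => 0)
      (h := fun _ (p : ℕ × ℕ) => p.1 + p.2) h (Primrec.const 0)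
      (Primrec.nat_add.comp (Primrec.fst.comp Primrec.snd) (Primrec.snd.comp Primrec.snd))
    exact Primrec.succ.comp (this.of_eq fun a => by rw [List.sum_eq_foldr])
  exact PrimFam.exVars hs (PrimFam.exSets hs Primrec.id h)

/-- Iteration of a formula transformer that acts on codes in a primitive recursive way. -/
theorem PrimFam.iterate {r : α → ℕ} {F : α → MSO → MSO} {G : α → List ℕ → List ℕ} {φ : α → MSO}
    (hr : Primrec r) (hG : Primrec₂ G) (hF : ∀ a ψ, (F a ψ).code = G a ψ.code) (h : PrimFam φ) :
    PrimFam fun a => (Nat.rec (φ a) (fun _ ψ => F a ψ) (r a) : MSO) := by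
  have := Primrec.nat_rec' (f := r) (g := fun a => (φ a).code)
    (h := fun a (p : ℕ × List ℕ) => G a p.2) hr h
    (hG.comp Primrec.fst (Primrec.snd.comp Primrec.snd))
  refine this.of_eq fun a => ?_
  dsimp only
  generalize r a = m
  induction m with
  | zero => rfl
  | succ n ih => simp only [ih, hF]

end Computability

end MSO

/-! ### The interpretation of a linearly ordered set with binary relations

The set variables `0, 1, 2` are used for a set of edges of the first layer, a set of edges of the
second layer, and a set of vertices at which one may switch between the layers. In the first layer
we walk on vertices, in the second layer on edges. The set variable `3` is used for the domain and
`4, 6, 8` for the order. -/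

namespace ColStructure

variable {A : Type u} (M : ColStructure A) (S : ℕ → Set A)

/-- A vertex at which two paths cross belongs to the first layer as a vertex, and to the second
layer only through its edges. So crossing paths remain separate unless the vertex is in `S 2`. -/
def LayerAdj (x y : A) : Prop :=
  (∃ e, e ∈ S 0 ∧ M.inc x e ∧ M.inc y e) ∨ (x ∈ S 1 ∧ y ∈ S 1) ∧ (∃ v, M.inc v x ∧ M.inc v y) ∨
    (x ∈ S 2 ∧ y ∈ S 1 ∧ M.inc x y) ∨ y ∈ S 2 ∧ x ∈ S 1 ∧ M.inc y x

def LayerConn (x y : A) : Prop :=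
  ∀ X : Set A, x ∈ X → (∀ u v, u ∈ X → M.LayerAdj S u v → v ∈ X) → y ∈ X

/-- The binary relation encoded by the sets `S Z, S (Z + 2), S (Z + 4)`. -/
def CodedRel (Z : ℕ) (x y : A) : Prop :=
  (∃ v, v ∈ S Z ∧ M.LayerConn S v x ∧ ∃ f, f ∈ S 1 ∧ M.inc v f ∧ M.LayerConn S f y) ∨
  (∃ v, v ∈ S (Z + 2) ∧ M.LayerConn S v y ∧ ∃ f, f ∈ S 1 ∧ M.inc v f ∧ M.LayerConn S f x) ∨
  x = y ∧ x ∈ S (Z + 4)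

/-- The first vertex of the coloured path. -/
def IsStart (x : A) : Prop :=
  ∃ e, e ∈ M.B ∧ M.inc x e ∧ ∀ f, f ∈ M.B ∨ f ∈ M.R → M.inc x f → f = e

/-- The order on the coloured path. -/
def PathLt (x y : A) : Prop :=
  ∀ X : Set A, (∀ a, M.IsStart a → a ≠ y → a ∈ X) →
    (∀ a b e, a ∈ X → b ≠ y → (e ∈ M.B ∨ e ∈ M.R) → M.inc a e → M.inc b e → b ∈ X) → x ∈ X

/-- The vertices of the coloured path that stand for a letter. -/
def IsLetter (x : A) : Prop :=
  (∃ e, (e ∈ M.B ∨ e ∈ M.R) ∧ M.inc x e) ∧ (x ∈ M.C0 ∨ x ∈ M.C1) ∧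
    ((∀ e f, e ∈ M.B → f ∈ M.B → e = f) ∨
      ∃ e y, e ∈ M.B ∧ M.inc x e ∧ M.inc y e ∧ M.PathLt y x)

/-- The vertex `v` lies on the piece of `x` in the first layer, and on the piece of `y` in the second
layer, and on no other pieces of elements of `D`. -/
def IsLink (D : Set A) (v x y : A) : Prop :=
  M.LayerConn S v x ∧ (∀ z, z ∈ D → M.LayerConn S v z → z = x) ∧
    (∃ f, f ∈ S 1 ∧ M.inc v f ∧ M.LayerConn S f y) ∧
    ∀ z, z ∈ D → ∀ f, f ∈ S 1 → M.inc v f → M.LayerConn S f z → z = y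

/-- The order on the domain is linear, any two elements of the domain are linked, and the letters
are assigned to an initial segment of the
domain in their order along the coloured path. -/
structure IsFrame : Prop where
  irrefl : ∀ x, x ∈ S 3 → ¬ M.CodedRel S 4 x x
  trans : ∀ x, x ∈ S 3 → ∀ y, y ∈ S 3 → ∀ z, z ∈ S 3 →
    M.CodedRel S 4 x y → M.CodedRel S 4 y z → M.CodedRel S 4 x z
  total : ∀ x, x ∈ S 3 → ∀ y, y ∈ S 3 → x = y ∨ M.CodedRel S 4 x y ∨ M.CodedRel S 4 y x
  link : ∀ x, x ∈ S 3 → ∀ y, y ∈ S 3 → x = y ∨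
    ∃ v, M.IsLink S (S 3) v x y ∨ M.IsLink S (S 3) v y x
  total_letter : ∀ x, M.IsLetter x → ∃ i, i ∈ S 3 ∧ M.LayerConn S x i
  functional_letter : ∀ x, M.IsLetter x → ∀ i, i ∈ S 3 → ∀ j, j ∈ S 3 →
    M.LayerConn S x i → M.LayerConn S x j → i = j
  mono_letter : ∀ x, M.IsLetter x → ∀ y, M.IsLetter y → ∀ i, i ∈ S 3 → ∀ j, j ∈ S 3 →
    M.LayerConn S x i → M.LayerConn S y j → M.PathLt x y → M.CodedRel S 4 i j
  initial_letter : ∀ x, M.IsLetter x → ∀ i, i ∈ S 3 → ∀ j, j ∈ S 3 → M.CodedRel S 4 i j →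
    M.LayerConn S x j → ∃ y, M.IsLetter y ∧ M.LayerConn S y i

/-- The letter at `x`, where `C` is one of the colours. -/
def HasLetter (C : Set A) (x : A) : Prop :=
  ∃ y, M.IsLetter y ∧ y ∈ C ∧ M.LayerConn S y x

end ColStructure

/-! ### Formulas that define the interpretation -/

namespace MSO

def layerAdj : MSO :=
  or (ex 2 (and (mem 2 0) (and (inc 0 2) (inc 1 2))))
    (or (and (and (mem 0 1) (mem 1 1)) (ex 2 (and (inc 2 0) (inc 2 1))))
      (or (and (mem 0 2) (and (mem 1 1) (inc 0 1))) (and (mem 1 2) (and (mem 0 1) (inc 1 0)))))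

/-- The variables `0` and `1`, the arguments of `layerAdj`, are rebound inside, but `mem x 5` and
`mem y 5` lie outside their scope, so `x` and `y` may be any variables. -/
def layerConn (x y : ℕ) : MSO :=
  allSet 5 (imp (mem x 5)
    (imp (all 0 (all 1 (imp (mem 0 5) (imp layerAdj (mem 1 5))))) (mem y 5)))

/-- The bound variables are `x + y + 1` and `x + y + 2` because these differ from both `x` and `y`.
The set variables `Z`, `Z + 2`, `Z + 4` have the same parity, which later keeps a relation inside
one slot. -/
def codedRel (Z x y : ℕ) : MSO :=
  or (ex (x + y + 1) (and (mem (x + y + 1) Z) (and (layerConn (x + y + 1) x)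
      (ex (x + y + 2) (and (mem (x + y + 2) 1) (and (inc (x + y + 1) (x + y + 2))
        (layerConn (x + y + 2) y)))))))
    (or (ex (x + y + 1) (and (mem (x + y + 1) (Z + 2)) (and (layerConn (x + y + 1) y)
      (ex (x + y + 2) (and (mem (x + y + 2) 1) (and (inc (x + y + 1) (x + y + 2))
        (layerConn (x + y + 2) x)))))))
      (and (eq x y) (mem x (Z + 4))))

def isColoured (x : ℕ) : MSO := or (unary .B x) (unary .R x)

def isStart (x : ℕ) : MSO :=
  ex (x + 1) (and (unary .B (x + 1)) (and (inc x (x + 1))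
    (all (x + 2) (imp (isColoured (x + 2)) (imp (inc x (x + 2)) (eq (x + 2) (x + 1)))))))

def pathLt (x y : ℕ) : MSO :=
  allSet 7 (imp (all (y + 1) (imp (isStart (y + 1)) (imp (not (eq (y + 1) y)) (mem (y + 1) 7))))
    (imp (all (y + 1) (all (y + 2) (all (y + 3) (imp (mem (y + 1) 7) (imp (not (eq (y + 2) y))
      (imp (isColoured (y + 3)) (imp (inc (y + 1) (y + 3)) (imp (inc (y + 2) (y + 3))
        (mem (y + 2) 7)))))))))
      (mem x 7)))

def isLetter (x : ℕ) : MSO :=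
  and (ex (x + 1) (and (isColoured (x + 1)) (inc x (x + 1))))
    (and (or (unary .C0 x) (unary .C1 x))
      (or (all 0 (all 1 (imp (unary .B 0) (imp (unary .B 1) (eq 0 1)))))
        (ex (x + 1) (ex (x + 2) (and (unary .B (x + 1)) (and (inc x (x + 1))
          (and (inc (x + 2) (x + 1)) (pathLt (x + 2) x))))))))

/-- Quantification over the domain. -/
def exDom (x : ℕ) (φ : MSO) : MSO := ex x (and (mem x 3) φ)

/-- Quantification over the domain. -/
def allDom (x : ℕ) (φ : MSO) : MSO := all x (imp (mem x 3) φ)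

def isLink (v x y : ℕ) : MSO :=
  and (layerConn v x) (and (allDom (v + x + y + 1) (imp (layerConn v (v + x + y + 1))
      (eq (v + x + y + 1) x)))
    (and (ex (v + x + y + 1) (and (mem (v + x + y + 1) 1) (and (inc v (v + x + y + 1))
      (layerConn (v + x + y + 1) y))))
    (allDom (v + x + y + 1) (all (v + x + y + 2) (imp (mem (v + x + y + 2) 1)
      (imp (inc v (v + x + y + 2)) (imp (layerConn (v + x + y + 2) (v + x + y + 1))
        (eq (v + x + y + 1) y))))))))

def isFrame : MSO :=
  and (allDom 0 (not (codedRel 4 0 0))) <|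
  and (allDom 0 (allDom 1 (allDom 2 (imp (codedRel 4 0 1) (imp (codedRel 4 1 2)
    (codedRel 4 0 2)))))) <|
  and (allDom 0 (allDom 1 (or (eq 0 1) (or (codedRel 4 0 1) (codedRel 4 1 0))))) <|
  and (allDom 0 (allDom 1 (or (eq 0 1) (ex 2 (or (isLink 2 0 1) (isLink 2 1 0)))))) <|
  and (all 0 (imp (isLetter 0) (exDom 1 (layerConn 0 1)))) <|
  and (all 0 (imp (isLetter 0) (allDom 1 (allDom 2 (imp (layerConn 0 1) (imp (layerConn 0 2)
    (eq 1 2))))))) <|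
  and (all 0 (imp (isLetter 0) (all 1 (imp (isLetter 1) (allDom 2 (allDom 3
    (imp (layerConn 0 2) (imp (layerConn 1 3) (imp (pathLt 0 1) (codedRel 4 2 3)))))))))) <|
  all 0 (imp (isLetter 0) (allDom 1 (allDom 2 (imp (codedRel 4 1 2) (imp (layerConn 0 2)
    (ex 3 (and (isLetter 3) (layerConn 3 1))))))))

def hasLetter (U : UnarySym) (x : ℕ) : MSO :=
  ex (x + 1) (and (isLetter (x + 1)) (and (unary U (x + 1)) (layerConn (x + 1) x)))

variable {A : Type u} {M : ColStructure A} {s : ℕ → A} {S : ℕ → Set A}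

@[simp] theorem sat_layerConn {x y} :
    Sat M (layerConn x y) s S ↔ M.LayerConn S (s x) (s y) := by
  simp [layerConn, layerAdj, ColStructure.LayerConn, ColStructure.LayerAdj]

@[simp] theorem sat_codedRel {Z x y} :
    Sat M (codedRel Z x y) s S ↔ M.CodedRel S Z (s x) (s y) := by
  have h1 : x ≠ x + y + 1 := by omega
  have h2 : x ≠ x + y + 2 := by omega
  have h3 : y ≠ x + y + 1 := by omega
  have h4 : y ≠ x + y + 2 := by omega
  simp [codedRel, ColStructure.CodedRel, h1, h2, h3, h4]

@[simp] theorem sat_isColoured {x} :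
    Sat M (isColoured x) s S ↔ s x ∈ M.B ∨ s x ∈ M.R := Iff.rfl

@[simp] theorem sat_isStart {x} : Sat M (isStart x) s S ↔ M.IsStart (s x) := by
  simp [isStart, ColStructure.IsStart, ColStructure.interp]

@[simp] theorem sat_pathLt {x y} :
    Sat M (pathLt x y) s S ↔ M.PathLt (s x) (s y) := by
  simp [pathLt, ColStructure.PathLt]

@[simp] theorem sat_isLetter {x} : Sat M (isLetter x) s S ↔ M.IsLetter (s x) := by
  simp [isLetter, ColStructure.IsLetter, ColStructure.interp]

@[simp] theorem sat_exDom {x φ} :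
    Sat M (exDom x φ) s S ↔ ∃ a, a ∈ S 3 ∧ Sat M φ (Function.update s x a) S := by
  simp [exDom]

@[simp] theorem sat_allDom {x φ} :
    Sat M (allDom x φ) s S ↔ ∀ a, a ∈ S 3 → Sat M φ (Function.update s x a) S := by
  simp [allDom]

@[simp] theorem sat_isLink {v x y} :
    Sat M (isLink v x y) s S ↔ M.IsLink S (S 3) (s v) (s x) (s y) := by
  have h1 : v ≠ v + x + y + 1 := by omega
  have h2 : v ≠ v + x + y + 2 := by omega
  have h3 : x ≠ v + x + y + 1 := by omega
  have h4 : y ≠ v + x + y + 1 := by omega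
  have h5 : y ≠ v + x + y + 2 := by omega
  simp [isLink, ColStructure.IsLink, h1, h2, h3, h4, h5]

theorem sat_isFrame : Sat M isFrame s S ↔ M.IsFrame S := by
  constructor
  · intro h
    simp only [isFrame, sat_and, sat_allDom, sat_not, sat_codedRel, sat_imp, sat_or, sat_eq,
      sat_all, sat_isLetter, sat_exDom, sat_layerConn, sat_pathLt, sat_ex, sat_isLink] at h
    obtain ⟨h1, h2, h3, h4, h5, h6, h7, h8⟩ := h
    simp at h1 h2 h3 h4 h5 h6 h7 h8
    exact ⟨h1, h2, h3, h4, h5, h6, h7, h8⟩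
  · rintro ⟨h1, h2, h3, h4, h5, h6, h7, h8⟩
    simp only [isFrame, sat_and, sat_allDom, sat_not, sat_codedRel, sat_imp, sat_or, sat_eq,
      sat_all, sat_isLetter, sat_exDom, sat_layerConn, sat_pathLt, sat_ex, sat_isLink]
    simp
    exact ⟨h1, h2, h3, h4, h5, h6, h7, h8⟩

@[simp] theorem sat_hasLetter {U x} :
    Sat M (hasLetter U x) s S ↔ M.HasLetter S (M.interp U) (s x) := by
  simp [hasLetter, ColStructure.HasLetter]

end MSO

/-! ### Frames as finite linear orders with a word, and the coding of relations -/

namespace ColStructure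

variable {A : Type u} (M : ColStructure A)

/-- `x` enumerates the vertices standing for letters, and they spell the word `w`. -/
structure Spells (w : List Bool) (x : Fin w.length → A) : Prop where
  isLetter_iff : ∀ z, M.IsLetter z ↔ ∃ j, x j = z
  lt_iff : ∀ i j, M.PathLt (x i) (x j) ↔ i < j
  mem_C1_iff : ∀ j, x j ∈ M.C1 ↔ w[j] = true
  mem_C0_iff : ∀ j, x j ∈ M.C0 ↔ w[j] = false

/-- The domain together with its order and the letters is isomorphic, via `e`, to
`{0, …, n - 1}` with the word `w`. -/
structure IsEnum (S : ℕ → Set A) (w : List Bool) {n : ℕ} (e : Fin n → A) : Prop where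
  length_le : w.length ≤ n
  mem_dom_iff : ∀ z, z ∈ S 3 ↔ ∃ i, e i = z
  lt_iff : ∀ i j, M.CodedRel S 4 (e i) (e j) ↔ i < j
  letter_one : ∀ i, M.HasLetter S M.C1 (e i) ↔ w[(i : ℕ)]? = some true
  letter_zero : ∀ i, M.HasLetter S M.C0 (e i) ↔ w[(i : ℕ)]? = some false

variable {M}

theorem IsEnum.injective {S : ℕ → Set A} {w : List Bool} {n : ℕ} {e : Fin n → A}
    (h : M.IsEnum S w e) : Function.Injective e := by
  intro i j hij
  have h1 := h.lt_iff i i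
  have h2 := h.lt_iff i j
  have h3 := h.lt_iff j i
  rw [hij] at h1 h2 h3
  have h4 : ¬ i < j := fun h' => lt_irrefl i (h1.1 (h2.2 h'))
  have h5 : ¬ j < i := fun h' => lt_irrefl i (h1.1 (h3.2 h'))
  exact le_antisymm (not_lt.1 h5) (not_lt.1 h4)

/-- Every binary relation on the domain can be encoded. -/
def CodesAll (S : ℕ → Set A) {n : ℕ} (e : Fin n → A) : Prop :=
  ∀ (Z : ℕ) (r : Fin n → Fin n → Prop), ∃ Z₀ Z₁ Z₂ : Set A, ∀ S' : ℕ → Set A,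
    (∀ X < 3, S' X = S X) → S' Z = Z₀ → S' (Z + 2) = Z₁ → S' (Z + 4) = Z₂ →
    ∀ i j, M.CodedRel S' Z (e i) (e j) ↔ r i j

theorem LayerConn.congr {S S' : ℕ → Set A} (h : ∀ X < 3, S' X = S X) :
    M.LayerConn S' = M.LayerConn S := by
  funext x y
  simp only [LayerConn, LayerAdj, h 0 (by omega), h 1 (by omega), h 2 (by omega)]

/-- The uniqueness clauses in `IsLink` make a link vertex determine its ordered pair, so a set of
link vertices is a set of pairs. The link of two elements may have either orientation, whence the
first two sets; the third one takes care of the diagonal, for which there is no link. -/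
theorem codesAll_of_isLink {S : ℕ → Set A} {n : ℕ} {e : Fin n → A} (hinj : Function.Injective e)
    (h : ∀ i j, i ≠ j → ∃ v, M.IsLink S (Set.range e) v (e i) (e j) ∨
      M.IsLink S (Set.range e) v (e j) (e i)) : M.CodesAll S e := by
  intro Z r
  refine ⟨{v | ∃ i j, r i j ∧ M.IsLink S (Set.range e) v (e i) (e j)},
    {v | ∃ i j, r i j ∧ M.IsLink S (Set.range e) v (e j) (e i)},
    {v | ∃ i, r i i ∧ v = e i}, fun S' hS h0 h1 h2 i j => ?_⟩
  unfold CodedRel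
  rw [LayerConn.congr hS, h0, h1, h2, hS 1 (by omega)]
  constructor
  · rintro (⟨v, ⟨i', j', hr, -, hu, -, hu'⟩, hc, f, hf1, hvf, hc'⟩ |
      ⟨v, ⟨i', j', hr, -, hu, -, hu'⟩, hc, f, hf1, hvf, hc'⟩ | ⟨hij, i', hr, hi'⟩)
    · rwa [hinj (hu _ ⟨_, rfl⟩ hc), hinj (hu' _ ⟨_, rfl⟩ f hf1 hvf hc')]
    · rwa [hinj (hu _ ⟨_, rfl⟩ hc), hinj (hu' _ ⟨_, rfl⟩ f hf1 hvf hc')]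
    · rwa [← hinj hij, hinj hi']
  · intro hr
    by_cases hij : i = j
    · subst hij
      exact Or.inr (Or.inr ⟨rfl, i, hr, rfl⟩)
    · obtain ⟨v, hv | hv⟩ := h i j hij
      · exact Or.inl ⟨v, ⟨i, j, hr, hv⟩, hv.1, hv.2.2.1⟩
      · exact Or.inr (Or.inl ⟨v, ⟨i, j, hr, hv⟩, hv.1, hv.2.2.1⟩)

theorem CodesAll.congr {S S' : ℕ → Set A} (hS : ∀ X < 3, S' X = S X) {n : ℕ} {e : Fin n → A}
    (h : M.CodesAll S e) : M.CodesAll S' e := by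
  intro Z r
  obtain ⟨Z₀, Z₁, Z₂, h'⟩ := h Z r
  exact ⟨Z₀, Z₁, Z₂, fun S'' h'' => h' S'' fun X hX => (h'' X hX).trans (hS X hX)⟩

theorem exists_enum_of_strictTotal [Finite A] (D : Set A) (r : A → A → Prop)
    (irrefl : ∀ x ∈ D, ¬ r x x) (trans : ∀ x ∈ D, ∀ y ∈ D, ∀ z ∈ D, r x y → r y z → r x z)
    (total : ∀ x ∈ D, ∀ y ∈ D, x = y ∨ r x y ∨ r y x) :
    ∃ (n : ℕ) (e : Fin n → A), (∀ z, z ∈ D ↔ ∃ i, e i = z) ∧ ∀ i j, r (e i) (e j) ↔ i < j := by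
  classical
  let r' : D → D → Prop := fun x y => r x y
  have : IsStrictTotalOrder D r' :=
    { irrefl := fun x => irrefl x x.2
      trans := fun x y z => trans x x.2 y y.2 z z.2
      trichotomous := fun x y h1 h2 => by
        rcases total x x.2 y y.2 with h | h | h
        · exact Subtype.ext h
        · exact absurd h h1
        · exact absurd h h2 }
  let := linearOrderOfSTO r'
  have := Fintype.ofFinite D
  let f := Fintype.orderIsoFinOfCardEq D rfl
  refine ⟨_, fun i => f i, fun z => ⟨fun hz => ⟨f.symm ⟨z, hz⟩, by simp⟩, ?_⟩, fun i j => ?_⟩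
  · rintro ⟨i, rfl⟩
    exact (f i).2
  · exact f.lt_iff_lt (x := i) (y := j)

/-- The assignment of letters to the domain is strictly increasing with an initial segment as its
image, hence it sends the letter with number j to the element with number j. In particular, the word
fits into the domain. -/
theorem exists_isEnum [Finite A] {S : ℕ → Set A} {w : List Bool} {x : Fin w.length → A}
    (hx : M.Spells w x) (h : M.IsFrame S) :
    ∃ (n : ℕ) (e : Fin n → A), M.IsEnum S w e ∧ M.CodesAll S e := by
  obtain ⟨n, e, he, hlt⟩ := exists_enum_of_strictTotal (S 3) (M.CodedRel S 4) h.irrefl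
    h.trans h.total
  have hinj : Function.Injective e := by
    intro i j hij
    by_contra hne
    rcases lt_or_gt_of_ne hne with h' | h'
    · have := (hlt i j).2 h'
      rw [hij, hlt] at this
      exact lt_irrefl _ this
    · have := (hlt j i).2 h'
      rw [hij, hlt] at this
      exact lt_irrefl _ this
  have hmem : ∀ i, e i ∈ S 3 := fun i => (he _).2 ⟨i, rfl⟩
  have hL : ∀ j, M.IsLetter (x j) := fun j => (hx.isLetter_iff _).2 ⟨j, rfl⟩
  have hg : ∀ j, ∃ i, M.LayerConn S (x j) (e i) := fun j => by
    obtain ⟨z, hz, hc⟩ := h.total_letter _ (hL j)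
    obtain ⟨i, rfl⟩ := (he z).1 hz
    exact ⟨i, hc⟩
  choose g hg using hg
  have hgu : ∀ j i, M.LayerConn S (x j) (e i) → g j = i := fun j i hi =>
    hinj (h.functional_letter _ (hL j) _ (hmem _) _ (hmem _) (hg j) hi)
  have hmono : StrictMono g := fun i j hij => (hlt _ _).1 <|
    h.mono_letter _ (hL i) _ (hL j) _ (hmem _) _ (hmem _) (hg i) (hg j) ((hx.lt_iff i j).2 hij)
  have hini : ∀ i j, i < g j → ∃ j', g j' = i := fun i j hij => by
    obtain ⟨y, hy, hc⟩ := h.initial_letter _ (hL j) _ (hmem i) _ (hmem _) ((hlt _ _).2 hij) (hg j)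
    obtain ⟨j', rfl⟩ := (hx.isLetter_iff y).1 hy
    exact ⟨j', hgu _ _ hc⟩
  -- Strong induction on `m`. A value `g j < m` would be fixed by `g`, against strict monotonicity;
  -- if `g j > m`, then `m` would be a value of `g` at an index below `j`, which is fixed by `g`.
  have hval : ∀ m : ℕ, ∀ j : Fin w.length, (j : ℕ) = m → (g j : ℕ) = m := by
    intro m
    induction m using Nat.strong_induction_on with
    | _ m ih =>
      intro j hj
      have h1 : m ≤ g j := by
        by_contra hlt'
        have := ih (g j) (by omega) ⟨g j, by omega⟩ rfl
        have h2 : g ⟨g j, by omega⟩ < g j := hmono (by rw [Fin.lt_def]; simp; omega)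
        rw [Fin.lt_def] at h2
        omega
      by_contra hne
      obtain ⟨j', hj'⟩ := hini ⟨m, by omega⟩ j (by rw [Fin.lt_def]; simp; omega)
      have h3 : j' < j := hmono.lt_iff_lt.1 (by rw [hj', Fin.lt_def]; simp; omega)
      rw [Fin.lt_def] at h3
      have := ih j' (by omega) j' rfl
      rw [hj'] at this
      simp at this
      omega
  have key : ∀ (C : Set A) (i : Fin n), M.HasLetter S C (e i) ↔
      ∃ h : (i : ℕ) < w.length, x ⟨i, h⟩ ∈ C := by
    intro C i
    constructor
    · rintro ⟨y, hy, hC, hc⟩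
      obtain ⟨j, rfl⟩ := (hx.isLetter_iff y).1 hy
      have h1 := hgu _ _ hc
      have h2 := hval _ j rfl
      rw [h1] at h2
      exact ⟨h2 ▸ j.2, by simpa [h2] using hC⟩
    · rintro ⟨hi, hC⟩
      refine ⟨_, hL _, hC, ?_⟩
      have h2 := hval _ ⟨i, hi⟩ rfl
      have h3 : g ⟨i, hi⟩ = i := Fin.ext h2
      have h4 := hg ⟨i, hi⟩
      rwa [h3] at h4
  have h3 : S 3 = Set.range e := Set.ext he
  refine ⟨n, e, ⟨?_, he, hlt, fun i => ?_, fun i => ?_⟩, codesAll_of_isLink hinj fun i j hij => ?_⟩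
  · by_contra hn
    have h2 := hval n ⟨n, by omega⟩ rfl
    have := (g ⟨n, by omega⟩).2
    omega
  · rw [key, List.getElem?_eq_some_iff]
    exact exists_congr fun hi => hx.mem_C1_iff ⟨i, hi⟩
  · rw [key, List.getElem?_eq_some_iff]
    exact exists_congr fun hi => hx.mem_C0_iff ⟨i, hi⟩
  · rw [← h3]
    exact (h.link _ (hmem i) _ (hmem j)).resolve_left (hinj.ne hij)

theorem IsEnum.congr {S S' : ℕ → Set A} {w : List Bool} {n : ℕ} {e : Fin n → A}
    (hS : ∀ X < 10, S' X = S X) (h : M.IsEnum S w e) : M.IsEnum S' w e := by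
  have hc : M.LayerConn S' = M.LayerConn S := LayerConn.congr fun X hX => hS X (by omega)
  have hr : M.CodedRel S' 4 = M.CodedRel S 4 := by
    funext x y
    simp only [CodedRel, hc, hS 1 (by omega), hS 4 (by omega), hS 6 (by omega), hS 8 (by omega)]
  have hl : M.HasLetter S' = M.HasLetter S := by
    funext C x
    simp only [HasLetter, hc]
  exact ⟨h.length_le, by simpa only [hS 3 (by omega)] using h.mem_dom_iff,
    by simpa only [hr] using h.lt_iff, by simpa only [hl] using h.letter_one,
    by simpa only [hl] using h.letter_zero⟩

/-! ### Sufficient conditions -/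

/-- A family of connected pieces of the two layers, any two of which are linked by a vertex that
lies on one of them in the first layer and on the other one in the second layer. -/
structure IsCliqueModel (S : ℕ → Set A) {n : ℕ} (U : Fin n → Set A) : Prop where
  nonempty : ∀ i, (U i).Nonempty
  disjoint : ∀ i j, i ≠ j → Disjoint (U i) (U j)
  closed : ∀ i x y, x ∈ U i → M.LayerAdj S x y → y ∈ U i
  conn : ∀ i, ∀ x ∈ U i, ∀ y ∈ U i, M.LayerConn S x y
  link : ∀ i j, i ≠ j → ∃ v,
    (v ∈ U i ∧ (∃ f ∈ S 1, M.inc v f) ∧ ∀ f ∈ S 1, M.inc v f → f ∈ U j) ∨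
    (v ∈ U j ∧ (∃ f ∈ S 1, M.inc v f) ∧ ∀ f ∈ S 1, M.inc v f → f ∈ U i)

theorem IsCliqueModel.eq_of_mem {S : ℕ → Set A} {n : ℕ} {U : Fin n → Set A}
    (h : M.IsCliqueModel S U) {i j : Fin n} {x : A} (hi : x ∈ U i) (hj : x ∈ U j) : i = j := by
  by_contra hne
  exact Set.disjoint_left.1 (h.disjoint i j hne) hi hj

theorem IsCliqueModel.mem_of_conn {S : ℕ → Set A} {n : ℕ} {U : Fin n → Set A}
    (h : M.IsCliqueModel S U) {i : Fin n} {x y : A} (hx : x ∈ U i) (hxy : M.LayerConn S x y) :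
    y ∈ U i :=
  hxy (U i) hx fun u v hu => h.closed i u v hu

/-- A piece is closed under layer adjacency, so whatever is connected to one of its elements lies in
it; as the pieces are disjoint, this gives the uniqueness clauses of `IsLink`. -/
theorem IsCliqueModel.exists_isLink {S : ℕ → Set A} {n : ℕ} {U : Fin n → Set A}
    (h : M.IsCliqueModel S U) {e : Fin n → A} (he : ∀ i, e i ∈ U i) {i j : Fin n} (hij : i ≠ j) :
    ∃ v, M.IsLink S (Set.range e) v (e i) (e j) ∨ M.IsLink S (Set.range e) v (e j) (e i) := by
  have key : ∀ {i j v}, v ∈ U i → (∃ f ∈ S 1, M.inc v f) →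
      (∀ f ∈ S 1, M.inc v f → f ∈ U j) → M.IsLink S (Set.range e) v (e i) (e j) := by
    rintro i j v hv ⟨f, hf1, hvf⟩ hf
    refine ⟨h.conn _ _ hv _ (he i), ?_, ⟨f, hf1, hvf, h.conn _ _ (hf f hf1 hvf) _ (he j)⟩, ?_⟩
    · rintro _ ⟨i', rfl⟩ hc
      rw [h.eq_of_mem (he i') (h.mem_of_conn hv hc)]
    · rintro _ ⟨i', rfl⟩ f hf1 hvf hc
      rw [h.eq_of_mem (he i') (h.mem_of_conn (hf f hf1 hvf) hc)]
  obtain ⟨v, ⟨hv, hf, hf'⟩ | ⟨hv, hf, hf'⟩⟩ := h.link i j hij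
  · exact ⟨v, Or.inl (key hv hf hf')⟩
  · exact ⟨v, Or.inr (key hv hf hf')⟩

/-- A clique model such that the letters lie on its first pieces gives rise to a frame. -/
theorem IsCliqueModel.exists_frame {S : ℕ → Set A} {n : ℕ} {U : Fin n → Set A}
    (h : M.IsCliqueModel S U) {w : List Bool} {x : Fin w.length → A} (hx : M.Spells w x)
    (hn : w.length ≤ n) (hU : ∀ j, x j ∈ U (Fin.castLE hn j)) :
    ∃ (S' : ℕ → Set A) (e : Fin n → A), M.IsFrame S' ∧ M.IsEnum S' w e ∧ M.CodesAll S' e := by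
  choose e he using h.nonempty
  have hinj : Function.Injective e := fun i j hij => h.eq_of_mem (he i) (hij ▸ he j)
  have hcodes : M.CodesAll S e := codesAll_of_isLink hinj fun i j hij => h.exists_isLink he hij
  -- The numbering of the pieces is itself a binary relation on the domain, so the order of the
  -- frame can be coded by links.
  obtain ⟨Z₀, Z₁, Z₂, hZ⟩ := hcodes 4 (· < ·)
  set S' : ℕ → Set A := fun X => if X < 3 then S X else if X = 3 then Set.range e else
    if X = 4 then Z₀ else if X = 6 then Z₁ else Z₂ with hS'
  have hS : ∀ X < 3, S' X = S X := fun X hX => by simp [hS', hX]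
  have hlt := hZ S' hS (by simp [S']) (by simp [S']) (by simp [S'])
  have h3 : S' 3 = Set.range e := by simp [S']
  have hconn : ∀ (j : Fin w.length) (i : Fin n),
      M.LayerConn S' (x j) (e i) ↔ (j : ℕ) = i := fun j i => by
    rw [LayerConn.congr hS]
    constructor
    · intro hc
      rw [← h.eq_of_mem (h.mem_of_conn (hU j) hc) (he i)]
      rfl
    · intro hji
      have : Fin.castLE hn j = i := Fin.ext hji
      exact h.conn i _ (this ▸ hU j) _ (he i)
  have key : ∀ (C : Set A) (i : Fin n), M.HasLetter S' C (e i) ↔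
      ∃ h : (i : ℕ) < w.length, x ⟨i, h⟩ ∈ C := by
    intro C i
    constructor
    · rintro ⟨y, hy, hC, hc⟩
      obtain ⟨j, rfl⟩ := (hx.isLetter_iff y).1 hy
      have h1 := (hconn j i).1 hc
      exact ⟨h1 ▸ j.2, by simpa [← h1] using hC⟩
    · rintro ⟨hi, hC⟩
      exact ⟨_, (hx.isLetter_iff _).2 ⟨_, rfl⟩, hC, (hconn _ _).2 rfl⟩
  refine ⟨S', e, ?_, ⟨hn, fun z => by rw [h3]; rfl, hlt, fun i => ?_, fun i => ?_⟩,
    hcodes.congr hS⟩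
  · constructor
    · rw [h3]; rintro _ ⟨i, rfl⟩; rw [hlt]; exact lt_irrefl _
    · rw [h3]; rintro _ ⟨i, rfl⟩ _ ⟨j, rfl⟩ _ ⟨k, rfl⟩; simp only [hlt]; exact lt_trans
    · rw [h3]; rintro _ ⟨i, rfl⟩ _ ⟨j, rfl⟩; simp only [hlt, hinj.eq_iff]
      rcases lt_trichotomy i j with h | h | h <;> simp [h]
    · rw [h3]
      rintro _ ⟨i, rfl⟩ _ ⟨j, rfl⟩
      rw [or_iff_not_imp_left, hinj.eq_iff]
      intro hij
      have := h.exists_isLink he hij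
      simpa only [IsLink, LayerConn.congr hS, hS 1 (by omega)] using this
    · intro y hy
      obtain ⟨j, rfl⟩ := (hx.isLetter_iff y).1 hy
      exact ⟨e (Fin.castLE hn j), h3 ▸ ⟨_, rfl⟩, (hconn _ _).2 rfl⟩
    · intro y hy
      obtain ⟨j, rfl⟩ := (hx.isLetter_iff y).1 hy
      rw [h3]; rintro _ ⟨i, rfl⟩ _ ⟨i', rfl⟩
      rw [hconn, hconn]
      intro h1 h2
      rw [Fin.ext (h1.symm.trans h2)]
    · intro y hy z hz
      obtain ⟨j, rfl⟩ := (hx.isLetter_iff y).1 hy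
      obtain ⟨k, rfl⟩ := (hx.isLetter_iff z).1 hz
      rw [h3]; rintro _ ⟨i, rfl⟩ _ ⟨i', rfl⟩
      rw [hconn, hconn, hx.lt_iff, hlt, Fin.lt_def, Fin.lt_def]
      omega
    · intro y hy
      obtain ⟨j, rfl⟩ := (hx.isLetter_iff y).1 hy
      rw [h3]; rintro _ ⟨i, rfl⟩ _ ⟨i', rfl⟩
      rw [hconn, hlt, Fin.lt_def]
      intro h1 h2
      exact ⟨x ⟨i, by omega⟩, (hx.isLetter_iff _).2 ⟨_, rfl⟩, (hconn _ _).2 rfl⟩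
  · rw [key, List.getElem?_eq_some_iff]
    exact exists_congr fun hi => hx.mem_C1_iff ⟨i, hi⟩
  · rw [key, List.getElem?_eq_some_iff]
    exact exists_congr fun hi => hx.mem_C0_iff ⟨i, hi⟩

end ColStructure

/-! ### Paths -/

namespace GPath

variable {A : Type u} {M : ColStructure A}

/-- A path of an induced substructure, as a path of the whole structure. -/
def lift {T : Set A} (P : GPath (M.induce T)) : GPath M where
  len := P.len
  len_pos := P.len_pos
  vert t := P.vert t
  edge t := P.edge t
  vert_injective := Subtype.val_injective.comp P.vert_injective
  inc_left := P.inc_left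
  inc_right := P.inc_right

theorem lift_mem_verts {T : Set A} {P : GPath (M.induce T)} {x : A} :
    x ∈ P.lift.verts ↔ ∃ h : x ∈ T, ⟨x, h⟩ ∈ P.verts := by
  constructor
  · rintro ⟨t, rfl⟩
    exact ⟨(P.vert t).2, t, rfl⟩
  · rintro ⟨h, t, ht⟩
    exact ⟨t, congrArg Subtype.val ht⟩

theorem PairwiseDisjoint.lift {T : Set A} {ι : Type*} {P : ι → GPath (M.induce T)}
    (h : PairwiseDisjoint P) : PairwiseDisjoint fun a => (P a).lift := by
  intro a b hab
  rw [Set.disjoint_left]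
  intro x hx hx'
  obtain ⟨_, h1⟩ := lift_mem_verts.1 hx
  obtain ⟨_, h2⟩ := lift_mem_verts.1 hx'
  exact Set.disjoint_left.1 (h a b hab) h1 h2

theorem PairwiseDisjoint.eq_of_mem {ι : Type*} {P : ι → GPath M} (h : PairwiseDisjoint P)
    {a b : ι} {x : A} (ha : x ∈ (P a).verts) (hb : x ∈ (P b).verts) : a = b := by
  by_contra hne
  exact Set.disjoint_left.1 (h a b hne) ha hb

/-- An edge has exactly two ends, and the path supplies two distinct ones. -/
theorem inc_edge_iff (hM : M.IsGraph) (P : GPath M) (t : Fin P.len) (z : A) :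
    M.inc z (P.edge t) ↔ z = P.vert t.castSucc ∨ z = P.vert t.succ := by
  obtain ⟨x, y, hxy, h⟩ := hM.two_ends _ (hM.inc_mem _ _ (P.inc_left t)).2
  have h1 := (h _).1 (P.inc_left t)
  have h2 := (h _).1 (P.inc_right t)
  have h3 : P.vert t.castSucc ≠ P.vert t.succ := fun he => by
    have := P.vert_injective he
    rw [Fin.ext_iff] at this
    simp at this
  rw [h]
  grind

theorem mem_verts_of_inc (hM : M.IsGraph) {P : GPath M} {t : Fin P.len} {z : A}
    (h : M.inc z (P.edge t)) : z ∈ P.verts := by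
  rcases (P.inc_edge_iff hM t z).1 h with rfl | rfl
  · exact ⟨_, rfl⟩
  · exact ⟨_, rfl⟩

theorem edge_injective (hM : M.IsGraph) (P : GPath M) : Function.Injective P.edge := by
  intro a b hab
  have h1 := (P.inc_edge_iff hM b _).1 (hab ▸ P.inc_left a)
  have h2 := (P.inc_edge_iff hM b _).1 (hab ▸ P.inc_right a)
  simp only [P.vert_injective.eq_iff, Fin.ext_iff, Fin.val_castSucc, Fin.val_succ] at h1 h2
  exact Fin.ext (by omega)

theorem vert_mem (hM : M.IsGraph) (P : GPath M) (t) : P.vert t ∈ M.V := by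
  by_cases h : (t : ℕ) < P.len
  · exact (hM.inc_mem _ _ (P.inc_left ⟨t, h⟩)).1
  · have h0 := P.len_pos
    have : t = Fin.succ ⟨P.len - 1, by omega⟩ := Fin.ext (by simp; omega)
    rw [this]
    exact (hM.inc_mem _ _ (P.inc_right _)).1

theorem edge_mem (hM : M.IsGraph) (P : GPath M) (t) : P.edge t ∈ M.E :=
  (hM.inc_mem _ _ (P.inc_left t)).2

theorem exists_inc {P : GPath M} {v : A} (hv : v ∈ P.verts) : ∃ t, M.inc v (P.edge t) := by
  obtain ⟨t, rfl⟩ := hv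
  by_cases h : (t : ℕ) < P.len
  · exact ⟨⟨t, h⟩, P.inc_left ⟨t, h⟩⟩
  · have h0 := P.len_pos
    refine ⟨⟨P.len - 1, by omega⟩, ?_⟩
    have : t = Fin.succ ⟨P.len - 1, by omega⟩ := Fin.ext (by simp; omega)
    rw [this]
    exact P.inc_right _

end GPath

namespace ColStructure

variable {A : Type u} {M : ColStructure A}

theorem IsGraph.notMem_E (hM : M.IsGraph) {x : A} (h : x ∈ M.V) : x ∉ M.E :=
  Set.disjoint_left.1 hM.disjoint h

/-- `P` is the path formed by the coloured edges, directed in such a way that the first edge is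
blue and the last edge is red. -/
structure IsColouredPath (M : ColStructure A) (P : GPath M) : Prop where
  isGraph : M.IsGraph
  coloured_iff : ∀ e, (e ∈ M.B ∨ e ∈ M.R) ↔ ∃ t, P.edge t = e
  first_mem : ∀ t : Fin P.len, (t : ℕ) = 0 → P.edge t ∈ M.B
  last_notMem : ∀ t : Fin P.len, (t : ℕ) + 1 = P.len → P.edge t ∉ M.B

namespace IsColouredPath

variable {P : GPath M} (h : M.IsColouredPath P)
include h

/-- Only the two ends of the path lie on a single coloured edge, and only the edge at the first of
them is blue. This breaks the symmetry of the path. -/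
theorem isStart_iff (x : A) : M.IsStart x ↔ x = P.vert 0 := by
  have hinj := P.edge_injective h.isGraph
  constructor
  · rintro ⟨e, he, hxe, hu⟩
    obtain ⟨t, rfl⟩ := (h.coloured_iff e).1 (Or.inl he)
    rcases (P.inc_edge_iff h.isGraph t x).1 hxe with rfl | rfl
    · by_cases h0 : (t : ℕ) = 0
      · exact congrArg P.vert (Fin.ext h0)
      · have ht := t.2
        have h1 := hu (P.edge ⟨t - 1, by omega⟩) ((h.coloured_iff _).2 ⟨_, rfl⟩) (by
          have h2 := P.inc_right ⟨t - 1, by omega⟩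
          rwa [show Fin.succ ⟨(t : ℕ) - 1, _⟩ = t.castSucc from Fin.ext (by simp; omega)] at h2)
        have := congrArg Fin.val (hinj h1)
        simp at this
        omega
    · by_cases h0 : (t : ℕ) + 1 = P.len
      · exact absurd he (h.last_notMem t h0)
      · have ht := t.2
        have h1 := hu (P.edge ⟨t + 1, by omega⟩) ((h.coloured_iff _).2 ⟨_, rfl⟩)
          (P.inc_left ⟨t + 1, by omega⟩)
        have := congrArg Fin.val (hinj h1)
        simp at this
  · rintro rfl
    refine ⟨P.edge ⟨0, P.len_pos⟩, h.first_mem _ rfl, P.inc_left ⟨0, P.len_pos⟩, fun f hf hxf => ?_⟩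
    obtain ⟨t, rfl⟩ := (h.coloured_iff f).1 hf
    rcases (P.inc_edge_iff h.isGraph t _).1 hxf with h1 | h1
    · have := congrArg Fin.val (P.vert_injective h1)
      exact congrArg P.edge (Fin.ext (by simpa using this.symm))
    · have := congrArg Fin.val (P.vert_injective h1)
      simp at this

/-- Walking along coloured edges from the start without entering `P.vert b`, one reaches exactly the
vertices in front of it. -/
theorem pathLt_iff (a b) : M.PathLt (P.vert a) (P.vert b) ↔ a < b := by
  constructor
  · intro hlt
    obtain ⟨c, hc, hc'⟩ := hlt {z | ∃ c, c < b ∧ P.vert c = z} (by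
      rintro s hs hsb
      rw [h.isStart_iff] at hs
      subst hs
      exact ⟨0, Fin.pos_iff_ne_zero.2 fun hb => hsb (by rw [hb]), rfl⟩) (by
      rintro _ y e ⟨c, hc, rfl⟩ hyb he hce hye
      obtain ⟨t, rfl⟩ := (h.coloured_iff e).1 he
      rw [P.inc_edge_iff h.isGraph] at hce hye
      rcases hye with rfl | rfl
      all_goals
        refine ⟨_, ?_, rfl⟩
        simp only [ne_eq, P.vert_injective.eq_iff, Fin.ext_iff, Fin.lt_def, Fin.val_castSucc,
          Fin.val_succ] at *
        omega)
    rwa [← P.vert_injective hc']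
  · intro hab X hs hX
    obtain ⟨a, ha⟩ := a
    induction a with
    | zero =>
      refine hs _ ((h.isStart_iff _).2 rfl) fun h' => ?_
      exact hab.ne (P.vert_injective h')
    | succ a ih =>
      refine hX _ _ (P.edge ⟨a, by omega⟩) (ih (by omega) ?_) ?_ ((h.coloured_iff _).2 ⟨_, rfl⟩)
        (P.inc_left ⟨a, by omega⟩) (P.inc_right ⟨a, by omega⟩)
      · rw [Fin.lt_def] at hab ⊢
        simp at hab ⊢
        omega
      · intro h'
        exact hab.ne (P.vert_injective h')

theorem mem_verts_iff (x : A) : (∃ e, (e ∈ M.B ∨ e ∈ M.R) ∧ M.inc x e) ↔ x ∈ P.verts := by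
  constructor
  · rintro ⟨e, he, hx⟩
    obtain ⟨t, rfl⟩ := (h.coloured_iff e).1 he
    exact GPath.mem_verts_of_inc h.isGraph hx
  · intro hx
    obtain ⟨t, ht⟩ := GPath.exists_inc hx
    exact ⟨_, (h.coloured_iff _).2 ⟨t, rfl⟩, ht⟩

end IsColouredPath

/-! ### Walking in the two layers -/

section Layers

variable {S : ℕ → Set A}

theorem LayerAdj.symm {x y : A} (h : M.LayerAdj S x y) : M.LayerAdj S y x := by
  rcases h with ⟨e, he, hx, hy⟩ | ⟨⟨hx, hy⟩, v, hv, hv'⟩ | h | h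
  · exact Or.inl ⟨e, he, hy, hx⟩
  · exact Or.inr (Or.inl ⟨⟨hy, hx⟩, v, hv', hv⟩)
  · exact Or.inr (Or.inr (Or.inr h))
  · exact Or.inr (Or.inr (Or.inl h))

theorem LayerConn.refl (x : A) : M.LayerConn S x x := fun _ hx _ => hx

theorem LayerConn.trans {x y z : A} (h : M.LayerConn S x y) (h' : M.LayerConn S y z) :
    M.LayerConn S x z := fun X hx hX => h' X (h X hx hX) hX

theorem LayerConn.symm {x y : A} (h : M.LayerConn S x y) : M.LayerConn S y x := by
  intro X hy hX
  by_contra hx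
  exact h Xᶜ hx (fun u v hu huv hv => hu (hX v u hv huv.symm)) hy

theorem LayerAdj.conn {x y : A} (h : M.LayerAdj S x y) : M.LayerConn S x y :=
  fun _ hx hX => hX _ _ hx h

/-- A subpath all edges of which belong to the first layer is connected there. -/
theorem layerConn_vert (P : GPath M) (a b : ℕ) (hab : a ≤ b) (hb : b < P.len + 1)
    (h : ∀ t : Fin P.len, a ≤ t → (t : ℕ) < b → P.edge t ∈ S 0) :
    M.LayerConn S (P.vert ⟨a, by omega⟩) (P.vert ⟨b, hb⟩) := by
  induction b, hab using Nat.le_induction with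
  | base => exact LayerConn.refl _
  | succ b hab ih =>
    refine (ih (by omega) fun t h1 h2 => h t h1 (by omega)).trans (LayerAdj.conn (Or.inl ?_))
    exact ⟨P.edge ⟨b, by omega⟩, h _ hab (by simp), P.inc_left ⟨b, by omega⟩,
      P.inc_right ⟨b, by omega⟩⟩

theorem layerConn_verts {P : GPath M} (h : ∀ t, P.edge t ∈ S 0) {x y : A} (hx : x ∈ P.verts)
    (hy : y ∈ P.verts) : M.LayerConn S x y := by
  have key : ∀ t, M.LayerConn S (P.vert 0) (P.vert t) := fun t =>
    layerConn_vert P 0 t (by omega) t.2 fun t _ _ => h t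
  obtain ⟨a, rfl⟩ := hx
  obtain ⟨b, rfl⟩ := hy
  exact (key a).symm.trans (key b)

theorem layerConn_edges {P : GPath M} (h : ∀ t, P.edge t ∈ S 1) (a b : Fin P.len) :
    M.LayerConn S (P.edge a) (P.edge b) := by
  have key : ∀ t (ht : t < P.len), M.LayerConn S (P.edge ⟨0, P.len_pos⟩) (P.edge ⟨t, ht⟩) := by
    intro t
    induction t with
    | zero => exact fun _ => LayerConn.refl _
    | succ t ih =>
      intro ht
      refine (ih (by omega)).trans (LayerAdj.conn (Or.inr (Or.inl ⟨⟨h _, h _⟩, ?_⟩)))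
      exact ⟨_, P.inc_right ⟨t, by omega⟩, P.inc_left ⟨t + 1, ht⟩⟩
  exact (key a a.2).symm.trans (key b b.2)

end Layers

end ColStructure

/-! ### Clique models in pseudo-walls -/

namespace ColStructure

variable {A : Type u} {M : ColStructure A}

/-- Used for blue edges: it singles out the first vertex of an interval, which stands for the letter
of that interval. -/
theorem IsColouredPath.blue_right_end {P : GPath M} (h : M.IsColouredPath P) (t : Fin P.len)
    (z : A) : (∃ y, M.inc z (P.edge t) ∧ M.inc y (P.edge t) ∧ M.PathLt y z) ↔
      z = P.vert t.succ := by
  constructor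
  · rintro ⟨y, hz, hy, hlt⟩
    rw [P.inc_edge_iff h.isGraph] at hz hy
    rcases hz with rfl | rfl
    · exfalso
      rcases hy with rfl | rfl <;> rw [h.pathLt_iff, Fin.lt_def] at hlt <;> simp at hlt
    · rfl
  · rintro rfl
    exact ⟨P.vert t.castSucc, P.inc_right t, P.inc_left t, (h.pathLt_iff _ _).2
      (by rw [Fin.lt_def]; simp)⟩

/-- The positions of the `j`-th interval of a long path. -/
def InInterval {k len : ℕ} (i : Fin k → Fin len) (j : Fin k) (t : Fin (len + 1)) : Prop :=
  (i j : ℕ) < t ∧ ∀ j', j < j' → (t : ℕ) ≤ i j'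

theorem InInterval.unique {k len : ℕ} {i : Fin k → Fin len} {j j' : Fin k}
    {t : Fin (len + 1)} (h : InInterval i j t) (h' : InInterval i j' t) : j = j' := by
  rcases lt_trichotomy j j' with hlt | rfl | hlt
  · have := h.2 _ hlt; have := h'.1; omega
  · rfl
  · have := h'.2 _ hlt; have := h.1; omega

theorem inInterval_succ {k len : ℕ} {i : Fin k → Fin len} (hi : StrictMono i) (j : Fin k) :
    InInterval i j (i j).succ := by
  refine ⟨by simp, fun j' hj' => ?_⟩
  have := Fin.lt_def.1 (hi hj')
  simp
  omega

/-- The clique model given by the intervals of a long path and the paths linking them. -/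
theorem isCliqueModel_of_intervals (hM : M.IsGraph) {k : ℕ} (L : GPath M) (i : Fin k → Fin L.len)
    (hi : StrictMono i) (Q : {p : Fin k × Fin k // p.1 < p.2} → GPath M)
    (hQ : GPath.PairwiseDisjoint Q) (hR : ∀ e, e ∈ M.R ↔ ∃ t, (∀ j, t ≠ i j) ∧ L.edge t = e)
    (hfirst : ∀ p, ∃ t, InInterval i p.1.1 t ∧ L.vert t = (Q p).first)
    (hlast : ∀ p, ∃ t, InInterval i p.1.2 t ∧ L.vert t = (Q p).last) :
    ∃ S : ℕ → Set A, M.IsCliqueModel S fun j =>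
      {z | (∃ t, InInterval i j t ∧ L.vert t = z) ∨ ∃ p, p.1.2 = j ∧ z ∈ (Q p).edges} := by
  -- Red edges never leave an interval, since intervals are separated by blue edges. A linking path
  -- is attached, at its last vertex, to the piece with its larger index; its first vertex is not a
  -- switch and serves as the link from the piece with its smaller index.
  let S : ℕ → Set A := fun X => if X = 0 then M.R else if X = 1 then ⋃ p, (Q p).edges else
    Set.range fun p => (Q p).last
  have hS0 : ∀ z, z ∈ S 0 ↔ ∃ t, (∀ j, t ≠ i j) ∧ L.edge t = z := hR
  have hS1 : ∀ z, z ∈ S 1 ↔ ∃ p t, (Q p).edge t = z := fun z => by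
    simp [S, GPath.edges]
  have hS2 : ∀ z, z ∈ S 2 ↔ ∃ p, (Q p).last = z := fun z => by simp [S]
  have hstep : ∀ (t : Fin L.len) (_ : ∀ j, t ≠ i j) (j : Fin k),
      InInterval i j t.castSucc ↔ InInterval i j t.succ := by
    intro t ht j
    have h1 : ∀ j, (t : ℕ) ≠ i j := fun j h => ht j (Fin.ext h)
    simp only [InInterval, Fin.val_castSucc, Fin.val_succ]
    have := h1 j
    constructor
    · rintro ⟨ha, hb⟩
      exact ⟨by omega, fun j' hj' => by have := hb j' hj'; have := h1 j'; omega⟩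
    · rintro ⟨ha, hb⟩
      exact ⟨by omega, fun j' hj' => by have := hb j' hj'; omega⟩
  have hVE : ∀ (P P' : GPath M) t t', P.vert t ≠ P'.edge t' := fun P P' t t' he =>
    hM.notMem_E (P.vert_mem hM t) (he ▸ P'.edge_mem hM t')
  have hQinc : ∀ {p p' t t' v}, M.inc v ((Q p).edge t) → M.inc v ((Q p').edge t') → p = p' :=
    fun h h' => hQ.eq_of_mem (GPath.mem_verts_of_inc hM h) (GPath.mem_verts_of_inc hM h')
  have hQe : ∀ {p p' t t'}, (Q p).edge t = (Q p').edge t' → p = p' := fun {p p' t t'} h =>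
    hQinc ((Q p).inc_left t) (h ▸ (Q p).inc_left t)
  have hconn1 : ∀ p t t', M.LayerConn S ((Q p).edge t) ((Q p).edge t') := fun p t t' =>
    layerConn_edges (fun t => (hS1 _).2 ⟨p, t, rfl⟩) t t'
  have hbase : ∀ j z, ((∃ t, InInterval i j t ∧ L.vert t = z) ∨
      ∃ p, p.1.2 = j ∧ z ∈ (Q p).edges) → M.LayerConn S (L.vert (i j).succ) z := by
    have h1 : ∀ j t, InInterval i j t → M.LayerConn S (L.vert (i j).succ) (L.vert t) := by
      intro j t ht
      refine layerConn_vert L (i j + 1) t ht.1 t.2 fun u hu hu' => (hS0 _).2 ⟨u, ?_, rfl⟩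
      rintro j' rfl
      have hjj : j < j' := hi.lt_iff_lt.1 (by rw [Fin.lt_def]; omega)
      have := ht.2 _ hjj
      omega
    rintro j z (⟨t, ht, rfl⟩ | ⟨p, rfl, t, rfl⟩)
    · exact h1 j t ht
    · obtain ⟨u, hu, hu'⟩ := hlast p
      refine (h1 _ u hu).trans ?_
      rw [hu']
      have h0 := (Q p).len_pos
      have hl : (Q p).last = (Q p).vert (Fin.succ ⟨(Q p).len - 1, by omega⟩) :=
        congrArg (Q p).vert (Fin.ext (by simp; omega))
      refine LayerConn.trans (LayerAdj.conn (Or.inr (Or.inr (Or.inl ⟨(hS2 _).2 ⟨p, rfl⟩,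
        (hS1 _).2 ⟨p, _, rfl⟩, ?_⟩)))) (hconn1 p ⟨(Q p).len - 1, by omega⟩ t)
      rw [hl]
      exact (Q p).inc_right _
  have hlink : ∀ a b : Fin k, a < b → ∃ v,
      (∃ t, InInterval i a t ∧ L.vert t = v) ∧ (∃ f ∈ S 1, M.inc v f) ∧
        ∀ f ∈ S 1, M.inc v f → ∃ p, p.1.2 = b ∧ f ∈ (Q p).edges := by
    intro a b hab
    refine ⟨(Q ⟨(a, b), hab⟩).first, hfirst ⟨(a, b), hab⟩,
      ⟨_, (hS1 _).2 ⟨_, ⟨0, (Q ⟨(a, b), hab⟩).len_pos⟩, rfl⟩, (Q _).inc_left ⟨0, _⟩⟩, ?_⟩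
    intro f hf hinc
    obtain ⟨p, t, rfl⟩ := (hS1 f).1 hf
    obtain rfl := hQ.eq_of_mem (GPath.mem_verts_of_inc hM hinc) ⟨0, rfl⟩
    exact ⟨⟨(a, b), hab⟩, rfl, t, rfl⟩
  refine ⟨S, fun j => ⟨_, Or.inl ⟨_, inInterval_succ hi j, rfl⟩⟩, fun a b hab => ?_, ?_,
    fun j x hx y hy => (hbase j x hx).symm.trans (hbase j y hy), fun a b hab => ?_⟩
  · rw [Set.disjoint_left]
    rintro x (⟨t, ht, rfl⟩ | ⟨p, rfl, t, rfl⟩) (⟨t', ht', he⟩ | ⟨p', rfl, t', he⟩)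
    · obtain rfl := L.vert_injective he
      exact hab (ht.unique ht')
    · exact hVE _ _ _ _ he.symm
    · exact hVE _ _ _ _ he
    · exact hab (by rw [hQe he])
  · rintro j x y hx (⟨e, he, hxe, hye⟩ | ⟨⟨hx1, hy1⟩, v, hvx, hvy⟩ | ⟨hx2, hy1, hxy⟩ |
      ⟨hy2, hx1, hyx⟩)
    · obtain ⟨t, ht, rfl⟩ := (hS0 _).1 he
      rcases hx with ⟨t', ht', rfl⟩ | ⟨p, rfl, t', rfl⟩
      · rw [L.inc_edge_iff hM] at hxe hye
        have h1 : InInterval i j t.castSucc ∧ InInterval i j t.succ := by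
          rw [hstep t ht]
          rcases hxe with he | he <;> obtain rfl := L.vert_injective he
          · exact ⟨(hstep t ht j).1 ht', (hstep t ht j).1 ht'⟩
          · exact ⟨ht', ht'⟩
        rcases hye with rfl | rfl
        · exact Or.inl ⟨_, h1.1, rfl⟩
        · exact Or.inl ⟨_, h1.2, rfl⟩
      · exact absurd ((Q p).edge_mem hM t') (hM.notMem_E (hM.inc_mem _ _ hxe).1)
    · obtain ⟨p, t, rfl⟩ := (hS1 _).1 hx1
      obtain ⟨p', t', rfl⟩ := (hS1 _).1 hy1
      rcases hx with ⟨t'', ht'', he⟩ | ⟨p'', rfl, t'', he⟩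
      · exact absurd he (hVE _ _ _ _)
      · obtain rfl := hQinc hvx hvy
        obtain rfl := hQe he
        exact Or.inr ⟨p'', rfl, t', rfl⟩
    · obtain ⟨p, rfl⟩ := (hS2 _).1 hx2
      obtain ⟨p', t', rfl⟩ := (hS1 _).1 hy1
      obtain rfl := hQ.eq_of_mem (GPath.mem_verts_of_inc hM hxy) ⟨_, rfl⟩
      rcases hx with ⟨t'', ht'', he⟩ | ⟨p'', rfl, t'', he⟩
      · obtain ⟨u, hu, hu'⟩ := hlast p'
        obtain rfl := L.vert_injective (he.trans hu'.symm)
        exact Or.inr ⟨p', hu.unique ht'', t', rfl⟩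
      · exact absurd he.symm (hVE _ _ _ _)
    · obtain ⟨p, rfl⟩ := (hS2 _).1 hy2
      obtain ⟨p', t', rfl⟩ := (hS1 _).1 hx1
      obtain rfl := hQ.eq_of_mem (GPath.mem_verts_of_inc hM hyx) ⟨_, rfl⟩
      rcases hx with ⟨t'', ht'', he⟩ | ⟨p'', rfl, t'', he⟩
      · exact absurd he (hVE _ _ _ _)
      · obtain rfl := hQe he
        exact Or.inl (hlast p'')
  · rcases lt_or_gt_of_ne hab with h | h
    · obtain ⟨v, h1, h2, h3⟩ := hlink a b h
      exact ⟨v, Or.inl ⟨Or.inl h1, h2, fun f hf hv => Or.inr (h3 f hf hv)⟩⟩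
    · obtain ⟨v, h1, h2, h3⟩ := hlink b a h
      exact ⟨v, Or.inr ⟨Or.inl h1, h2, fun f hf hv => Or.inr (h3 f hf hv)⟩⟩

/-- The clique model given by a topological clique in the intersection graph of two families of
disjoint paths. -/
theorem isCliqueModel_of_topCliqueImage (hM : M.IsGraph) {ι κ : Type*} (P : ι → GPath M)
    (Q : κ → GPath M) (hP : GPath.PairwiseDisjoint P) (hQ : GPath.PairwiseDisjoint Q)
    {H : SimpleGraph (ι ⊕ κ)}
    (hH : ∀ a b, H.Adj (.inl a) (.inr b) → ((P a).verts ∩ (Q b).verts).Nonempty)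
    (hH₁ : ∀ a a', ¬ H.Adj (.inl a) (.inl a')) (hH₂ : ∀ b b', ¬ H.Adj (.inr b) (.inr b'))
    {n : ℕ} (μ : TopCliqueImage H n) :
    ∃ S : ℕ → Set A, M.IsCliqueModel S fun j =>
      {z | (∃ a, .inl a ∈ μ.branch j ∧ z ∈ (P a).verts) ∨
        ∃ b, .inr b ∈ μ.branch j ∧ z ∈ (Q b).edges} := by
  -- A crossing is a switch only if both paths belong to the same branch set. A crossing of paths
  -- from different branch sets connects nothing and can serve as a link.
  let S : ℕ → Set A := fun X => if X = 0 then ⋃ a, (P a).edges else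
    if X = 1 then ⋃ b, (Q b).edges else
    {v | ∃ j a b, .inl a ∈ μ.branch j ∧ .inr b ∈ μ.branch j ∧ v ∈ (P a).verts ∧ v ∈ (Q b).verts}
  have hS0 : ∀ z, z ∈ S 0 ↔ ∃ a t, (P a).edge t = z := fun z => by simp [S, GPath.edges]
  have hS1 : ∀ z, z ∈ S 1 ↔ ∃ b t, (Q b).edge t = z := fun z => by simp [S, GPath.edges]
  have hS2 : ∀ z, z ∈ S 2 ↔ ∃ j a b, .inl a ∈ μ.branch j ∧ .inr b ∈ μ.branch j ∧
      z ∈ (P a).verts ∧ z ∈ (Q b).verts := fun z => by simp [S]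
  have hVE : ∀ (P P' : GPath M) t t', P.vert t ≠ P'.edge t' := fun P P' t t' he =>
    hM.notMem_E (P.vert_mem hM t) (he ▸ P'.edge_mem hM t')
  have hQinc : ∀ {p p' t t' v}, M.inc v ((Q p).edge t) → M.inc v ((Q p').edge t') → p = p' :=
    fun h h' => hQ.eq_of_mem (GPath.mem_verts_of_inc hM h) (GPath.mem_verts_of_inc hM h')
  have hQe : ∀ {p p' t t'}, (Q p).edge t = (Q p').edge t' → p = p' := fun {p p' t t'} h =>
    hQinc ((Q p).inc_left t) (h ▸ (Q p).inc_left t)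
  have hbr : ∀ {j j' h}, h ∈ μ.branch j → h ∈ μ.branch j' → j = j' := fun {j j' h} h1 h2 => by
    by_contra hne
    exact Set.disjoint_left.1 (μ.branch_disjoint j j' hne) h1 h2
  -- What a vertex of the intersection graph contributes to its piece: a path of the first family
  -- its vertices, one of the second family its edges.
  let El : ι ⊕ κ → Set A := Sum.elim (fun a => (P a).verts) fun b => (Q b).edges
  have hEl : ∀ h x y, x ∈ El h → y ∈ El h → M.LayerConn S x y := by
    rintro (a | b) x y hx hy
    · exact layerConn_verts (fun t => (hS0 _).2 ⟨a, t, rfl⟩) hx hy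
    · obtain ⟨t, rfl⟩ := hx
      obtain ⟨t', rfl⟩ := hy
      exact layerConn_edges (fun t => (hS1 _).2 ⟨b, t, rfl⟩) t t'
  have hadj' : ∀ a b j, H.Adj (.inl a) (.inr b) → .inl a ∈ μ.branch j → .inr b ∈ μ.branch j →
      ∀ x y, x ∈ El (.inl a) → y ∈ El (.inr b) → M.LayerConn S x y := by
    intro a b j hab ha hb x y hx hy
    obtain ⟨v, hva, hvb⟩ := hH a b hab
    obtain ⟨t, ht⟩ := GPath.exists_inc hvb
    refine (hEl _ _ _ hx hva).trans (LayerConn.trans (LayerAdj.conn ?_)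
      (hEl (.inr b) _ _ ⟨t, rfl⟩ hy))
    exact Or.inr (Or.inr (Or.inl ⟨(hS2 _).2 ⟨j, a, b, ha, hb, hva, hvb⟩,
      (hS1 _).2 ⟨b, t, rfl⟩, ht⟩))
  have hadj : ∀ h h' j, H.Adj h h' → h ∈ μ.branch j → h' ∈ μ.branch j →
      ∀ x y, x ∈ El h → y ∈ El h' → M.LayerConn S x y := by
    rintro (a | b) (a' | b') j hab ha hb x y hx hy
    · exact absurd hab (hH₁ _ _)
    · exact hadj' a b' j hab ha hb x y hx hy
    · exact (hadj' a' b j hab.symm hb ha y x hy hx).symm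
    · exact absurd hab (hH₂ _ _)
  have hne : ∀ h, (El h).Nonempty := by
    rintro (a | b)
    · exact ⟨_, 0, rfl⟩
    · exact ⟨_, ⟨0, (Q b).len_pos⟩, rfl⟩
  have hwalk : ∀ j {h h'} (p : H.Walk h h'), (∀ g ∈ p.support, g ∈ μ.branch j) →
      ∀ g ∈ p.support, ∀ x y, x ∈ El h → y ∈ El g → M.LayerConn S x y := by
    intro j h h' p
    induction p with
    | nil =>
      intro _ g hg x y hx hy
      rw [SimpleGraph.Walk.support_nil, List.mem_singleton] at hg
      subst hg
      exact hEl _ _ _ hx hy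
    | @cons a b c hab p ih =>
      intro hs g hg x y hx hy
      rw [SimpleGraph.Walk.support_cons, List.mem_cons] at hg
      rw [SimpleGraph.Walk.support_cons] at hs
      rcases hg with rfl | hg
      · exact hEl _ _ _ hx hy
      · obtain ⟨z, hz⟩ := hne b
        exact (hadj a b j hab (hs _ (by simp)) (hs _ (by simp)) x z hx hz).trans
          (ih (fun g hg => hs g (by simp [hg])) g hg z y hz hy)
  have hcen : ∀ j, μ.center j ∈ μ.branch j := fun j => Or.inl rfl
  have hbase : ∀ j g, g ∈ μ.branch j → ∀ x y, x ∈ El (μ.center j) → y ∈ El g →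
      M.LayerConn S x y := by
    rintro j g (rfl | ⟨j', hj', hg⟩) x y hx hy
    · exact hEl _ _ _ hx hy
    · exact hwalk j (μ.arm j j') (fun g hg => Or.inr ⟨j', hj', hg⟩) g hg x y hx hy
  have hmem : ∀ j z, ((∃ a, .inl a ∈ μ.branch j ∧ z ∈ (P a).verts) ∨
      ∃ b, .inr b ∈ μ.branch j ∧ z ∈ (Q b).edges) ↔ ∃ g ∈ μ.branch j, z ∈ El g := by
    intro j z
    constructor
    · rintro (⟨a, h1, h2⟩ | ⟨a, h1, h2⟩)
      · exact ⟨_, h1, h2⟩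
      · exact ⟨_, h1, h2⟩
    · rintro ⟨(a | b), h1, h2⟩
      · exact Or.inl ⟨a, h1, h2⟩
      · exact Or.inr ⟨b, h1, h2⟩
  have hEle : ∀ {g g' z}, z ∈ El g → z ∈ El g' → g = g' := by
    rintro (a | b) (a' | b') z hz hz'
    · exact congrArg _ (hP.eq_of_mem hz hz')
    · obtain ⟨t, rfl⟩ := hz
      obtain ⟨t', he⟩ := hz'
      exact absurd he.symm (hVE _ _ _ _)
    · obtain ⟨t, rfl⟩ := hz'
      obtain ⟨t', he⟩ := hz
      exact absurd he.symm (hVE _ _ _ _)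
    · obtain ⟨t, rfl⟩ := hz
      obtain ⟨t', he⟩ := hz'
      rw [hQe he]
  have htip : ∀ j j', j ≠ j' → μ.tip j j' ∈ μ.branch j := fun j j' h =>
    Or.inr ⟨j', h, (μ.arm j j').end_mem_support⟩
  have hlink : ∀ a b j j', .inl a ∈ μ.branch j → .inr b ∈ μ.branch j' →
      H.Adj (.inl a) (.inr b) → ∃ v, (∃ g ∈ μ.branch j, v ∈ El g) ∧ (∃ f ∈ S 1, M.inc v f) ∧
        ∀ f ∈ S 1, M.inc v f → ∃ g ∈ μ.branch j', f ∈ El g := by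
    intro a b j j' ha hb hab
    obtain ⟨v, hva, hvb⟩ := hH a b hab
    obtain ⟨t, ht⟩ := GPath.exists_inc hvb
    refine ⟨v, ⟨_, ha, hva⟩, ⟨_, (hS1 _).2 ⟨b, t, rfl⟩, ht⟩, fun f hf hvf => ?_⟩
    obtain ⟨b', t', rfl⟩ := (hS1 f).1 hf
    obtain rfl := hQinc ht hvf
    exact ⟨_, hb, t', rfl⟩
  refine ⟨S, ?_⟩
  simp only [hmem]
  constructor
  · intro j
    obtain ⟨z, hz⟩ := hne (μ.center j)
    exact ⟨z, _, hcen j, hz⟩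
  · intro a b hab
    rw [Set.disjoint_left]
    rintro x ⟨g, hg, hx⟩ ⟨g', hg', hx'⟩
    obtain rfl := hEle hx hx'
    exact hab (hbr hg hg')
  · rintro j x y ⟨g, hg, hx⟩ (⟨e, he, hxe, hye⟩ | ⟨⟨hx1, hy1⟩, v, hvx, hvy⟩ | ⟨hx2, hy1, hxy⟩ |
      ⟨hy2, hx1, hyx⟩)
    · obtain ⟨a, t, rfl⟩ := (hS0 _).1 he
      obtain rfl := hEle hx (g' := .inl a) (GPath.mem_verts_of_inc hM hxe)
      exact ⟨_, hg, GPath.mem_verts_of_inc hM hye⟩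
    · obtain ⟨p, t, rfl⟩ := (hS1 _).1 hx1
      obtain ⟨p', t', rfl⟩ := (hS1 _).1 hy1
      obtain rfl := hQinc hvx hvy
      obtain rfl := hEle hx (g' := .inr p) ⟨t, rfl⟩
      exact ⟨_, hg, t', rfl⟩
    · obtain ⟨j', a, b, ha, hb, hva, hvb⟩ := (hS2 _).1 hx2
      obtain ⟨p', t', rfl⟩ := (hS1 _).1 hy1
      obtain rfl := hQ.eq_of_mem (GPath.mem_verts_of_inc hM hxy) hvb
      obtain rfl := hEle hx (g' := .inl a) hva
      obtain rfl := hbr ha hg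
      exact ⟨_, hb, t', rfl⟩
    · obtain ⟨j', a, b, ha, hb, hva, hvb⟩ := (hS2 _).1 hy2
      obtain ⟨p', t', rfl⟩ := (hS1 _).1 hx1
      obtain rfl := hQ.eq_of_mem (GPath.mem_verts_of_inc hM hyx) hvb
      obtain rfl := hEle hx (g' := .inr p') ⟨t', rfl⟩
      obtain rfl := hbr hb hg
      exact ⟨_, ha, hva⟩
  · rintro j x ⟨g, hg, hx⟩ y ⟨g', hg', hy⟩
    obtain ⟨z, hz⟩ := hne (μ.center j)
    exact (hbase j g hg z x hz hx).symm.trans (hbase j g' hg' z y hz hy)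
  -- As `H` is bipartite, one of the two tips is a path of the first family and the other one a path
  -- of the second family. A vertex common to both is the link, oriented according to which tip is
  -- which.
  · intro j j' hj
    have h1 := htip j j' hj
    have h2 := htip j' j hj.symm
    have h3 := μ.tip_adj j j' hj
    rcases hs : μ.tip j j' with a | b <;> rcases hs' : μ.tip j' j with a' | b' <;>
      rw [hs, hs'] at h3 <;> rw [hs] at h1 <;> rw [hs'] at h2
    · exact absurd h3 (hH₁ _ _)
    · obtain ⟨v, h⟩ := hlink a b' j j' h1 h2 h3
      exact ⟨v, Or.inl h⟩
    · obtain ⟨v, h⟩ := hlink a' b j' j h2 h1 h3.symm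
      exact ⟨v, Or.inr h⟩
    · exact absurd h3 (hH₂ _ _)

end ColStructure

/-! ### Words and clique models read off from a contained pseudo-wall -/

namespace ColStructure

variable {A : Type u} {M : ColStructure A}

/-- For `B` and `R`, containment of a pseudo-wall provides the inclusion `hX`, so their descriptions
carry over to the whole structure. For `C0` and `C1` there is no such inclusion, which is why
`IsLetter` looks at the coloured path only. -/
theorem mem_iff_of_induce {T X : Set A} {Y : Set T} (hX : X ⊆ T) {Z : A → Prop}
    (h : Y = {x : T | (x : A) ∈ X}) (hZ : ∀ x : T, x ∈ Y ↔ Z x) (hZT : ∀ x, Z x → x ∈ T) (x : A) :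
    x ∈ X ↔ Z x := by
  subst h
  exact ⟨fun hx => (hZ ⟨x, hX hx⟩).1 hx, fun hx => (hZ ⟨x, hZT x hx⟩).2 hx⟩

/-- The summary of what is needed about pseudo-walls: the letters can be read off, and there is a
clique model with sufficiently many pieces the first ones of which contain the letters. -/
def HasWordModel (M : ColStructure A) (k : ℕ) (w : List Bool) : Prop :=
  ∃ x : Fin w.length → A, M.Spells w x ∧
    ∃ (n : ℕ) (hn : w.length ≤ n) (S : ℕ → Set A) (U : Fin n → Set A),
      k ≤ n ∧ M.IsCliqueModel S U ∧ ∀ j, x j ∈ U (Fin.castLE hn j)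

/-- Since k ≥ 2, there are two blue edges, so the last clause of `IsLetter` applies and picks the
first vertex of each coloured interval. The pieces are built around the intervals in their order, so
the letters lie on the first ones. -/
theorem hasWordModel_of_simple (hM : M.IsGraph) {T : Set A} (hT : M.B ∪ M.R ⊆ T) {k : ℕ}
    {w : List Bool} (h : (M.induce T).IsSimplePseudoWall k w) : M.HasWordModel k w := by
  obtain ⟨hk, -, L, i, Q, -, hi, hi0, hilast, hB, hR, hC0, hC1, hC, hI0, hI1, -, hQ, hends, hw,
    hcol, hletter⟩ := h
  let P := L.lift
  have hBiff : ∀ e, e ∈ M.B ↔ ∃ j, P.edge (i j) = e := by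
    refine mem_iff_of_induce (Set.subset_union_left.trans hT) rfl (fun x => ?_) ?_
    · change x ∈ (M.induce T).B ↔ _
      rw [hB]
      constructor
      · rintro ⟨j, rfl⟩
        exact ⟨j, rfl⟩
      · rintro ⟨j, hj⟩
        exact ⟨j, Subtype.ext hj.symm⟩
    · rintro _ ⟨j, rfl⟩
      exact (L.edge (i j)).2
  have hedge := P.edge_injective hM
  have hRiff : ∀ e, e ∈ M.R ↔ ∃ t, (∀ j, t ≠ i j) ∧ P.edge t = e := by
    refine mem_iff_of_induce (Set.subset_union_right.trans hT) rfl (fun x => ?_) ?_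
    · change x ∈ (M.induce T).R ↔ _
      rw [hR]
      constructor
      · rintro ⟨⟨t, rfl⟩, ht⟩
        rw [hB] at ht
        exact ⟨t, fun j hj => ht ⟨j, by rw [hj]⟩, rfl⟩
      · rintro ⟨t, ht, he⟩
        refine ⟨⟨t, Subtype.ext he⟩, fun hx => ?_⟩
        obtain ⟨j, hj⟩ := (hBiff x).1 hx
        exact ht j (hedge (he.trans hj.symm))
    · rintro _ ⟨t, -, rfl⟩
      exact (L.edge t).2
  have hP : M.IsColouredPath P := by
    refine ⟨hM, fun e => ?_, fun t ht => ?_, fun t ht ht' => ?_⟩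
    · rw [hBiff, hRiff]
      constructor
      · rintro (⟨j, rfl⟩ | ⟨t, -, rfl⟩)
        · exact ⟨_, rfl⟩
        · exact ⟨_, rfl⟩
      · rintro ⟨t, rfl⟩
        by_cases hj : ∃ j, t = i j
        · obtain ⟨j, rfl⟩ := hj
          exact Or.inl ⟨j, rfl⟩
        · exact Or.inr ⟨t, fun j h => hj ⟨j, h⟩, rfl⟩
    · refine (hBiff _).2 ⟨⟨0, by omega⟩, congrArg P.edge (Fin.ext ?_)⟩
      rw [hi0 _ rfl, ht]
    · obtain ⟨j, hj⟩ := (hBiff _).1 ht'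
      have h1 := hilast j
      rw [hedge hj] at h1
      change (t : ℕ) + 1 < P.len at h1
      omega
  have hint : ∀ j t, InInterval i j t ↔ L.vert t ∈ L.interval i j := by
    intro j t
    constructor
    · rintro ⟨h1, h2⟩
      exact ⟨t, h1, h2, rfl⟩
    · rintro ⟨t', h1, h2, h3⟩
      rw [← L.vert_injective h3]
      exact ⟨h1, h2⟩
  have hfirst : ∀ j, L.vert (i j).succ ∈ L.interval i j := fun j =>
    (hint _ _).1 (inInterval_succ hi j)
  have hsub : ∀ {C D : Set T} {j : Fin k},
      (L.interval i j ⊆ C ∨ Disjoint (L.interval i j) C) → L.vert (i j).succ ∈ C →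
      C ⊆ D → L.interval i j ⊆ D := by
    intro C D j hd hj hCD
    rcases hd with hd | hd
    · exact hd.trans hCD
    · exact absurd hj (Set.disjoint_left.1 hd (hfirst j))
  have hlen : ∀ j : Fin k, (L.vert (i j).succ ∈ (M.induce T).C0 ∪ (M.induce T).C1) ↔
      (j : ℕ) < w.length := by
    intro j
    rw [← hcol]
    constructor
    · rintro (h1 | h1)
      · exact hsub (hI0 j) h1 Set.subset_union_left
      · exact hsub (hI1 j) h1 Set.subset_union_right
    · exact fun h1 => h1 (hfirst j)
  let x : Fin w.length → A := fun j => P.vert (i (Fin.castLE hw j)).succ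
  have hx1 : ∀ j, w[j] = true → x j ∈ M.C1 := fun j hj =>
    (hletter (Fin.castLE hw j) j.2).1 hj (hfirst _)
  have hx0 : ∀ j, w[j] = false → x j ∈ M.C0 := fun j hj =>
    (hletter (Fin.castLE hw j) j.2).2 hj (hfirst _)
  have hx01 : ∀ j, x j ∈ M.C0 → x j ∉ M.C1 := fun j h0 h1 =>
    Set.disjoint_left.1 hC (show L.vert (i (Fin.castLE hw j)).succ ∈ _ from h0) h1
  refine ⟨x, ⟨fun z => ?_, fun a b => ?_, fun j => ⟨fun h1 => ?_, hx1 j⟩,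
    fun j => ⟨fun h0 => ?_, hx0 j⟩⟩, k, hw, ?_⟩
  · have hBtwo : ¬ ∀ e f, e ∈ M.B → f ∈ M.B → e = f := by
      intro hu
      have h1 := hedge (hu _ _ ((hBiff _).2 ⟨⟨0, by omega⟩, rfl⟩)
        ((hBiff _).2 ⟨⟨1, by omega⟩, rfl⟩))
      have := congrArg Fin.val (hi.injective h1)
      simp at this
    simp only [IsLetter, hP.mem_verts_iff, hBtwo, false_or]
    constructor
    · rintro ⟨-, hz, e, y, he, hze, hye, hlt⟩
      obtain ⟨j, rfl⟩ := (hBiff e).1 he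
      obtain rfl := (hP.blue_right_end _ _).1 ⟨y, hze, hye, hlt⟩
      exact ⟨⟨j, (hlen j).1 hz⟩, rfl⟩
    · rintro ⟨j, rfl⟩
      refine ⟨⟨_, rfl⟩, (hlen (Fin.castLE hw j)).2 j.2, P.edge (i (Fin.castLE hw j)), ?_⟩
      obtain ⟨y, h1, h2, h3⟩ := (hP.blue_right_end (i (Fin.castLE hw j)) _).2 rfl
      exact ⟨y, (hBiff _).2 ⟨_, rfl⟩, h1, h2, h3⟩
  · exact (hP.pathLt_iff _ _).trans (Fin.succ_lt_succ_iff.trans hi.lt_iff_lt)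
  · by_contra hne
    exact hx01 j (hx0 j (by simpa using hne)) h1
  · by_contra hne
    exact hx01 j h0 (hx1 j (by simpa using hne))
  · obtain ⟨S, hS⟩ := isCliqueModel_of_intervals hM P i hi (fun p => (Q p).lift) hQ.lift hRiff
      (fun p => by
        obtain ⟨t, h1, h2, h3⟩ := (hends p).1
        exact ⟨t, ⟨h1, h2⟩, congrArg Subtype.val h3⟩)
      (fun p => by
        obtain ⟨t, h1, h2, h3⟩ := (hends p).2
        exact ⟨t, ⟨h1, h2⟩, congrArg Subtype.val h3⟩)
    exact ⟨S, _, le_rfl, hS, fun j => Or.inl ⟨_, inInterval_succ hi _, rfl⟩⟩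

theorem IsCliqueModel.comp_injective {S : ℕ → Set A} {n m : ℕ} {U : Fin n → Set A}
    (h : M.IsCliqueModel S U) {σ : Fin m → Fin n} (hσ : Function.Injective σ) :
    M.IsCliqueModel S (U ∘ σ) :=
  ⟨fun _ => h.nonempty _, fun _ _ hij => h.disjoint _ _ (hσ.ne hij), fun _ => h.closed _,
    fun _ => h.conn _, fun _ _ hij => h.link _ _ (hσ.ne hij)⟩

/-- With a single blue edge, every vertex of the path that has a colour is a letter. It is an
endpoint of a path of the first family in its own branch set, hence lies on that piece in the first
layer. -/
theorem hasWordModel_of_complex (hM : M.IsGraph) {T : Set A} (hT : M.B ∪ M.R ⊆ T) {k : ℕ}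
    {w : List Bool} (h : (M.induce T).IsComplexPseudoWall k w) : M.HasWordModel k w := by
  obtain ⟨-, L, r₁, r₂, P', Q, -, -, -, hlen, hB, hR, hC0, hC1, hC, hP', hQ, -, ⟨μ, β, hβ, hμ⟩,
    p, hp, hrange, hletter⟩ := h
  let P := L.lift
  have hBiff : ∀ e, e ∈ M.B ↔ ∃ t : Fin P.len, (t : ℕ) = 0 ∧ P.edge t = e := by
    refine mem_iff_of_induce (Set.subset_union_left.trans hT) rfl (fun x => ?_) ?_
    · change x ∈ (M.induce T).B ↔ _
      rw [hB]
      exact exists_congr fun t => and_congr_right fun _ =>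
        ⟨fun h => by rw [h]; rfl, fun h => Subtype.ext h.symm⟩
    · rintro _ ⟨t, -, rfl⟩
      exact (L.edge t).2
  have hRiff : ∀ e, e ∈ M.R ↔ ∃ t : Fin P.len, (t : ℕ) ≠ 0 ∧ P.edge t = e := by
    refine mem_iff_of_induce (Set.subset_union_right.trans hT) rfl (fun x => ?_) ?_
    · change x ∈ (M.induce T).R ↔ _
      rw [hR]
      exact exists_congr fun t => and_congr_right fun _ =>
        ⟨fun h => by rw [h]; rfl, fun h => Subtype.ext h.symm⟩
    · rintro _ ⟨t, -, rfl⟩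
      exact (L.edge t).2
  have hedge := P.edge_injective hM
  have hP : M.IsColouredPath P := by
    refine ⟨hM, fun e => ?_, fun t ht => (hBiff _).2 ⟨t, ht, rfl⟩, fun t ht ht' => ?_⟩
    · rw [hBiff, hRiff]
      constructor
      · rintro (⟨t, -, rfl⟩ | ⟨t, -, rfl⟩) <;> exact ⟨_, rfl⟩
      · rintro ⟨t, rfl⟩
        by_cases ht : (t : ℕ) = 0
        · exact Or.inl ⟨t, ht, rfl⟩
        · exact Or.inr ⟨t, ht, rfl⟩
    · obtain ⟨t', h0, h1⟩ := (hBiff _).1 ht'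
      have h2 := congrArg Fin.val (hedge h1)
      change 2 ≤ P.len at hlen
      omega
  let x : Fin w.length → A := fun j => P.vert (p j)
  have hxc : ∀ j, L.vert (p j) ∈ (M.induce T).C0 ∪ (M.induce T).C1 := fun j =>
    hrange ▸ ⟨j, rfl⟩
  have hx01 : ∀ j, x j ∈ M.C0 → x j ∉ M.C1 := fun j h0 h1 =>
    Set.disjoint_left.1 hC (show L.vert (p j) ∈ _ from h0) h1
  have hx1 : ∀ j, w[j] = true → x j ∈ M.C1 := fun j hj => (hletter j).1 hj
  have hx0 : ∀ j, w[j] = false → x j ∈ M.C0 := fun j hj => (hletter j).2 hj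
  let g : Fin w.length → Fin (k ^ 2) := fun j => β ⟨L.vert (p j), hxc j⟩
  have hg : Function.Injective g := fun a b hab =>
    hp.injective (L.vert_injective (congrArg Subtype.val (hβ hab)))
  have hwk : w.length ≤ k ^ 2 := by
    simpa using Fintype.card_le_of_injective g hg
  -- The letters lie in distinct branch sets with arbitrary numbers; a renumbering moves these to
  -- the front in the order of the word.
  obtain ⟨σ, hσ⟩ : ∃ σ : Equiv.Perm (Fin (k ^ 2)), ∀ j, σ (Fin.castLE hwk j) = g j := by
    classical
    let e : {a // a ∈ Set.range (Fin.castLE hwk)} ≃ {a // a ∈ Set.range g} :=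
      (Equiv.ofInjective _ (Fin.castLE_injective hwk)).symm.trans (Equiv.ofInjective g hg)
    refine ⟨e.extendSubtype, fun j => ?_⟩
    rw [Equiv.extendSubtype_apply_of_mem _ _ ⟨j, rfl⟩]
    simp only [e, Equiv.trans_apply]
    rw [Equiv.ofInjective_symm_apply (Fin.castLE_injective hwk) j]
    rfl
  obtain ⟨S, hS⟩ := isCliqueModel_of_topCliqueImage hM (fun a => (P' a).lift)
    (fun b => (Q b).lift) hP'.lift hQ.lift (H := GPath.intersectionGraph P' Q)
    (fun a b hab => by
      obtain ⟨v, h1, h2⟩ := hab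
      exact ⟨v, GPath.lift_mem_verts.2 ⟨v.2, h1⟩, GPath.lift_mem_verts.2 ⟨v.2, h2⟩⟩)
    (fun _ _ h => h) (fun _ _ h => h) μ
  refine ⟨x, ⟨fun z => ?_, fun a b => ?_, fun j => ⟨fun h1 => ?_, hx1 j⟩,
    fun j => ⟨fun h0 => ?_, hx0 j⟩⟩, k ^ 2, hwk, S, _, Nat.le_self_pow (by omega) k,
    hS.comp_injective σ.injective, fun j => ?_⟩
  · have hone : ∀ e f, e ∈ M.B → f ∈ M.B → e = f := by
      intro e f he hf
      obtain ⟨t, ht, rfl⟩ := (hBiff e).1 he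
      obtain ⟨t', ht', rfl⟩ := (hBiff f).1 hf
      exact congrArg P.edge (Fin.ext (ht.trans ht'.symm))
    simp only [IsLetter, hP.mem_verts_iff, true_or, and_true, eq_true hone]
    constructor
    · rintro ⟨⟨t, rfl⟩, hz⟩
      have h1 : L.vert t ∈ (M.induce T).C0 ∪ (M.induce T).C1 := hz
      rw [← hrange] at h1
      obtain ⟨j, hj⟩ := h1
      exact ⟨j, congrArg Subtype.val hj⟩
    · rintro ⟨j, rfl⟩
      exact ⟨⟨_, rfl⟩, hxc j⟩
  · exact (hP.pathLt_iff _ _).trans hp.lt_iff_lt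
  · by_contra hne
    exact hx01 j (hx0 j (by simpa using hne)) h1
  · by_contra hne
    exact hx01 j h0 (hx1 j (by simpa using hne))
  · obtain ⟨a, ha, hab⟩ := hμ ⟨L.vert (p j), hxc j⟩
    refine Or.inl ⟨a, ?_, ?_⟩
    · rw [hσ]
      exact hab
    · rcases ha with ha | ha
      · exact ⟨0, congrArg Subtype.val ha.symm⟩
      · exact ⟨Fin.last _, congrArg Subtype.val ha.symm⟩

theorem hasWordModel_of_containsPseudoWall (hM : M.IsGraph) {k : ℕ} {w : List Bool}
    (h : M.ContainsPseudoWall k w) : M.HasWordModel k w := by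
  obtain ⟨T, hT, h | h⟩ := h
  · exact hasWordModel_of_simple hM hT h
  · exact hasWordModel_of_complex hM hT h

theorem ContainsPseudoWall.nonempty {k : ℕ} {w : List Bool} (h : M.ContainsPseudoWall k w) :
    Nonempty A := by
  obtain ⟨T, hT, ⟨_, _, L, _⟩ | ⟨_, L, _⟩⟩ := h
  · exact ⟨L.vert 0⟩
  · exact ⟨L.vert 0⟩

end ColStructure

/-! ### Computations as sequences of instructions -/

namespace TM

variable (K : TM)

/-- The instruction with number `q`. -/
def ins (q : ℕ) : ℕ × ℕ × ℕ × ℕ × Option Bool := K.instr.getD q (0, 0, 0, 0, none)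

/-- The result of carrying out the instruction with number `q`, applicable or not. -/
def exec (q : ℕ) (c : Cfg) : Cfg :=
  ⟨(K.ins q).2.2.1, c.head + moveBy (K.ins q).2.2.2.2,
    Function.update c.tape c.head (K.ins q).2.2.2.1⟩

/-- The instruction with number `q` exists and is applicable. -/
def Applicable (q : ℕ) (c : Cfg) : Prop :=
  q < K.instr.length ∧ c.state = (K.ins q).1 ∧ c.tape c.head = (K.ins q).2.1

/-- The configuration reached from the initial one by the instructions `ρ 0, …, ρ (t - 1)`. -/
def conf (w : List Bool) (ρ : ℕ → ℕ) (t : ℕ) : Cfg :=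
  Nat.rec (K.init w) (fun t c => K.exec (ρ t) c) t

/-- The instructions `ρ 0, …, ρ (T - 1)` can be carried out. -/
def IsLegal (w : List Bool) (ρ : ℕ → ℕ) (T : ℕ) : Prop :=
  ∀ t < T, K.Applicable (ρ t) (K.conf w ρ t)

variable {K} {w : List Bool} {ρ ρ' : ℕ → ℕ}

theorem step_iff {c c' : Cfg} : K.Step c c' ↔ ∃ q, K.Applicable q c ∧ c' = K.exec q c := by
  constructor
  · rintro ⟨q', a', m, hmem, rfl⟩
    obtain ⟨q, hq, he⟩ := List.getElem_of_mem hmem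
    have h : K.ins q = (c.state, c.tape c.head, q', a', m) := by
      rw [ins, List.getD_eq_getElem _ _ hq, he]
    refine ⟨q, ⟨hq, ?_, ?_⟩, ?_⟩
    · rw [h]
    · rw [h]
    · rw [exec, h]
  · rintro ⟨q, ⟨hq, h1, h2⟩, rfl⟩
    refine ⟨_, _, _, ?_, rfl⟩
    rw [h1, h2]
    change K.ins q ∈ K.instr
    rw [ins, List.getD_eq_getElem _ _ hq]
    exact List.getElem_mem hq

theorem halted_iff {c : Cfg} : K.Halted c ↔ ∀ q < K.instr.length,
    ¬ (c.state = (K.ins q).1 ∧ c.tape c.head = (K.ins q).2.1) := by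
  simp only [Halted, step_iff, Applicable]
  constructor
  · exact fun h q hq hc => h _ ⟨q, ⟨hq, hc⟩, rfl⟩
  · rintro h _ ⟨q, ⟨hq, hc⟩, -⟩
    exact h q hq hc

theorem conf_succ (t : ℕ) : K.conf w ρ (t + 1) = K.exec (ρ t) (K.conf w ρ t) := rfl

theorem conf_congr {T : ℕ} (h : ∀ t < T, ρ t = ρ' t) : ∀ t ≤ T, K.conf w ρ t = K.conf w ρ' t := by
  intro t
  induction t with
  | zero => exact fun _ => rfl
  | succ t ih => intro ht; rw [conf_succ, conf_succ, ih (by omega), h t (by omega)]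

theorem IsLegal.congr {T : ℕ} (h : ∀ t < T, ρ t = ρ' t) (hl : K.IsLegal w ρ T) :
    K.IsLegal w ρ' T := by
  intro t ht
  rw [← h t ht, ← conf_congr h t ht.le]
  exact hl t ht

theorem IsLegal.step {T t : ℕ} (hl : K.IsLegal w ρ T) (ht : t < T) :
    K.Step (K.conf w ρ t) (K.conf w ρ (t + 1)) :=
  step_iff.2 ⟨_, hl t ht, rfl⟩

theorem IsLegal.isRun {T : ℕ} (hl : K.IsLegal w ρ T) : K.IsRun w T (K.conf w ρ) :=
  ⟨rfl, fun _ ht => hl.step ht⟩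

/-- A computation can be prolonged by an applicable instruction. -/
theorem IsLegal.extend {T : ℕ} (hl : K.IsLegal w ρ T) {c : Cfg} (h : K.Step (K.conf w ρ T) c) :
    ∃ ρ', (∀ t < T, ρ t = ρ' t) ∧ K.IsLegal w ρ' (T + 1) ∧ K.conf w ρ' (T + 1) = c := by
  obtain ⟨q, hq, rfl⟩ := step_iff.1 h
  have hρ : ∀ t < T, ρ t = Function.update ρ T q t := fun t ht => by
    rw [Function.update_of_ne ht.ne]
  have hc := conf_congr (K := K) (w := w) hρ
  refine ⟨Function.update ρ T q, hρ, fun t ht => ?_, ?_⟩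
  · rcases Nat.lt_succ_iff_lt_or_eq.1 ht with h' | rfl
    · exact (hl.congr hρ) t h'
    · rw [Function.update_self, ← hc t le_rfl]
      exact hq
  · rw [conf_succ, Function.update_self, ← hc T le_rfl]

theorem abs_moveBy (m : Option Bool) : |moveBy m| ≤ 1 := by
  rcases m with _ | _ | _ <;> simp [moveBy]

/-- The head moves by at most one cell per step. Hence n steps stay within the n cells on either
side of cell 0, which the domain can name. -/
theorem abs_head_le (t : ℕ) : |(K.conf w ρ t).head| ≤ t := by
  induction t with
  | zero => simp [conf, init]
  | succ t ih =>
    have h := abs_moveBy (K.ins (ρ t)).2.2.2.2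
    have : (K.conf w ρ (t + 1)).head = (K.conf w ρ t).head + moveBy (K.ins (ρ t)).2.2.2.2 := rfl
    rw [this]
    refine (abs_add_le _ _).trans ?_
    push_cast
    omega

/-- The content of a cell is what has been written there at the last visit. -/
theorem tape_conf (t : ℕ) (z : ℤ) :
    (∃ v < t, (K.conf w ρ v).head = z ∧ (∀ v' < t, v < v' → (K.conf w ρ v').head ≠ z) ∧
      (K.conf w ρ t).tape z = (K.ins (ρ v)).2.2.2.1) ∨
    (∀ v < t, (K.conf w ρ v).head ≠ z) ∧ (K.conf w ρ t).tape z = (K.init w).tape z := by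
  induction t with
  | zero => exact Or.inr ⟨by simp, rfl⟩
  | succ t ih =>
    by_cases hz : (K.conf w ρ t).head = z
    · refine Or.inl ⟨t, by omega, hz, fun v' h1 h2 => by omega, ?_⟩
      rw [conf_succ, exec, hz]
      simp
    · have hu : (K.conf w ρ (t + 1)).tape z = (K.conf w ρ t).tape z := by
        rw [conf_succ, exec]
        simp only
        rw [Function.update_of_ne (Ne.symm hz)]
      rw [hu]
      rcases ih with ⟨v, h1, h2, h3, h4⟩ | ⟨h1, h2⟩
      · refine Or.inl ⟨v, by omega, h2, fun v' h5 h6 => ?_, h4⟩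
        rcases Nat.lt_succ_iff_lt_or_eq.1 h5 with h' | rfl
        · exact h3 v' h' h6
        · exact hz
      · refine Or.inr ⟨fun v h5 => ?_, h2⟩
        rcases Nat.lt_succ_iff_lt_or_eq.1 h5 with h' | rfl
        · exact h1 v h'
        · exact hz

/-- The last visit is unique, so the symbol is expressed through instructions and head positions
alone; this is why no set has to store the tape. -/
theorem tape_conf_eq_iff (t : ℕ) (z : ℤ) (a : ℕ) : (K.conf w ρ t).tape z = a ↔
    (∃ v < t, (K.conf w ρ v).head = z ∧ (∀ v' < t, v < v' → (K.conf w ρ v').head ≠ z) ∧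
      (K.ins (ρ v)).2.2.2.1 = a) ∨
    (∀ v < t, (K.conf w ρ v).head ≠ z) ∧ (K.init w).tape z = a := by
  rcases tape_conf (K := K) (w := w) (ρ := ρ) t z with ⟨v, h1, h2, h3, h4⟩ | ⟨h1, h2⟩
  · rw [h4]
    constructor
    · exact fun h => Or.inl ⟨v, h1, h2, h3, h⟩
    · rintro (⟨v', h5, h6, h7, h8⟩ | ⟨h5, -⟩)
      · have : v = v' := by
          rcases lt_trichotomy v v' with h | h | h
          · exact absurd h6 (h3 v' h5 h)
          · exact h
          · exact absurd h2 (h7 v h1 h)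
        rwa [this]
      · exact absurd h2 (h5 v h1)
  · rw [h2]
    constructor
    · exact fun h => Or.inr ⟨h1, h⟩
    · rintro (⟨v', h5, h6, -⟩ | ⟨-, h⟩)
      · exact absurd h6 (h1 v' h5)
      · exact h

theorem init_tape_one_iff (z : ℤ) :
    (K.init w).tape z = 1 ↔ 0 ≤ z ∧ w[z.toNat]? = some false := by
  rcases z with i | i
  · simp only [init, Int.ofNat_eq_natCast, Int.natCast_nonneg, true_and, Int.toNat_natCast]
    rcases w[i]? with _ | _ | _ <;> simp [letter]
  · simp [init, Int.negSucc_not_nonneg]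

theorem init_tape_two_iff (z : ℤ) :
    (K.init w).tape z = 2 ↔ 0 ≤ z ∧ w[z.toNat]? = some true := by
  rcases z with i | i
  · simp only [init, Int.ofNat_eq_natCast, Int.natCast_nonneg, true_and, Int.toNat_natCast]
    rcases w[i]? with _ | _ | _ <;> simp [letter]
  · simp [init, Int.negSucc_not_nonneg]

theorem init_tape_le (z : ℤ) : (K.init w).tape z ≤ 2 := by
  rcases z with i | i
  · simp only [init]
    rcases w[i]? with _ | _ | _ <;> simp [letter]
  · simp [init]

end TM

/-! ### Formulas about computations

A computation is encoded by the sets with the numbers `10 + 2 * k + σ`, where `σ` is `0` or `1`. The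
elements of the domain are used both to number the steps and to number the cells on either side of
the cell `0`. The sets with `k = 0`, `1 ≤ k ≤ 3`, `4 ≤ k ≤ 6` say whether the head is on the cell
`0`, on which positive cell, and on which negative cell it is after a step; the sets with `7 ≤ k` say
which instruction is carried out. A configuration is denoted by `none` (the initial one) or
`some v` (the one after the step `v`). -/

namespace MSO

def iff (φ ψ : MSO) : MSO := and (imp φ ψ) (imp ψ φ)

def lt (x y : ℕ) : MSO := codedRel 4 x y

def le (x y : ℕ) : MSO := or (eq x y) (lt x y)

def first (x : ℕ) : MSO := not (exDom (x + 1) (lt (x + 1) x))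

def succ (x y : ℕ) : MSO :=
  and (lt x y) (not (exDom (x + y + 1) (and (lt x (x + y + 1)) (lt (x + y + 1) y))))

/-- `F` holds of the configuration before the step `x`. -/
def before (k x : ℕ) (F : Option ℕ → MSO) : MSO :=
  or (and (first x) (F none)) (exDom k (and (succ k x) (F (some k))))

def headZero (σ : ℕ) : Option ℕ → MSO
  | none => not falsum
  | some v => mem v (10 + σ)

def sideBase : Bool → ℕ
  | true => 12
  | false => 18

def sideSign : Bool → ℤ
  | true => 1
  | false => -1

/-- The head is on the cell with number `i` on the positive or on the negative side. -/
def headSide (σ : ℕ) (b : Bool) (i : ℕ) : Option ℕ → MSO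
  | none => falsum
  | some v => codedRel (sideBase b + σ) v i

def sameHead (σ : ℕ) (τ τ' : Option ℕ) : MSO :=
  or (and (headZero σ τ) (headZero σ τ'))
    (or (exDom 25 (and (headSide σ true 25 τ) (headSide σ true 25 τ')))
      (exDom 25 (and (headSide σ false 25 τ) (headSide σ false 25 τ'))))

def headKept (σ : ℕ) : MSO :=
  and (iff (headZero σ (some 20)) (before 21 20 (headZero σ)))
    (allDom 25 (and
      (iff (headSide σ true 25 (some 20)) (before 21 20 (headSide σ true 25)))
      (iff (headSide σ false 25 (some 20)) (before 21 20 (headSide σ false 25)))))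

/-- Here `b` is the side towards which the head moves: cell 0 is entered from the first cell of the
opposite side, cell numbers grow on the side `b`, and they shrink on the opposite one. -/
def headMoved (σ : ℕ) (b : Bool) : MSO :=
  and (iff (headZero σ (some 20))
      (exDom 25 (and (first 25) (before 21 20 (headSide σ (!b) 25)))))
    (allDom 25 (and
      (iff (headSide σ b 25 (some 20)) (or (and (first 25) (before 21 20 (headZero σ)))
        (exDom 26 (and (succ 26 25) (before 21 20 (headSide σ b 26))))))
      (iff (headSide σ (!b) 25 (some 20))
        (exDom 26 (and (succ 25 26) (before 21 20 (headSide σ (!b) 26)))))))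

def headUpdate (σ : ℕ) : Option Bool → MSO
  | none => headKept σ
  | some b => headMoved σ b

/-- The initial inscription of the visited cell is the letter with the colour `U`. -/
def initLetter (σ : ℕ) (U : UnarySym) (τ : Option ℕ) : MSO :=
  or (and (headZero σ τ) (exDom 25 (and (first 25) (hasLetter U 25))))
    (exDom 25 (exDom 26 (and (headSide σ true 25 τ) (and (succ 25 26) (hasLetter U 26)))))

def initSymbol (σ a : ℕ) (τ : Option ℕ) : MSO :=
  if a = 0 then and (not (initLetter σ .C0 τ)) (not (initLetter σ .C1 τ)) else
    if a = 1 then initLetter σ .C0 τ else if a = 2 then initLetter σ .C1 τ else falsum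

/-- The step `x` belongs to the computation that leads to the given configuration. -/
def isEarlier (x : ℕ) : Option ℕ → MSO
  | none => falsum
  | some v => le x v

/-- The step `x` takes place on the cell visited in the given configuration. -/
def sameCell (σ x : ℕ) (τ : Option ℕ) : MSO := before 24 x fun τ' => sameHead σ τ' τ

/-- In the step `x`, an instruction is carried out that has the property `c`. -/
def select (K : TM) (σ : ℕ) (c : ℕ → Prop) [DecidablePred c] (x : ℕ) : MSO :=
  bigOr K.instr.length fun q => if c q then mem x (24 + 2 * q + σ) else falsum

/-- The symbol read in the given configuration is `a`. -/
def symbolIs (K : TM) (σ a : ℕ) (τ : Option ℕ) : MSO :=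
  or (exDom 22 (and (isEarlier 22 τ) (and (sameCell σ 22 τ)
      (and (allDom 23 (imp (lt 22 23) (imp (isEarlier 23 τ) (not (sameCell σ 23 τ)))))
        (select K σ (fun q => (K.ins q).2.2.2.1 = a) 22)))))
    (and (allDom 22 (imp (isEarlier 22 τ) (not (sameCell σ 22 τ)))) (initSymbol σ a τ))

def stateIs (K : TM) (σ a : ℕ) : Option ℕ → MSO
  | none => if K.start = a then not falsum else falsum
  | some v => select K σ (fun q => (K.ins q).2.2.1 = a) v

def applicable (K : TM) (σ q : ℕ) (τ : Option ℕ) : MSO :=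
  and (stateIs K σ (K.ins q).1 τ) (symbolIs K σ (K.ins q).2.1 τ)

/-- The step `x` is carried out. -/
def isStep (K : TM) (σ x : ℕ) : MSO := select K σ (fun _ => True) x

/-- No step has two instructions, the steps in use form an initial segment, and the head follows the
instructions. Applicability is left to `isLegal`: a trace already determines its configurations, so
that `isLegal` can be evaluated in them. -/
def isTrace (K : TM) (σ : ℕ) : MSO :=
  and (allDom 20 (bigAnd K.instr.length fun q =>
      imp (mem 20 (24 + 2 * q + σ)) (not (select K σ (fun p => p ≠ q) 20)))) <|
  and (allDom 20 (imp (isStep K σ 20) (allDom 21 (imp (lt 21 20) (isStep K σ 21))))) <|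
  allDom 20 <|
    and (imp (select K σ (fun q => (K.ins q).2.2.2.2 = none) 20) (headUpdate σ none)) <|
    and (imp (select K σ (fun q => (K.ins q).2.2.2.2 = some true) 20) (headUpdate σ (some true)))
      (imp (select K σ (fun q => (K.ins q).2.2.2.2 = some false) 20) (headUpdate σ (some false)))

def isLegal (K : TM) (σ : ℕ) : MSO :=
  allDom 20 (bigAnd K.instr.length fun q =>
    imp (mem 20 (24 + 2 * q + σ)) (before 21 20 (applicable K σ q)))

end MSO

/-! ### Meaning of the order and head formulas in an enumerated domain -/

namespace ColStructure

open MSO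

variable {A : Type u} {M : ColStructure A} {s : ℕ → A} {S : ℕ → Set A} {w : List Bool} {n : ℕ}
  {e : Fin n → A} {σ : ℕ} {K : TM} {ρ : ℕ → ℕ} {T : ℕ}

@[simp] theorem sat_iff {φ ψ} : Sat M (MSO.iff φ ψ) s S ↔ (Sat M φ s S ↔ Sat M ψ s S) := by
  simp only [MSO.iff, sat_and, sat_imp]; tauto

section Order

variable (hE : M.IsEnum S w e)
include hE

theorem IsEnum.sat_exDom {x φ} : Sat M (exDom x φ) s S ↔
    ∃ i, Sat M φ (Function.update s x (e i)) S := by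
  rw [MSO.sat_exDom]
  constructor
  · rintro ⟨a, ha, h⟩
    obtain ⟨i, rfl⟩ := (hE.mem_dom_iff a).1 ha
    exact ⟨i, h⟩
  · rintro ⟨i, h⟩
    exact ⟨_, (hE.mem_dom_iff _).2 ⟨i, rfl⟩, h⟩

theorem IsEnum.sat_allDom {x φ} : Sat M (allDom x φ) s S ↔
    ∀ i, Sat M φ (Function.update s x (e i)) S := by
  rw [MSO.sat_allDom]
  constructor
  · exact fun h i => h _ ((hE.mem_dom_iff _).2 ⟨i, rfl⟩)
  · rintro h a ha
    obtain ⟨i, rfl⟩ := (hE.mem_dom_iff a).1 ha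
    exact h i

variable {x y : ℕ} {i j : Fin n} (hx : s x = e i) (hy : s y = e j)
include hx

theorem IsEnum.sat_first : Sat M (first x) s S ↔ (i : ℕ) = 0 := by
  rw [first, sat_not, hE.sat_exDom]
  simp only [lt, sat_codedRel, Function.update_self,
    Function.update_of_ne (show x ≠ x + 1 by omega), hx, hE.lt_iff, Fin.lt_def]
  constructor
  · intro h
    by_contra h0
    exact h ⟨⟨0, by omega⟩, by simp; omega⟩
  · rintro h ⟨k, hk⟩
    omega

include hy

theorem IsEnum.sat_lt : Sat M (lt x y) s S ↔ (i : ℕ) < j := by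
  rw [lt, sat_codedRel, hx, hy, hE.lt_iff, Fin.lt_def]

theorem IsEnum.sat_le : Sat M (le x y) s S ↔ (i : ℕ) ≤ j := by
  rw [le, sat_or, sat_eq, hE.sat_lt hx hy, hx, hy, hE.injective.eq_iff, Fin.ext_iff]
  omega

theorem IsEnum.sat_succ : Sat M (succ x y) s S ↔ (i : ℕ) + 1 = j := by
  rw [succ, sat_and, hE.sat_lt hx hy, sat_not, hE.sat_exDom]
  simp only [lt, sat_and, sat_codedRel, Function.update_self,
    Function.update_of_ne (show x ≠ x + y + 1 by omega),
    Function.update_of_ne (show y ≠ x + y + 1 by omega), hx, hy, hE.lt_iff, Fin.lt_def]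
  constructor
  · rintro ⟨h1, h2⟩
    by_contra h0
    exact h2 ⟨⟨i + 1, by omega⟩, by simp, by simp; omega⟩
  · rintro h
    exact ⟨by omega, by rintro ⟨k, hk⟩; omega⟩

end Order

/-- The term `τ` denotes the configuration with number `c`. -/
def Denotes (e : Fin n → A) (s : ℕ → A) (c : ℕ) : Option ℕ → Prop
  | none => c = 0
  | some v => ∃ t : Fin n, s v = e t ∧ c = t + 1

theorem Denotes.update {c : ℕ} {τ : Option ℕ} (h : Denotes e s c τ) {k : ℕ} {a : A}
    (hk : ∀ v ∈ τ, v ≠ k) : Denotes e (Function.update s k a) c τ := by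
  rcases τ with _ | v
  · exact h
  · obtain ⟨t, h1, h2⟩ := h
    exact ⟨t, by rw [Function.update_of_ne (hk v rfl), h1], h2⟩

/-- The configuration before step t has number t: it is the initial one if t is the first element,
and otherwise the one after the predecessor of t. Both denotations are covered by the single
hypothesis `hF`. -/
theorem IsEnum.sat_before (hE : M.IsEnum S w e) {x k : ℕ} (hk : k ≠ x) {t : Fin n}
    (hx : s x = e t) {F : Option ℕ → MSO} {p : Prop}
    (hF : ∀ s' τ, (∀ v ≠ k, s' v = s v) → (∀ v ∈ τ, v = k) → Denotes e s' t τ →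
      (Sat M (F τ) s' S ↔ p)) : Sat M (before k x F) s S ↔ p := by
  rw [before, sat_or, sat_and, hE.sat_first hx, hE.sat_exDom]
  have h1 : ∀ i, Sat M (MSO.and (succ k x) (F (some k))) (Function.update s k (e i)) S ↔
      (i : ℕ) + 1 = t ∧ p := by
    intro i
    rw [sat_and, hE.sat_succ (Function.update_self ..)
      ((Function.update_of_ne hk.symm ..).trans hx)]
    refine and_congr_right fun hi => hF _ _ (fun v hv => Function.update_of_ne hv ..)
      (by simp) ⟨i, Function.update_self .., hi.symm⟩
  simp only [h1]
  by_cases h0 : (t : ℕ) = 0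
  · rw [hF s none (fun _ _ => rfl) (by simp) h0]
    simp [h0]
  · constructor
    · rintro (⟨h, -⟩ | ⟨i, -, h⟩)
      · exact absurd h h0
      · exact h
    · exact fun h => Or.inr ⟨⟨t - 1, by omega⟩, by simp; omega, h⟩

/-- The sets of the slot `σ` say that the head is on the cell `z` after the step `t`. -/
def HeadAt (M : ColStructure A) (S : ℕ → Set A) (e : Fin n → A) (σ : ℕ) (t : Fin n) (z : ℤ) : Prop :=
  (e t ∈ S (10 + σ) ↔ z = 0) ∧
    ∀ b i, M.CodedRel S (sideBase b + σ) (e t) (e i) ↔ z = sideSign b * ((i : ℕ) + 1)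

/-- The sets of the slot `σ` encode the sequence of instructions `ρ 0, …, ρ (T - 1)` together with
the resulting head positions. -/
structure IsTrace (M : ColStructure A) (K : TM) (w : List Bool) (S : ℕ → Set A) (e : Fin n → A)
    (σ : ℕ) (ρ : ℕ → ℕ) (T : ℕ) : Prop where
  le : T ≤ n
  lt_length : ∀ t < T, ρ t < K.instr.length
  mem_iff : ∀ (t : Fin n), ∀ q < K.instr.length,
    e t ∈ S (24 + 2 * q + σ) ↔ (t : ℕ) < T ∧ ρ t = q
  headAt : ∀ t : Fin n, (t : ℕ) < T → M.HeadAt S e σ t (K.conf w ρ (t + 1)).head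

section Head

variable {hd : ℕ → ℤ} (h0 : hd 0 = 0)
  (hT : ∀ t : Fin n, (t : ℕ) < T → M.HeadAt S e σ t (hd (t + 1)))
  {c : ℕ} (hc : c ≤ T) {τ : Option ℕ} (hτ : Denotes e s c τ)
include h0 hT hc hτ

theorem sat_headZero : Sat M (headZero σ τ) s S ↔ hd c = 0 := by
  rcases τ with _ | v
  · obtain rfl : c = 0 := hτ
    simp [headZero, h0]
  · obtain ⟨t, h1, rfl⟩ := hτ
    rw [headZero, sat_mem, h1, (hT t (by omega)).1]

theorem sat_headSide {b : Bool} {x : ℕ} {i : Fin n} (hx : s x = e i) :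
    Sat M (headSide σ b x τ) s S ↔ hd c = sideSign b * ((i : ℕ) + 1) := by
  rcases τ with _ | v
  · obtain rfl : c = 0 := hτ
    simp only [headSide, sat_falsum, h0, false_iff]
    cases b <;> simp only [sideSign] <;> omega
  · obtain ⟨t, h1, rfl⟩ := hτ
    rw [headSide, sat_codedRel, h1, hx, (hT t (by omega)).2]

theorem sat_sameHead (hE : M.IsEnum S w e) (hb : ∀ c ≤ T, |hd c| ≤ n) {c' : ℕ} (hc' : c' ≤ T)
    {τ' : Option ℕ} (hτ' : Denotes e s c' τ') (h25 : ∀ v ∈ τ, v ≠ 25) (h25' : ∀ v ∈ τ', v ≠ 25) :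
    Sat M (sameHead σ τ τ') s S ↔ hd c = hd c' := by
  have hside : ∀ b, Sat M (exDom 25 (MSO.and (headSide σ b 25 τ) (headSide σ b 25 τ'))) s S ↔
      ∃ i : Fin n, hd c = sideSign b * ((i : ℕ) + 1) ∧ hd c' = sideSign b * ((i : ℕ) + 1) := by
    intro b
    rw [hE.sat_exDom]
    refine exists_congr fun i => ?_
    rw [sat_and, sat_headSide h0 hT hc (hτ.update h25) (Function.update_self ..),
      sat_headSide h0 hT hc' (hτ'.update h25') (Function.update_self ..)]
  rw [sameHead, sat_or, sat_or, hside, hside, sat_and, sat_headZero h0 hT hc hτ,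
    sat_headZero h0 hT hc' hτ']
  have h1 := abs_le.1 (hb c hc)
  constructor
  · rintro (⟨h, h'⟩ | ⟨i, h, h'⟩ | ⟨i, h, h'⟩) <;> rw [h, h']
  · intro h
    rw [← h]
    simp only [and_self, sideSign]
    rcases lt_trichotomy (hd c) 0 with h2 | h2 | h2
    -- The element with number i names the cell at distance i + 1 from cell 0, since cell 0 has a
    -- set of its own.
    · refine Or.inr (Or.inr ⟨⟨(-hd c - 1).toNat, by omega⟩, ?_⟩)
      simp only
      omega
    · exact Or.inl h2
    · refine Or.inr (Or.inl ⟨⟨(hd c - 1).toNat, by omega⟩, ?_⟩)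
      simp only
      omega

end Head

end ColStructure

/-! ### Correctness of the head movement -/

namespace ColStructure

open MSO

variable {A : Type u} {M : ColStructure A} {s : ℕ → A} {S : ℕ → Set A} {w : List Bool} {n : ℕ}
  {e : Fin n → A} {σ : ℕ} {K : TM} {ρ : ℕ → ℕ} {T : ℕ}

section Update

variable {hd : ℕ → ℤ} (hE : M.IsEnum S w e) (h0 : hd 0 = 0) {t : Fin n}
  (hT : ∀ t' : Fin n, (t' : ℕ) < t → M.HeadAt S e σ t' (hd (t' + 1))) (hx : s 20 = e t)
include hE h0 hT hx

theorem sat_before_headZero : Sat M (before 21 20 (headZero σ)) s S ↔ hd t = 0 :=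
  hE.sat_before (by omega) hx fun _ _ _ _ hd => sat_headZero h0 hT le_rfl hd

theorem sat_before_headSide {b : Bool} {y : ℕ} (hy : y ≠ 21) {i : Fin n} (hi : s y = e i) :
    Sat M (before 21 20 (headSide σ b y)) s S ↔ hd t = sideSign b * ((i : ℕ) + 1) :=
  hE.sat_before (by omega) hx fun _ _ hs _ hd =>
    sat_headSide h0 hT le_rfl hd ((hs y hy).trans hi)

theorem sat_headKept : Sat M (headKept σ) s S ↔ M.HeadAt S e σ t (hd t) := by
  have h20 : ∀ i, Function.update s 25 (e i) 20 = e t := fun i => by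
    rw [Function.update_of_ne (by omega), hx]
  have hi : ∀ i, Function.update s 25 (e i) 25 = e i := fun i => Function.update_self ..
  rw [headKept, sat_and, sat_iff, hE.sat_allDom, sat_before_headZero hE h0 hT hx]
  simp only [sat_and, sat_iff]
  simp only [sat_before_headSide hE h0 hT (h20 _) (show 25 ≠ 21 by omega) (hi _)]
  simp only [headZero, sat_mem, headSide, sat_codedRel, hx, h20, hi, HeadAt, Bool.forall_bool]
  exact and_congr_right fun _ => ⟨fun h => ⟨fun i => (h i).2, fun i => (h i).1⟩,
    fun h i => ⟨h.2 i, h.1 i⟩⟩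

/-- From |hd t| ≤ t < n it follows that the positions before and after the step are at distance at
most n from cell 0. So every cell involved has a name, and no case is lost at the end of the domain.
-/
theorem sat_headMoved (hb : |hd t| ≤ (t : ℕ)) (b : Bool) :
    Sat M (headMoved σ b) s S ↔ M.HeadAt S e σ t (hd t + sideSign b) := by
  have h20 : ∀ i, Function.update s 25 (e i) 20 = e t := fun i => by
    rw [Function.update_of_ne (by omega), hx]
  have hi : ∀ i, Function.update s 25 (e i) 25 = e i := fun i => Function.update_self ..
  have h20' : ∀ i j, Function.update (Function.update s 25 (e i)) 26 (e j) 20 = e t := fun i j => by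
    rw [Function.update_of_ne (by omega), h20]
  have h25' : ∀ i j, Function.update (Function.update s 25 (e i)) 26 (e j) 25 = e i := fun i j => by
    rw [Function.update_of_ne (by omega), hi]
  have hj : ∀ i j, Function.update (Function.update s 25 (e i)) 26 (e j) 26 = e j := fun i j =>
    Function.update_self ..
  have hbt := abs_le.1 hb
  have ht := t.2
  rw [headMoved, sat_and, sat_iff, hE.sat_exDom, hE.sat_allDom]
  simp only [sat_and, sat_iff, sat_or, hE.sat_exDom]
  simp only [sat_before_headSide hE h0 hT (h20 _) (show 25 ≠ 21 by omega) (hi _),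
    sat_before_headSide hE h0 hT (h20' _ _) (show 26 ≠ 21 by omega) (hj _ _),
    sat_before_headZero hE h0 hT (h20 _), hE.sat_first (hi _),
    hE.sat_succ (h25' _ _) (hj _ _), hE.sat_succ (hj _ _) (h25' _ _)]
  simp only [headZero, sat_mem, headSide, sat_codedRel, hx, h20, hi, HeadAt]
  have e1 : (∃ i : Fin n, (i : ℕ) = 0 ∧ hd t = sideSign (!b) * ((i : ℕ) + 1)) ↔
      hd t + sideSign b = 0 := by
    constructor
    · rintro ⟨i, h1, h2⟩
      rw [h1] at h2
      cases b <;> simp only [sideSign, Bool.not_true, Bool.not_false] at h2 ⊢ <;> omega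
    · intro h
      refine ⟨⟨0, by omega⟩, rfl, ?_⟩
      cases b <;> simp only [sideSign, Bool.not_true, Bool.not_false] at h ⊢ <;> omega
  have e2 : ∀ i : Fin n, ((i : ℕ) = 0 ∧ hd t = 0 ∨
      ∃ j : Fin n, (j : ℕ) + 1 = i ∧ hd t = sideSign b * ((j : ℕ) + 1)) ↔
      hd t + sideSign b = sideSign b * ((i : ℕ) + 1) := by
    intro i
    have := i.2
    constructor
    · rintro (⟨h1, h2⟩ | ⟨j, h1, h2⟩)
      · cases b <;> simp only [sideSign] <;> omega
      · cases b <;> simp only [sideSign] at h2 ⊢ <;> omega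
    · intro h
      by_cases hi0 : (i : ℕ) = 0
      · left
        cases b <;> simp only [sideSign] at h <;> omega
      · right
        refine ⟨⟨i - 1, by omega⟩, by simp; omega, ?_⟩
        cases b <;> simp only [sideSign] at h ⊢ <;> omega
  have e3 : ∀ i : Fin n, (∃ j : Fin n, (i : ℕ) + 1 = j ∧ hd t = sideSign (!b) * ((j : ℕ) + 1)) ↔
      hd t + sideSign b = sideSign (!b) * ((i : ℕ) + 1) := by
    intro i
    have := i.2
    constructor
    · rintro ⟨j, h1, h2⟩
      cases b <;> simp only [sideSign, Bool.not_true, Bool.not_false] at h2 ⊢ <;> omega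
    · intro h
      have : (i : ℕ) + 1 < n := by
        cases b <;> simp only [sideSign, Bool.not_true, Bool.not_false] at h <;> omega
      refine ⟨⟨i + 1, this⟩, rfl, ?_⟩
      cases b <;> simp only [sideSign, Bool.not_true, Bool.not_false] at h ⊢ <;> omega
  simp only [e1, e2, e3]
  refine and_congr_right fun _ => ?_
  cases b <;> simp only [Bool.forall_bool, Bool.not_true, Bool.not_false]
  · exact ⟨fun h => ⟨fun i => (h i).1, fun i => (h i).2⟩, fun h i => ⟨h.1 i, h.2 i⟩⟩
  · exact ⟨fun h => ⟨fun i => (h i).2, fun i => (h i).1⟩, fun h i => ⟨h.2 i, h.1 i⟩⟩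

/-- Only the sets at steps before t are assumed to be correct, so that the correctness of all head
positions can be derived by induction on the step. -/
theorem sat_headUpdate (hb : |hd t| ≤ (t : ℕ)) (m : Option Bool) :
    Sat M (headUpdate σ m) s S ↔ M.HeadAt S e σ t (hd t + moveBy m) := by
  rcases m with _ | b
  · simpa [headUpdate, moveBy] using sat_headKept hE h0 hT hx
  · have : moveBy (some b) = sideSign b := by cases b <;> rfl
    rw [this]
    exact sat_headMoved hE h0 hT hx hb b

end Update

/-! ### The meaning of the formulas in a trace -/

section Trace

variable (hE : M.IsEnum S w e) (hρ : M.IsTrace K w S e σ ρ T)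

theorem sat_select {c : ℕ → Prop} [DecidablePred c] {x : ℕ} : Sat M (select K σ c x) s S ↔
    ∃ q < K.instr.length, c q ∧ s x ∈ S (24 + 2 * q + σ) := by
  rw [select, sat_bigOr]
  refine exists_congr fun q => and_congr_right fun _ => ?_
  split <;> simp [*]

include hρ

theorem IsTrace.sat_select {c : ℕ → Prop} [DecidablePred c] {x : ℕ} {t : Fin n}
    (hx : s x = e t) : Sat M (select K σ c x) s S ↔ (t : ℕ) < T ∧ c (ρ t) := by
  rw [ColStructure.sat_select, hx]
  constructor
  · rintro ⟨q, hq, hc, h⟩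
    obtain ⟨h1, rfl⟩ := (hρ.mem_iff t q hq).1 h
    exact ⟨h1, hc⟩
  · rintro ⟨h1, hc⟩
    exact ⟨_, hρ.lt_length t h1, hc, (hρ.mem_iff t _ (hρ.lt_length t h1)).2 ⟨h1, rfl⟩⟩

theorem IsTrace.abs_head_le : ∀ c ≤ T, |(K.conf w ρ c).head| ≤ n := fun c hc =>
  (TM.abs_head_le c).trans (by have := hρ.le; omega)

variable {c : ℕ} (hc : c ≤ T) {τ : Option ℕ} (hτ : Denotes e s c τ)
include hE hc hτ

/-- Letter i of the word is attached to element i, whereas as a head position element i names the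
cell i + 1. The formula therefore passes to the successor for positive cells and treats cell 0
separately; negative cells are initially blank. -/
theorem IsTrace.sat_initLetter {U : UnarySym} {b : Bool} (hU : ∀ i,
      M.HasLetter S (M.interp U) (e i) ↔ w[(i : ℕ)]? = some b) (hk : ∀ v ∈ τ, v ≠ 25 ∧ v ≠ 26) :
    Sat M (initLetter σ U τ) s S ↔ 0 ≤ (K.conf w ρ c).head ∧
      w[(K.conf w ρ c).head.toNat]? = some b := by
  set hd : ℕ → ℤ := fun c => (K.conf w ρ c).head with hhd
  have h0 : hd 0 = 0 := rfl
  have hi : ∀ i, Function.update s 25 (e i) 25 = e i := fun i => Function.update_self ..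
  have h25' : ∀ i j, Function.update (Function.update s 25 (e i)) 26 (e j) 25 = e i := fun i j => by
    rw [Function.update_of_ne (by omega), hi]
  have hj : ∀ i j, Function.update (Function.update s 25 (e i)) 26 (e j) 26 = e j := fun i j =>
    Function.update_self ..
  have hτ' : ∀ i j, Denotes e (Function.update (Function.update s 25 (e i)) 26 (e j)) c τ :=
    fun i j => (hτ.update fun v hv => (hk v hv).1).update fun v hv => (hk v hv).2
  rw [initLetter, sat_or, sat_and, hE.sat_exDom, hE.sat_exDom, sat_headZero h0 hρ.headAt hc hτ]
  simp only [hE.sat_exDom, sat_and]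
  simp only [sat_headSide (b := true) h0 hρ.headAt hc (hτ' _ _) (h25' _ _), hE.sat_first (hi _),
    hE.sat_succ (h25' _ _) (hj _ _), sat_hasLetter, hi, hj, hU]
  change _ ↔ 0 ≤ hd c ∧ w[(hd c).toNat]? = some b
  constructor
  · rintro (⟨h1, i, h2, h3⟩ | ⟨i, j, h1, h2, h3⟩)
    · rw [h1]
      rw [h2] at h3
      exact ⟨le_rfl, h3⟩
    · simp only [sideSign] at h1
      refine ⟨by omega, ?_⟩
      rw [show (hd c).toNat = (j : ℕ) by omega]
      exact h3
  · rintro ⟨h1, h2⟩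
    obtain ⟨hlt, -⟩ := List.getElem?_eq_some_iff.1 h2
    have hle := hE.length_le
    by_cases h3 : hd c = 0
    · refine Or.inl ⟨h3, ⟨0, by omega⟩, rfl, ?_⟩
      rw [h3] at h2
      exact h2
    · refine Or.inr ⟨⟨(hd c).toNat - 1, by omega⟩, ⟨(hd c).toNat, by omega⟩, ?_, ?_, h2⟩
      · simp only [sideSign]
        omega
      · simp only
        omega

theorem IsTrace.sat_initSymbol (hk : ∀ v ∈ τ, v ≠ 25 ∧ v ≠ 26) (a : ℕ) :
    Sat M (initSymbol σ a τ) s S ↔ (K.init w).tape (K.conf w ρ c).head = a := by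
  have h1 := hρ.sat_initLetter hE hc hτ (U := .C0) hE.letter_zero hk
  have h2 := hρ.sat_initLetter hE hc hτ (U := .C1) hE.letter_one hk
  rw [← TM.init_tape_one_iff (K := K)] at h1
  rw [← TM.init_tape_two_iff (K := K)] at h2
  have h3 := TM.init_tape_le (K := K) (w := w) (K.conf w ρ c).head
  rw [initSymbol]
  split_ifs with ha ha ha
  · rw [sat_and, sat_not, sat_not, h1, h2]
    omega
  · rw [h1, ha]
  · rw [h2, ha]
  · simp only [sat_falsum, false_iff]
    omega

omit hρ hc in
theorem sat_isEarlier {x : ℕ} {t : Fin n} (hx : s x = e t) :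
    Sat M (isEarlier x τ) s S ↔ (t : ℕ) < c := by
  rcases τ with _ | v
  · obtain rfl : c = 0 := hτ
    simp [isEarlier]
  · obtain ⟨t', h1, rfl⟩ := hτ
    rw [isEarlier, hE.sat_le hx h1]
    omega

theorem IsTrace.sat_sameCell {x : ℕ} (h24 : x ≠ 24) {t : Fin n} (hx : s x = e t)
    (ht : (t : ℕ) ≤ T) (hk : ∀ v ∈ τ, v ≠ 24 ∧ v ≠ 25) :
    Sat M (sameCell σ x τ) s S ↔ (K.conf w ρ t).head = (K.conf w ρ c).head := by
  refine hE.sat_before h24.symm hx fun s' τ' hs hk' hd => ?_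
  have hτ' : Denotes e s' c τ := by
    rcases τ with _ | v
    · exact hτ
    · obtain ⟨t', h1, h2⟩ := hτ
      exact ⟨t', by rw [hs v (hk v rfl).1, h1], h2⟩
  exact sat_sameHead (hd := fun c => (K.conf w ρ c).head) rfl hρ.headAt ht hd hE hρ.abs_head_le hc
    hτ' (fun v hv => by rw [hk' v hv]; omega) fun v hv => (hk v hv).2

/-- This is `TM.tape_conf_eq_iff` read inside the domain. The formula binds variables from `22` on,
so the variable in `τ` has to be below `22` to avoid capture. -/
theorem IsTrace.sat_symbolIs (hk : ∀ v ∈ τ, v < 22) (a : ℕ) :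
    Sat M (symbolIs K σ a τ) s S ↔ (K.conf w ρ c).tape (K.conf w ρ c).head = a := by
  have h22 : ∀ i, Function.update s 22 (e i) 22 = e i := fun i => Function.update_self ..
  have h22' : ∀ i j, Function.update (Function.update s 22 (e i)) 23 (e j) 22 = e i := fun i j => by
    rw [Function.update_of_ne (by omega), h22]
  have h23' : ∀ i j, Function.update (Function.update s 22 (e i)) 23 (e j) 23 = e j := fun i j =>
    Function.update_self ..
  have hτ1 : ∀ i, Denotes e (Function.update s 22 (e i)) c τ :=
    fun i => hτ.update fun v hv => by have := hk v hv; omega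
  have hτ2 : ∀ i j, Denotes e (Function.update (Function.update s 22 (e i)) 23 (e j)) c τ :=
    fun i j => (hτ1 i).update fun v hv => by have := hk v hv; omega
  have hk' : ∀ v ∈ τ, v ≠ 24 ∧ v ≠ 25 := fun v hv => by have := hk v hv; omega
  have hn := hρ.le
  rw [TM.tape_conf_eq_iff, symbolIs, sat_or, hE.sat_exDom, sat_and,
    hρ.sat_initSymbol hE hc hτ (fun v hv => by have := hk v hv; omega), hE.sat_allDom]
  simp only [sat_and, sat_imp, sat_not, hE.sat_allDom]
  simp only [sat_isEarlier hE (hτ1 _) (h22 _), sat_isEarlier hE (hτ2 _ _) (h23' _ _),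
    hE.sat_lt (h22' _ _) (h23' _ _), hρ.sat_select (h22 _)]
  refine or_congr ?_ (and_congr_left fun _ => ?_)
  · constructor
    · rintro ⟨i, h1, h2, h3, h4⟩
      rw [hρ.sat_sameCell hE hc (hτ1 i) (by omega) (h22 i) (by omega) hk'] at h2
      refine ⟨i, h1, h2, fun v h5 h6 => ?_, h4.2⟩
      have h7 := h3 ⟨v, by omega⟩ h6 h5
      rwa [hρ.sat_sameCell hE hc (hτ2 i _) (by omega) (h23' i _) (by simp; omega) hk'] at h7
    · rintro ⟨v, h1, h2, h3, h4⟩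
      refine ⟨⟨v, by omega⟩, h1, ?_, fun j h5 h6 => ?_, by simp; omega, h4⟩
      · rwa [hρ.sat_sameCell hE hc (hτ1 _) (by omega) (h22 _) (by simp; omega) hk']
      · rw [hρ.sat_sameCell hE hc (hτ2 _ j) (by omega) (h23' _ j) (by omega) hk']
        exact h3 j h6 h5
  · constructor
    · intro h v hv
      have h7 := h ⟨v, by omega⟩ hv
      rwa [hρ.sat_sameCell hE hc (hτ1 _) (by omega) (h22 _) (by simp; omega) hk'] at h7
    · intro h i hi
      rw [hρ.sat_sameCell hE hc (hτ1 _) (by omega) (h22 _) (by omega) hk']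
      exact h i hi

omit hE in
theorem IsTrace.sat_stateIs (a : ℕ) :
    Sat M (stateIs K σ a τ) s S ↔ (K.conf w ρ c).state = a := by
  rcases τ with _ | v
  · obtain rfl : c = 0 := hτ
    have : (K.conf w ρ 0).state = K.start := rfl
    rw [this, stateIs]
    split_ifs with h <;> simp [h]
  · obtain ⟨t, h1, rfl⟩ := hτ
    rw [stateIs, hρ.sat_select h1]
    exact ⟨fun h => h.2, fun h => ⟨by omega, h⟩⟩

theorem IsTrace.sat_applicable (hk : ∀ v ∈ τ, v < 22) (q : ℕ) :
    Sat M (applicable K σ q τ) s S ↔ (K.conf w ρ c).state = (K.ins q).1 ∧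
      (K.conf w ρ c).tape (K.conf w ρ c).head = (K.ins q).2.1 := by
  rw [applicable, sat_and, hρ.sat_stateIs hc hτ, hρ.sat_symbolIs hE hc hτ hk]

omit hc hτ in
theorem IsTrace.sat_isLegal : Sat M (isLegal K σ) s S ↔ K.IsLegal w ρ T := by
  have h20 : ∀ i, Function.update s 20 (e i) 20 = e i := fun i => Function.update_self ..
  have hb : ∀ (q : ℕ) (t : Fin n), (t : ℕ) < T →
      (Sat M (before 21 20 (applicable K σ q)) (Function.update s 20 (e t)) S ↔
        (K.conf w ρ t).state = (K.ins q).1 ∧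
          (K.conf w ρ t).tape (K.conf w ρ t).head = (K.ins q).2.1) := fun q t ht =>
    hE.sat_before (by omega) (h20 t) fun s' τ _ hk hd =>
      hρ.sat_applicable hE ht.le hd (fun v hv => by rw [hk v hv]; omega) q
  rw [isLegal, hE.sat_allDom]
  simp only [sat_bigAnd, sat_imp, sat_mem, h20]
  constructor
  · intro h t ht
    have hq := hρ.lt_length t ht
    exact ⟨hq, (hb _ ⟨t, by have := hρ.le; omega⟩ ht).1
      (h _ _ hq ((hρ.mem_iff _ _ hq).2 ⟨ht, rfl⟩))⟩
  · intro h t q hq hm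
    obtain ⟨ht, rfl⟩ := (hρ.mem_iff _ _ hq).1 hm
    exact (hb _ t ht).2 (h t ht).2

end Trace

end ColStructure

/-! ### Formulas about ends and prolongations of computations -/

namespace MSO

/-- `F` holds of the last configuration. -/
def atEnd (K : TM) (σ : ℕ) (F : Option ℕ → MSO) : MSO :=
  or (and (allDom 20 (not (isStep K σ 20))) (F none))
    (exDom 20 (and (isStep K σ 20)
      (and (allDom 21 (imp (lt 20 21) (not (isStep K σ 21)))) (F (some 20)))))

def isHalted (K : TM) (σ : ℕ) (τ : Option ℕ) : MSO :=
  bigAnd K.instr.length fun q => not (applicable K σ q τ)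

/-- The state belongs to the list `l`. -/
def stateIn (K : TM) (l : List ℕ) (σ : ℕ) : Option ℕ → MSO
  | none => if K.start ∈ l then not falsum else falsum
  | some v => select K σ (fun q => (K.ins q).2.2.1 ∈ l) v

/-- All elements of the domain are used as steps. -/
def isFull (K : TM) (σ : ℕ) : MSO := allDom 20 (isStep K σ 20)

/-- The slot `σ'` prolongs the computation in the slot `σ`. -/
def prolongs (K : TM) (σ σ' : ℕ) : MSO :=
  bigAnd K.instr.length fun q => allDom 20 (imp (mem 20 (24 + 2 * q + σ)) (mem 20 (24 + 2 * q + σ')))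

/-- `F` holds of all configurations before the steps that are added in the slot `σ'`. -/
def between (K : TM) (σ σ' : ℕ) (F : Option ℕ → MSO) : MSO :=
  allDom 20 (imp (isStep K σ' 20) (imp (not (isStep K σ 20)) (before 21 20 F)))

/-- The number of the `k`-th set of a slot. -/
def slot (σ k : ℕ) : ℕ := 10 + 2 * k + σ

end MSO

/-! ### Decoding sets into instruction sequences and encoding them back -/

namespace ColStructure

open MSO

variable {A : Type u} {M : ColStructure A} {s : ℕ → A} {S S' : ℕ → Set A} {w : List Bool} {n : ℕ}
  {e : Fin n → A} {σ σ' : ℕ} {K : TM} {ρ ρ' : ℕ → ℕ} {T T' : ℕ}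

/-- The steps in use form an initial segment, whose length is `T`, and each carries an instruction,
which defines `ρ`. The stored head positions are then forced one after the other by the head
formulas. -/
theorem exists_isTrace_of_sat (hE : M.IsEnum S w e) (h : Sat M (MSO.isTrace K σ) s S) :
    ∃ ρ T, M.IsTrace K w S e σ ρ T := by
  have h20 : ∀ i, Function.update s 20 (e i) 20 = e i := fun i => Function.update_self ..
  have h20' : ∀ i j, Function.update (Function.update s 20 (e i)) 21 (e j) 20 = e i := fun i j => by
    rw [Function.update_of_ne (by omega), h20]
  have h21' : ∀ i j, Function.update (Function.update s 20 (e i)) 21 (e j) 21 = e j := fun i j =>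
    Function.update_self ..
  rw [MSO.isTrace, sat_and, sat_and, hE.sat_allDom, hE.sat_allDom, hE.sat_allDom] at h
  simp only [sat_bigAnd, sat_imp, sat_not, sat_mem, hE.sat_allDom, isStep, sat_and,
    hE.sat_lt (h21' _ _) (h20' _ _)] at h
  simp only [sat_select, h20, h21'] at h
  obtain ⟨h1, h2, h3⟩ := h
  let dom : Fin n → Prop := fun t => ∃ q < K.instr.length, e t ∈ S (24 + 2 * q + σ)
  have hdom : ∀ t u : Fin n, dom t → (u : ℕ) < t → dom u := fun t u ⟨q, hq, hm⟩ hu => by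
    obtain ⟨q', hq', -, hm'⟩ := h2 t ⟨q, hq, trivial, hm⟩ u hu
    exact ⟨q', hq', hm'⟩
  classical
  -- The value `n` qualifies vacuously; it is the length if all elements of the domain are used as
  -- steps.
  have hex : ∃ T : ℕ, ∀ h : T < n, ¬ dom ⟨T, h⟩ := ⟨n, fun h => absurd h (lt_irrefl _)⟩
  have hT : ∀ t : Fin n, dom t ↔ (t : ℕ) < Nat.find hex := by
    intro t
    constructor
    · intro ht
      by_contra hlt
      rcases Nat.lt_or_ge (Nat.find hex) t with h' | h'
      · exact Nat.find_spec hex (by omega) (hdom t _ ht h')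
      · have h4 : Nat.find hex = t := by omega
        refine Nat.find_spec hex (by omega) ?_
        simp only [h4]
        exact ht
    · intro ht
      have := Nat.find_min hex ht
      push Not at this
      exact this.choose_spec
  have hTn : Nat.find hex ≤ n := Nat.find_min' hex fun h => absurd h (lt_irrefl _)
  generalize Nat.find hex = T at hT hTn
  have hq : ∀ t : ℕ, ∃ q, ∀ h : t < n, t < T →
      q < K.instr.length ∧ e ⟨t, h⟩ ∈ S (24 + 2 * q + σ) := by
    intro t
    by_cases ht : t < T
    · obtain ⟨q, hq⟩ := (hT ⟨t, by omega⟩).2 ht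
      exact ⟨q, fun _ _ => hq⟩
    · exact ⟨0, fun _ h => absurd h ht⟩
  choose ρ hρ using hq
  have hlen : ∀ t < T, ρ t < K.instr.length := fun t ht => (hρ t (by omega) ht).1
  refine ⟨ρ, T, hTn, hlen, fun t q hq => ⟨fun hm => ?_, ?_⟩, ?_⟩
  · have ht := (hT t).1 ⟨q, hq, hm⟩
    refine ⟨ht, ?_⟩
    by_contra hne
    exact h1 t q hq hm ⟨ρ t, hlen t ht, hne, (hρ t t.2 ht).2⟩
  · rintro ⟨ht, rfl⟩
    exact (hρ t t.2 ht).2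
  · intro t
    obtain ⟨t, htn⟩ := t
    induction t using Nat.strong_induction_on with
    | _ t ih =>
      intro ht
      have key := sat_headUpdate (σ := σ) (hd := fun t => (K.conf w ρ t).head) hE rfl
        (t := ⟨t, htn⟩) (fun t' ht' => ih t' ht' t'.2 (lt_trans (b := t) ht' ht)) (h20 _)
        (TM.abs_head_le t) (K.ins (ρ t)).2.2.2.2
      refine key.1 ?_
      obtain ⟨ha, hb, hc⟩ := h3 ⟨t, htn⟩
      obtain ⟨hq, hm⟩ := hρ t htn ht
      rcases hmv : (K.ins (ρ t)).2.2.2.2 with _ | _ | _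
      · exact ha ⟨_, hq, hmv, hm⟩
      · exact hc ⟨_, hq, hmv, hm⟩
      · exact hb ⟨_, hq, hmv, hm⟩

theorem IsTrace.sat_isStep (hρ : M.IsTrace K w S e σ ρ T) {x : ℕ} {t : Fin n} (hx : s x = e t) :
    Sat M (isStep K σ x) s S ↔ (t : ℕ) < T := by
  rw [isStep, hρ.sat_select hx, and_true]

theorem IsTrace.sat_isTrace (hE : M.IsEnum S w e) (hρ : M.IsTrace K w S e σ ρ T) :
    Sat M (MSO.isTrace K σ) s S := by
  have h20 : ∀ i, Function.update s 20 (e i) 20 = e i := fun i => Function.update_self ..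
  have h20' : ∀ i j, Function.update (Function.update s 20 (e i)) 21 (e j) 20 = e i := fun i j => by
    rw [Function.update_of_ne (by omega), h20]
  have h21' : ∀ i j, Function.update (Function.update s 20 (e i)) 21 (e j) 21 = e j := fun i j =>
    Function.update_self ..
  rw [MSO.isTrace, sat_and, sat_and, hE.sat_allDom, hE.sat_allDom, hE.sat_allDom]
  simp only [sat_bigAnd, sat_imp, sat_not, sat_mem, hE.sat_allDom, sat_and,
    hE.sat_lt (h21' _ _) (h20' _ _), hρ.sat_select (h20 _), hρ.sat_isStep (h20 _),
    hρ.sat_isStep (h21' _ _), h20]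
  refine ⟨fun t q hq hm h => h.2 ((hρ.mem_iff t q hq).1 hm).2, fun t ht u hu => by omega,
    fun t => ?_⟩
  have key : (t : ℕ) < T → ∀ m, (K.ins (ρ t)).2.2.2.2 = m →
      Sat M (headUpdate σ m) (Function.update s 20 (e t)) S := by
    rintro ht _ rfl
    exact (sat_headUpdate (hd := fun t => (K.conf w ρ t).head) hE rfl
      (fun t' ht' => hρ.headAt t' (by omega)) (h20 t) (TM.abs_head_le t) _).2 (hρ.headAt t ht)
  exact ⟨fun h => key h.1 _ h.2, fun h => key h.1 _ h.2, fun h => key h.1 _ h.2⟩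

/-- Every sequence of instructions that fits into the domain is encoded by some sets. -/
theorem exists_isTrace (hE : M.IsEnum S w e) (hC : M.CodesAll S e) (hσ : σ < 2) (hT : T ≤ n)
    (hρ : ∀ t < T, ρ t < K.instr.length) :
    ∃ S', (∀ X, (∀ k < 7 + K.instr.length, X ≠ slot σ k) → S' X = S X) ∧
      M.IsTrace K w S' e σ ρ T := by
  classical
  obtain ⟨P₀, P₁, P₂, hP⟩ := hC (12 + σ) fun t i =>
    (K.conf w ρ (t + 1)).head = sideSign true * ((i : ℕ) + 1)
  obtain ⟨N₀, N₁, N₂, hN⟩ := hC (18 + σ) fun t i =>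
    (K.conf w ρ (t + 1)).head = sideSign false * ((i : ℕ) + 1)
  let S' : ℕ → Set A := fun X =>
    if X = 10 + σ then {z | ∃ t : Fin n, e t = z ∧ (K.conf w ρ (t + 1)).head = 0} else
    if X = 12 + σ then P₀ else if X = 14 + σ then P₁ else if X = 16 + σ then P₂ else
    if X = 18 + σ then N₀ else if X = 20 + σ then N₁ else if X = 22 + σ then N₂ else
    if ∃ q < K.instr.length, X = 24 + 2 * q + σ then
      {z | ∃ t : Fin n, e t = z ∧ (t : ℕ) < T ∧ X = 24 + 2 * ρ t + σ} else S X
  have hS : ∀ X, (∀ k < 7 + K.instr.length, X ≠ slot σ k) → S' X = S X := by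
    intro X hX
    have hX' : ∀ k < 7, X ≠ 10 + 2 * k + σ := fun k hk => hX k (by omega)
    have h7 : ¬ ∃ q < K.instr.length, X = 24 + 2 * q + σ := by
      rintro ⟨q, hq, rfl⟩
      exact hX (7 + q) (by omega) (by simp only [slot]; ring)
    have h0 := hX' 0 (by omega)
    have h1 := hX' 1 (by omega)
    have h2 := hX' 2 (by omega)
    have h3 := hX' 3 (by omega)
    have h4 := hX' 4 (by omega)
    have h5 := hX' 5 (by omega)
    have h6 := hX' 6 (by omega)
    simp only [Nat.reduceMul, Nat.reduceAdd] at h0 h1 h2 h3 h4 h5 h6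
    simp only [S', h0, h1, h2, h3, h4, h5, h6, h7, if_false]
  have hS3 : ∀ X < 3, S' X = S X := fun X hX => hS X fun k _ => by simp only [slot]; omega
  have h14 : S' (14 + σ) = P₁ := by simp [S']
  have h16 : S' (16 + σ) = P₂ := by simp [S']
  have h20 : S' (20 + σ) = N₁ := by simp [S']
  have h22 : S' (22 + σ) = N₂ := by simp [S']
  refine ⟨S', hS, hT, hρ, fun t q hq => ?_, fun t ht => ⟨?_, ?_⟩⟩
  · have : S' (24 + 2 * q + σ) =
        {z | ∃ t : Fin n, e t = z ∧ (t : ℕ) < T ∧ 24 + 2 * q + σ = 24 + 2 * ρ t + σ} := by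
      simp only [S']
      rw [if_neg (by omega), if_neg (by omega), if_neg (by omega), if_neg (by omega),
        if_neg (by omega), if_neg (by omega), if_neg (by omega), if_pos ⟨q, hq, rfl⟩]
    rw [this]
    constructor
    · rintro ⟨t', h1, h2, h3⟩
      obtain rfl := hE.injective h1
      exact ⟨h2, by omega⟩
    · rintro ⟨h1, h2⟩
      exact ⟨t, rfl, h1, by omega⟩
  · have : S' (10 + σ) = {z | ∃ t : Fin n, e t = z ∧ (K.conf w ρ (t + 1)).head = 0} := by
      simp [S']
    rw [this]
    constructor
    · rintro ⟨t', h1, h2⟩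
      rwa [hE.injective h1] at h2
    · exact fun h => ⟨t, rfl, h⟩
  · rintro (_ | _) i
    · exact hN S' hS3 (by simp [S']) ((congrArg S' (by omega)).trans h20)
        ((congrArg S' (by omega)).trans h22) t i
    · exact hP S' hS3 (by simp [S']) ((congrArg S' (by omega)).trans h14)
        ((congrArg S' (by omega)).trans h16) t i

/-- A trace involves only the frame and set variables with the parity of its slot, so one slot can
be overwritten without damage to the other. -/
theorem IsTrace.congr (hS : ∀ X, X < 10 ∨ X % 2 = σ % 2 → S' X = S X)
    (hρ : M.IsTrace K w S e σ ρ T) : M.IsTrace K w S' e σ ρ T := by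
  have hc : M.LayerConn S' = M.LayerConn S := LayerConn.congr fun X hX => hS X (by omega)
  have hr : ∀ b, M.CodedRel S' (sideBase b + σ) = M.CodedRel S (sideBase b + σ) := by
    intro b
    have : sideBase b % 2 = 0 := by cases b <;> rfl
    funext x y
    simp only [CodedRel, hc, hS 1 (by omega), hS (sideBase b + σ) (by omega),
      hS (sideBase b + σ + 2) (by omega), hS (sideBase b + σ + 4) (by omega)]
  refine ⟨hρ.le, hρ.lt_length, fun t q hq => ?_, fun t ht => ?_⟩
  · rw [hS _ (by omega)]
    exact hρ.mem_iff t q hq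
  · have := hρ.headAt t ht
    simpa only [HeadAt, hr, hS (10 + σ) (by omega)] using this

section Trace

variable (hE : M.IsEnum S w e) (hρ : M.IsTrace K w S e σ ρ T) (hρ' : M.IsTrace K w S e σ' ρ' T')
include hE hρ

theorem IsTrace.sat_atEnd {F : Option ℕ → MSO} {p : Prop}
    (hF : ∀ s' τ, (∀ v ∈ τ, v = 20) → Denotes e s' T τ → (Sat M (F τ) s' S ↔ p)) :
    Sat M (atEnd K σ F) s S ↔ p := by
  have h20 : ∀ i, Function.update s 20 (e i) 20 = e i := fun i => Function.update_self ..
  have h20' : ∀ i j, Function.update (Function.update s 20 (e i)) 21 (e j) 20 = e i := fun i j => by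
    rw [Function.update_of_ne (by omega), h20]
  have h21' : ∀ i j, Function.update (Function.update s 20 (e i)) 21 (e j) 21 = e j := fun i j =>
    Function.update_self ..
  have hn := hρ.le
  rw [atEnd, sat_or, sat_and, hE.sat_allDom, hE.sat_exDom]
  simp only [sat_and, sat_not, hE.sat_allDom, sat_imp, hρ.sat_isStep (h20 _),
    hρ.sat_isStep (h21' _ _), hE.sat_lt (h20' _ _) (h21' _ _)]
  by_cases hT : T = 0
  · rw [hF s none (by simp) hT]
    constructor
    · rintro (⟨-, h⟩ | ⟨i, hi, -⟩)
      · exact h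
      · omega
    · exact fun h => Or.inl ⟨fun i => by omega, h⟩
  · constructor
    · rintro (⟨h, -⟩ | ⟨i, hi, hj, h⟩)
      · exact absurd (h ⟨0, by omega⟩) (by simp; omega)
      · refine (hF (Function.update s 20 (e i)) (some 20) (by simp) ⟨i, h20 i, ?_⟩).1 h
        by_contra hne
        exact hj ⟨i + 1, by omega⟩ (by simp) (by simp; omega)
    · intro h
      refine Or.inr ⟨⟨T - 1, by omega⟩, by simp; omega, fun j hj => by simp at hj; omega, ?_⟩
      exact (hF (Function.update s 20 _) (some 20) (by simp) ⟨_, h20 _, by simp; omega⟩).2 h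

theorem IsTrace.sat_isHalted {c : ℕ} (hc : c ≤ T) {τ : Option ℕ} (hτ : Denotes e s c τ)
    (hk : ∀ v ∈ τ, v < 22) :
    Sat M (isHalted K σ τ) s S ↔ K.Halted (K.conf w ρ c) := by
  rw [isHalted, sat_bigAnd, TM.halted_iff]
  simp only [sat_not, hρ.sat_applicable hE hc hτ hk]

omit hE in
theorem IsTrace.sat_stateIn (l : List ℕ) {c : ℕ} (hc : c ≤ T) {τ : Option ℕ}
    (hτ : Denotes e s c τ) :
    Sat M (stateIn K l σ τ) s S ↔ (K.conf w ρ c).state ∈ l := by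
  rcases τ with _ | v
  · obtain rfl : c = 0 := hτ
    have : (K.conf w ρ 0).state = K.start := rfl
    rw [this, stateIn]
    split_ifs with h <;> simp [h]
  · obtain ⟨t, h1, rfl⟩ := hτ
    rw [stateIn, hρ.sat_select h1]
    exact ⟨fun h => h.2, fun h => ⟨by omega, h⟩⟩

theorem IsTrace.sat_isFull : Sat M (isFull K σ) s S ↔ n ≤ T := by
  have h20 : ∀ i, Function.update s 20 (e i) 20 = e i := fun i => Function.update_self ..
  rw [isFull, hE.sat_allDom]
  simp only [hρ.sat_isStep (h20 _)]
  constructor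
  · intro h
    by_contra hlt
    exact absurd (h ⟨T, by omega⟩) (by simp)
  · exact fun h i => by omega

include hρ'

theorem IsTrace.sat_prolongs : Sat M (prolongs K σ σ') s S ↔ T ≤ T' ∧ ∀ t < T, ρ t = ρ' t := by
  have h20 : ∀ i, Function.update s 20 (e i) 20 = e i := fun i => Function.update_self ..
  have hn := hρ.le
  rw [prolongs, sat_bigAnd]
  simp only [hE.sat_allDom, sat_imp, sat_mem, h20]
  constructor
  · intro h
    have key : ∀ t < T, t < T' ∧ ρ' t = ρ t := fun t ht =>
      (hρ'.mem_iff ⟨t, by omega⟩ _ (hρ.lt_length t ht)).1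
        (h _ (hρ.lt_length t ht) _ ((hρ.mem_iff ⟨t, by omega⟩ _ (hρ.lt_length t ht)).2 ⟨ht, rfl⟩))
    refine ⟨?_, fun t ht => (key t ht).2.symm⟩
    by_contra hlt
    have := (key T' (by omega)).1
    omega
  · rintro ⟨h1, h2⟩ q hq t hm
    obtain ⟨h3, rfl⟩ := (hρ.mem_iff t q hq).1 hm
    exact (hρ'.mem_iff t _ hq).2 ⟨by omega, (h2 t h3).symm⟩

theorem IsTrace.sat_between {F : Option ℕ → MSO} {p : Cfg → Prop}
    (hF : ∀ s' τ, ∀ c ≤ T', (∀ v ∈ τ, v < 22) → Denotes e s' c τ →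
      (Sat M (F τ) s' S ↔ p (K.conf w ρ' c))) :
    Sat M (between K σ σ' F) s S ↔ ∀ t, T ≤ t → t < T' → p (K.conf w ρ' t) := by
  have h20 : ∀ i, Function.update s 20 (e i) 20 = e i := fun i => Function.update_self ..
  have hn := hρ'.le
  have hb : ∀ t : Fin n, (t : ℕ) < T' → (Sat M (before 21 20 F) (Function.update s 20 (e t)) S ↔
      p (K.conf w ρ' t)) := fun t ht =>
    hE.sat_before (by omega) (h20 t) fun s' τ _ hk hd =>
      hF _ _ _ (by omega) (fun v hv => by rw [hk v hv]; omega) hd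
  rw [between, hE.sat_allDom]
  simp only [sat_imp, sat_not, hρ.sat_isStep (h20 _), hρ'.sat_isStep (h20 _)]
  constructor
  · intro h t h1 h2
    exact (hb ⟨t, by omega⟩ h2).1 (h ⟨t, by omega⟩ h2 (by simp; omega))
  · intro h t h1 h2
    exact (hb t h1).2 (h t (by omega) h1)

end Trace

end ColStructure

/-! ### The game on computations -/

namespace ATM

variable (N : ATM) (w : List Bool) (n : ℕ)

def IsAcceptingEnd (c : Cfg) : Prop := N.machine.Halted c ∧ c.state ∈ N.machine.accept

/-- The computation `ρ'` of length `T' ≤ n` prolongs the computation `ρ` of length `T`; the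
configurations from which the new steps are made satisfy `p`. -/
structure Prolongs (p : Cfg → Prop) (ρ : ℕ → ℕ) (T : ℕ) (ρ' : ℕ → ℕ) (T' : ℕ) : Prop where
  le : T' ≤ n
  legal : N.machine.IsLegal w ρ' T'
  le_right : T ≤ T'
  agree : ∀ t < T, ρ t = ρ' t
  between : ∀ t, T ≤ t → t < T' → p (N.machine.conf w ρ' t)

/-- The existential player prolongs the computation up to an accepting end or a universal
configuration; thereafter each way in which the universal player prolongs it leads to an accepting
end, or it is unfinished without using up the available time, or it leads to an existential
configuration where `Ψ` holds. -/
def Round (Ψ : (ℕ → ℕ) → ℕ → Prop) (ρ : ℕ → ℕ) (T : ℕ) : Prop :=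
  ∃ ρ' T', N.Prolongs w n (fun c => c.state ∉ N.universal) ρ T ρ' T' ∧
    (N.IsAcceptingEnd (N.machine.conf w ρ' T') ∨
      (N.machine.conf w ρ' T').state ∈ N.universal ∧
      ∀ ρ'' T'', N.Prolongs w n (fun c => c.state ∈ N.universal) ρ' T' ρ'' T'' →
        N.IsAcceptingEnd (N.machine.conf w ρ'' T'') ∨
        (((N.machine.conf w ρ'' T'').state ∈ N.universal ∧
          ¬ N.machine.Halted (N.machine.conf w ρ'' T'')) ∧ ¬ n ≤ T'') ∨
        (N.machine.conf w ρ'' T'').state ∉ N.universal ∧ Ψ ρ'' T'')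

/-- When no round is left, the existential player has lost. -/
def Rounds (j : ℕ) : (ℕ → ℕ) → ℕ → Prop :=
  Nat.rec (fun _ _ => False) (fun _ Ψ => N.Round w n Ψ) j

variable {N w n} {Ψ : (ℕ → ℕ) → ℕ → Prop} {ρ ρ' : ℕ → ℕ} {T T' : ℕ}

theorem Prolongs.conf_eq {p : Cfg → Prop} (h : N.Prolongs w n p ρ T ρ' T') {t : ℕ} (ht : t ≤ T) :
    N.machine.conf w ρ t = N.machine.conf w ρ' t :=
  TM.conf_congr h.agree t ht

/-- Induction on the remaining time `n - T''`: an unfinished universal prolongation has time left,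
so it can be extended by every successor, and the extension is again among the prolongations
considered. Termination comes from `n` alone, whatever the running time of the machine. -/
theorem acceptsFrom_of_round
    (hΨ : ∀ ρ T, N.machine.IsLegal w ρ T → Ψ ρ T → N.AcceptsFrom (N.machine.conf w ρ T))
    (h : N.Round w n Ψ ρ T) : N.AcceptsFrom (N.machine.conf w ρ T) := by
  obtain ⟨ρ', T', hp, h⟩ := h
  have hend : N.AcceptsFrom (N.machine.conf w ρ' T') := by
    rcases h with h | ⟨-, h⟩
    · exact .halt _ h.1 h.2
    · have key : ∀ d ρ'' T'', n - T'' = d →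
          N.Prolongs w n (fun c => c.state ∈ N.universal) ρ' T' ρ'' T'' →
          N.AcceptsFrom (N.machine.conf w ρ'' T'') := by
        intro d
        induction d using Nat.strong_induction_on with
        | _ d ih =>
          rintro ρ'' T'' rfl hp'
          rcases h ρ'' T'' hp' with h | ⟨⟨hu, hh⟩, hn⟩ | ⟨-, h⟩
          · exact .halt _ h.1 h.2
          · refine .forall_succ _ hu hh fun c hc => ?_
            obtain ⟨ρ₃, h1, h2, rfl⟩ := hp'.legal.extend hc
            refine ih (n - (T'' + 1)) (by omega) ρ₃ (T'' + 1) rfl ⟨by omega, h2,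
              by have := hp'.le_right; omega, fun t ht => ?_, fun t ht ht' => ?_⟩
            · rw [hp'.agree t ht, h1 t (by have := hp'.le_right; omega)]
            · rw [← TM.conf_congr h1 t (by omega)]
              rcases Nat.lt_succ_iff_lt_or_eq.1 ht' with h' | rfl
              · exact hp'.between t ht h'
              · exact hu
          · exact hΨ _ _ hp'.legal h
      exact key _ ρ' T' rfl ⟨hp.le, hp.legal, le_rfl, fun _ _ => rfl, fun t h1 h2 => by omega⟩
  -- Acceptance is carried back from the end of the existential prolongation, one existential step
  -- at a time.
  have hback : ∀ d, d ≤ T' - T → N.AcceptsFrom (N.machine.conf w ρ' (T' - d)) := by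
    intro d
    induction d with
    | zero => exact fun _ => hend
    | succ d ih =>
      intro hd
      have h1 : T' - d = T' - (d + 1) + 1 := by omega
      have h2 := hp.legal.step (t := T' - (d + 1)) (by omega)
      rw [← h1] at h2
      exact .existential _ _ (hp.between _ (by omega) (by omega)) h2 (ih (by omega))
  have := hback (T' - T) le_rfl
  have hT := hp.le_right
  rwa [show T' - (T' - T) = T by omega, ← hp.conf_eq le_rfl] at this

theorem acceptsFrom_of_rounds {j : ℕ} (hl : N.machine.IsLegal w ρ T)
    (h : N.Rounds w n j ρ T) : N.AcceptsFrom (N.machine.conf w ρ T) := by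
  induction j generalizing ρ T with
  | zero => exact h.elim
  | succ j ih => exact acceptsFrom_of_round (fun ρ T hl h => ih hl h) h

theorem AcceptsFrom.of_step {c c' : Cfg} (h : N.AcceptsFrom c) (hu : c.state ∈ N.universal)
    (hs : N.machine.Step c c') : N.AcceptsFrom c' := by
  cases h with
  | halt _ hh => exact absurd hs (hh c')
  | existential _ _ he => exact absurd hu he
  | forall_succ _ _ _ ha => exact ha c' hs

theorem AcceptsFrom.of_prolongs (hp : N.Prolongs w n (fun c => c.state ∈ N.universal) ρ T ρ' T')
    (h : N.AcceptsFrom (N.machine.conf w ρ T)) : N.AcceptsFrom (N.machine.conf w ρ' T') := by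
  have key : ∀ t, T ≤ t → t ≤ T' → N.AcceptsFrom (N.machine.conf w ρ' t) := by
    intro t ht
    induction t, ht using Nat.le_induction with
    | base => exact fun _ => hp.conf_eq le_rfl ▸ h
    | succ t ht ih =>
      exact fun h' => (ih (by omega)).of_step (hp.between t ht (by omega)) (hp.legal.step (by omega))
  exact key T' hp.le_right le_rfl

theorem AcceptsFrom.mem_accept {c : Cfg} (h : N.AcceptsFrom c) (hh : N.machine.Halted c) :
    c.state ∈ N.machine.accept := by
  cases h with
  | halt _ _ ha => exact ha
  | existential _ c' _ hs => exact absurd hs (hh c')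
  | forall_succ _ _ hn => exact absurd hh hn

/-- Follow the accepting successors given by the derivation of acceptance until it reaches a halted
or a universal configuration; `hn` keeps the computation within the domain. -/
theorem AcceptsFrom.exists_prolongs (hn : ∀ ρ T, N.machine.IsLegal w ρ T → T ≤ n) {c : Cfg}
    (h : N.AcceptsFrom c) : ∀ ρ T, N.machine.IsLegal w ρ T → N.machine.conf w ρ T = c →
      ∃ ρ' T', N.Prolongs w n (fun c => c.state ∉ N.universal) ρ T ρ' T' ∧
        N.AcceptsFrom (N.machine.conf w ρ' T') ∧
        (N.IsAcceptingEnd (N.machine.conf w ρ' T') ∨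
          (N.machine.conf w ρ' T').state ∈ N.universal) := by
  have hrefl : ∀ ρ T, N.machine.IsLegal w ρ T →
      N.Prolongs w n (fun c => c.state ∉ N.universal) ρ T ρ T := fun ρ T hl =>
    ⟨hn ρ T hl, hl, le_rfl, fun _ _ => rfl, fun t h1 h2 => by omega⟩
  induction h with
  | halt c h1 h2 =>
    rintro ρ T hl rfl
    exact ⟨ρ, T, hrefl ρ T hl, .halt _ h1 h2, Or.inl ⟨h1, h2⟩⟩
  | existential c c' h1 h2 h3 ih =>
    rintro ρ T hl rfl
    obtain ⟨ρ₁, hag, hl₁, hc⟩ := hl.extend h2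
    obtain ⟨ρ', T', hp, h4, h5⟩ := ih ρ₁ (T + 1) hl₁ hc
    have hT := hp.le_right
    refine ⟨ρ', T', ⟨hp.le, hp.legal, by omega, fun t ht => ?_, fun t h6 h7 => ?_⟩, h4, h5⟩
    · rw [hag t ht, hp.agree t (by omega)]
    · rcases Nat.lt_or_eq_of_le h6 with h8 | rfl
      · exact hp.between t h8 h7
      · rw [← hp.conf_eq (by omega), ← TM.conf_congr hag T le_rfl]
        exact h1
  | forall_succ c h1 h2 h3 ih =>
    rintro ρ T hl rfl
    exact ⟨ρ, T, hrefl ρ T hl, .forall_succ _ h1 h2 h3, Or.inr h1⟩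

/-- The steps at which the computation switches between existential and universal states. -/
def switches (N : ATM) (w : List Bool) (ρ : ℕ → ℕ) (T : ℕ) : Finset ℕ :=
  (Finset.range T).filter fun t => ¬ ((N.machine.conf w ρ t).state ∈ N.universal ↔
    (N.machine.conf w ρ (t + 1)).state ∈ N.universal)

theorem Prolongs.switches_subset {p : Cfg → Prop} (h : N.Prolongs w n p ρ T ρ' T') :
    N.switches w ρ T ⊆ (N.switches w ρ' T').filter (· < T) := by
  intro t ht
  have hT := h.le_right
  simp only [switches, Finset.mem_filter, Finset.mem_range] at ht ⊢
  rw [← h.conf_eq (t := t) (by omega), ← h.conf_eq (t := t + 1) (by omega)]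
  exact ⟨⟨by omega, ht.2⟩, ht.1⟩

/-- Each round that is passed on adds a switch from universal to existential. Hence the sum of
switches so far and rounds left stays above m, and running out of rounds would contradict `hm`. -/
theorem rounds_of_acceptsFrom (hn : ∀ ρ T, N.machine.IsLegal w ρ T → T ≤ n) {m : ℕ}
    (hm : ∀ ρ T, N.machine.IsLegal w ρ T → (N.switches w ρ T).card ≤ m) {j : ℕ}
    (hl : N.machine.IsLegal w ρ T) (h : N.AcceptsFrom (N.machine.conf w ρ T))
    (hj : m < (N.switches w ρ T).card + j) : N.Rounds w n j ρ T := by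
  induction j generalizing ρ T with
  | zero => have := hm ρ T hl; omega
  | succ j ih =>
    obtain ⟨ρ', T', hp, hacc, hend⟩ := h.exists_prolongs hn ρ T hl rfl
    refine ⟨ρ', T', hp, hend.imp_right fun hu => ⟨hu, fun ρ'' T'' hp' => ?_⟩⟩
    have hacc' := hacc.of_prolongs hp'
    by_cases hu' : (N.machine.conf w ρ'' T'').state ∈ N.universal
    · by_cases hh : N.machine.Halted (N.machine.conf w ρ'' T'')
      · exact Or.inl ⟨hh, hacc'.mem_accept hh⟩
      -- If the time were used up, one more step would give a legal computation longer than `n`.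
      · refine Or.inr (Or.inl ⟨⟨hu', hh⟩, fun hle => ?_⟩)
        simp only [TM.Halted, not_forall, not_not] at hh
        obtain ⟨c, hc⟩ := hh
        obtain ⟨ρ₃, -, hl₃, -⟩ := hp'.legal.extend hc
        have := hn _ _ hl₃
        omega
    · refine Or.inr (Or.inr ⟨hu', ih hp'.legal hacc' ?_⟩)
      have hlt : T' < T'' := by
        rcases Nat.lt_or_eq_of_le hp'.le_right with h' | rfl
        · exact h'
        · exact absurd (hp'.conf_eq le_rfl ▸ hu) hu'
      have hT := hp.le_right
      have h1 : N.switches w ρ T ⊂ N.switches w ρ'' T'' := by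
        have h2 : N.switches w ρ T ⊆ N.switches w ρ'' T'' := fun t ht =>
          Finset.filter_subset _ _ (hp'.switches_subset
            (Finset.filter_subset _ _ (hp.switches_subset ht)))
        -- The last step leads from a universal to an existential state, and it comes after the
        -- first `T` steps because T ≤ T' < T''.
        refine (Finset.ssubset_iff_of_subset h2).2 ⟨T'' - 1, ?_, fun h3 => ?_⟩
        · have h4 := hp'.between (T'' - 1) (by omega) (by omega)
          rw [switches, Finset.mem_filter, Finset.mem_range, show T'' - 1 + 1 = T'' by omega]
          exact ⟨by omega, fun h5 => hu' (h5.1 h4)⟩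
        · have := (Finset.mem_filter.1 h3).1
          rw [Finset.mem_range] at this
          omega
      have := Finset.card_lt_card h1
      omega

end ATM

/-! ### The sentences -/

namespace MSO

/-- The slot `σ'` contains a computation that prolongs the one in the slot `σ`. -/
def extension (K : TM) (σ σ' : ℕ) (F : Option ℕ → MSO) : MSO :=
  and (isTrace K σ') (and (isLegal K σ') (and (prolongs K σ σ') (between K σ σ' F)))

def isUniversal (N : ATM) (σ : ℕ) : Option ℕ → MSO := stateIn N.machine N.universal σ

def acceptingEnd (N : ATM) (σ : ℕ) : MSO :=
  atEnd N.machine σ fun τ => and (isHalted N.machine σ τ) (stateIn N.machine N.machine.accept σ τ)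

/-- Slot `1` receives the existential prolongation of slot `0`, after which slot `0` is overwritten
with the universal one; so two slots serve any number of rounds. That `ψ` stands at the very end
makes the code a fixed prefix followed by the code of `ψ`. -/
def round (N : ATM) (ψ : MSO) : MSO :=
  exSets (7 + N.machine.instr.length) (slot 1) <|
    and (extension N.machine 0 1 fun τ => not (isUniversal N 1 τ)) <|
    or (acceptingEnd N 1) <|
    and (atEnd N.machine 1 (isUniversal N 1)) <|
    allSets (7 + N.machine.instr.length) (slot 0) <|
      imp (extension N.machine 1 0 (isUniversal N 0)) <|
      or (acceptingEnd N 0) <|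
      or (and (atEnd N.machine 0 fun τ => and (isUniversal N 0 τ) (not (isHalted N.machine 0 τ)))
        (not (isFull N.machine 0))) <|
      and (atEnd N.machine 0 fun τ => not (isUniversal N 0 τ)) ψ

def rounds (N : ATM) (j : ℕ) : MSO := Nat.rec falsum (fun _ ψ => round N ψ) j

/-- The sentence that is true in structures containing a pseudo-wall that encodes an accepted
word. -/
def acceptance (N : ATM) (m : ℕ) : MSO :=
  close <| exSets 10 id <| and isFrame <|
    exSets (7 + N.machine.instr.length) (slot 0) <|
      and (isTrace N.machine 0) (and (allDom 20 (not (isStep N.machine 0 20))) (rounds N (m + 1)))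

end MSO

/-! ### Meaning of the game formulas -/

namespace ColStructure

open MSO

variable {A : Type u} {M : ColStructure A} {s : ℕ → A} {S S₀ : ℕ → Set A} {w : List Bool} {n : ℕ}
  {e : Fin n → A} {σ σ' : ℕ} {K : TM} {N : ATM} {ρ ρ' : ℕ → ℕ} {T T' : ℕ}

theorem IsTrace.sat_extension (hE : M.IsEnum S w e) (hρ : M.IsTrace N.machine w S e σ ρ T)
    {F : Option ℕ → MSO} {p : Cfg → Prop}
    (hF : ∀ ρ' T', M.IsTrace N.machine w S e σ' ρ' T' → ∀ s' τ, ∀ c ≤ T', (∀ v ∈ τ, v < 22) →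
      Denotes e s' c τ → (Sat M (F τ) s' S ↔ p (N.machine.conf w ρ' c))) :
    Sat M (extension N.machine σ σ' F) s S ↔
      ∃ ρ' T', M.IsTrace N.machine w S e σ' ρ' T' ∧ N.Prolongs w n p ρ T ρ' T' := by
  rw [extension, sat_and, sat_and, sat_and]
  constructor
  · rintro ⟨h1, h2, h3, h4⟩
    obtain ⟨ρ', T', h⟩ := exists_isTrace_of_sat hE h1
    rw [h.sat_isLegal hE] at h2
    rw [hρ.sat_prolongs hE h] at h3
    rw [hρ.sat_between hE h (hF ρ' T' h)] at h4
    exact ⟨ρ', T', h, h.le, h2, h3.1, h3.2, h4⟩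
  · rintro ⟨ρ', T', h, hp⟩
    exact ⟨h.sat_isTrace hE, (h.sat_isLegal hE).2 hp.legal,
      (hρ.sat_prolongs hE h).2 ⟨hp.le_right, hp.agree⟩,
      (hρ.sat_between hE h (hF ρ' T' h)).2 hp.between⟩

theorem IsTrace.sat_isUniversal (hρ : M.IsTrace N.machine w S e σ ρ T) {c : ℕ} (hc : c ≤ T)
    {τ : Option ℕ} (hτ : Denotes e s c τ) :
    Sat M (isUniversal N σ τ) s S ↔ (N.machine.conf w ρ c).state ∈ N.universal :=
  hρ.sat_stateIn _ hc hτ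

theorem IsTrace.sat_acceptingEnd (hE : M.IsEnum S w e) (hρ : M.IsTrace N.machine w S e σ ρ T) :
    Sat M (acceptingEnd N σ) s S ↔ N.IsAcceptingEnd (N.machine.conf w ρ T) :=
  hρ.sat_atEnd hE fun s' τ hk hτ => by
    rw [sat_and, hρ.sat_isHalted hE le_rfl hτ fun v hv => by rw [hk v hv]; omega,
      hρ.sat_stateIn _ le_rfl hτ, ATM.IsAcceptingEnd]

/-- The formula `ψ` says that the computation in the slot `0` has the property `Ψ`. -/
def Expresses (M : ColStructure A) (K : TM) (w : List Bool) (S₀ : ℕ → Set A) (e : Fin n → A)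
    (ψ : MSO) (Ψ : (ℕ → ℕ) → ℕ → Prop) : Prop :=
  ∀ s S ρ T, (∀ X < 10, S X = S₀ X) → M.IsTrace K w S e 0 ρ T → (Sat M ψ s S ↔ Ψ ρ T)

section Extension

variable (hE : M.IsEnum S w e) (hσ : σ < 2) (hσ' : σ' < 2) (hne : σ ≠ σ')
  (hρ : M.IsTrace N.machine w S e σ ρ T) {F : Option ℕ → MSO} {p : Cfg → Prop}
  (hF : ∀ S' ρ' T', M.IsTrace N.machine w S' e σ' ρ' T' → M.IsEnum S' w e → ∀ s' τ, ∀ c ≤ T',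
    (∀ v ∈ τ, v < 22) → Denotes e s' c τ → (Sat M (F τ) s' S' ↔ p (N.machine.conf w ρ' c)))
  {S' : ℕ → Set A} (hS' : ∀ X, (∀ k < 7 + N.machine.instr.length, X ≠ slot σ' k) → S' X = S X)
include hσ hσ' hne hS'

theorem eq_of_eq_off_slot {X : ℕ} (hX : X < 10 ∨ X % 2 = σ % 2) : S' X = S X :=
  hS' X fun k _ => by simp only [slot]; omega

include hE hρ hF

theorem IsTrace.sat_extension_off_slot : Sat M (extension N.machine σ σ' F) s S' ↔
    ∃ ρ' T', M.IsTrace N.machine w S' e σ' ρ' T' ∧ N.Prolongs w n p ρ T ρ' T' := by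
  have hag := fun X => eq_of_eq_off_slot hσ hσ' hne hS' (X := X)
  have hE' := hE.congr fun X hX => hag X (Or.inl hX)
  exact (hρ.congr hag).sat_extension hE' fun ρ' T' h => hF S' ρ' T' h hE'

omit hS'
variable (hC : M.CodesAll S e) {χ : MSO} {P : (ℕ → ℕ) → ℕ → Prop}
  (hχ : ∀ S', (∀ X, X < 10 → S' X = S X) →
    ∀ ρ' T', M.IsTrace N.machine w S' e σ' ρ' T' → (Sat M χ s S' ↔ P ρ' T'))
include hC hχ

/-- Sets satisfying the formula decode to a prolongation, and every prolongation has length at most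
`n`, so it can be written into the slot. Quantifying over the slot thus amounts to quantifying over
prolongations. -/
theorem IsTrace.sat_exSets_extension :
    Sat M (exSets (7 + N.machine.instr.length) (slot σ')
      (MSO.and (extension N.machine σ σ' F) χ)) s S ↔
      ∃ ρ' T', N.Prolongs w n p ρ T ρ' T' ∧ P ρ' T' := by
  rw [sat_exSets]
  constructor
  · rintro ⟨S', hS', h⟩
    rw [sat_and, hρ.sat_extension_off_slot hE hσ hσ' hne hF hS'] at h
    obtain ⟨⟨ρ', T', h1, h2⟩, h3⟩ := h
    exact ⟨ρ', T', h2, (hχ S' (fun X hX => eq_of_eq_off_slot hσ hσ' hne hS' (Or.inl hX)) _ _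
      h1).1 h3⟩
  · rintro ⟨ρ', T', h2, h3⟩
    obtain ⟨S', hS', h1⟩ := exists_isTrace hE hC hσ' h2.le fun t ht => (h2.legal t ht).1
    refine ⟨S', hS', ?_⟩
    rw [sat_and, hρ.sat_extension_off_slot hE hσ hσ' hne hF hS']
    exact ⟨⟨ρ', T', h1, h2⟩, (hχ S' (fun X hX => eq_of_eq_off_slot hσ hσ' hne hS' (Or.inl hX)) _ _
      h1).2 h3⟩

theorem IsTrace.sat_allSets_extension :
    Sat M (allSets (7 + N.machine.instr.length) (slot σ')
      (MSO.imp (extension N.machine σ σ' F) χ)) s S ↔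
      ∀ ρ' T', N.Prolongs w n p ρ T ρ' T' → P ρ' T' := by
  rw [sat_allSets]
  constructor
  · intro h ρ' T' h2
    obtain ⟨S', hS', h1⟩ := exists_isTrace hE hC hσ' h2.le fun t ht => (h2.legal t ht).1
    have h' := h S' hS'
    rw [sat_imp, hρ.sat_extension_off_slot hE hσ hσ' hne hF hS'] at h'
    exact (hχ S' (fun X hX => eq_of_eq_off_slot hσ hσ' hne hS' (Or.inl hX)) _ _ h1).1
      (h' ⟨ρ', T', h1, h2⟩)
  · intro h S' hS'
    rw [sat_imp, hρ.sat_extension_off_slot hE hσ hσ' hne hF hS']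
    rintro ⟨ρ', T', h1, h2⟩
    exact (hχ S' (fun X hX => eq_of_eq_off_slot hσ hσ' hne hS' (Or.inl hX)) _ _ h1).2 (h ρ' T' h2)

end Extension

theorem expresses_round (hE₀ : M.IsEnum S₀ w e) (hC₀ : M.CodesAll S₀ e) {ψ : MSO}
    {Ψ : (ℕ → ℕ) → ℕ → Prop} (hψ : M.Expresses N.machine w S₀ e ψ Ψ) :
    M.Expresses N.machine w S₀ e (MSO.round N ψ) (N.Round w n Ψ) := by
  intro s S ρ T hS hρ
  have hE := hE₀.congr hS
  have hC := hC₀.congr fun X hX => hS X (by omega)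
  refine hρ.sat_exSets_extension hE (by omega) (by omega) (by omega)
    (p := fun c => c.state ∉ N.universal)
    (fun S' ρ' T' h _ s' τ c hc _ hτ => by rw [sat_not, h.sat_isUniversal hc hτ]) hC
    (fun S' hS' ρ' T' hρ' => ?_)
  have hE' := hE.congr hS'
  have hC' := hC.congr fun X hX => hS' X (by omega)
  rw [sat_or, hρ'.sat_acceptingEnd hE', sat_and,
    hρ'.sat_atEnd hE' fun s' τ _ hτ => hρ'.sat_isUniversal le_rfl hτ]
  refine or_congr_right (and_congr_right fun _ => ?_)
  refine hρ'.sat_allSets_extension hE' (by omega) (by omega) (by omega)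
    (p := fun c => c.state ∈ N.universal)
    (fun S' ρ' T' h _ s' τ c hc _ hτ => h.sat_isUniversal hc hτ) hC'
    (fun S'' hS'' ρ'' T'' hρ'' => ?_)
  have hE'' := hE'.congr hS''
  have hψ' := hψ s S'' ρ'' T''
    (fun X hX => (hS'' X hX).trans ((hS' X hX).trans (hS X hX))) hρ''
  rw [sat_or, hρ''.sat_acceptingEnd hE'', sat_or, sat_and, sat_not, hρ''.sat_isFull hE'',
    hρ''.sat_atEnd hE'' (F := fun τ => MSO.and (isUniversal N 0 τ)
      (MSO.not (isHalted N.machine 0 τ))) fun s' τ hk hτ => by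
        rw [sat_and, sat_not, hρ''.sat_isUniversal le_rfl hτ,
          hρ''.sat_isHalted hE'' le_rfl hτ fun v hv => by rw [hk v hv]; omega],
    sat_and, hρ''.sat_atEnd hE'' (F := fun τ => MSO.not (isUniversal N 0 τ)) fun s' τ _ hτ => by
      rw [sat_not, hρ''.sat_isUniversal le_rfl hτ], hψ']

theorem expresses_rounds (hE : M.IsEnum S₀ w e) (hC : M.CodesAll S₀ e) (j : ℕ) :
    M.Expresses N.machine w S₀ e (rounds N j) (N.Rounds w n j) := by
  induction j with
  | zero => exact fun _ _ _ _ _ _ => iff_of_false sat_falsum id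
  | succ j ih => exact expresses_round hE hC ih

end ColStructure

/-! ### Correctness of the sentence -/

namespace ColStructure

open MSO

variable {A : Type u} {M : ColStructure A}

theorem IsFrame.congr {S S' : ℕ → Set A} (hS : ∀ X < 10, S' X = S X) (h : M.IsFrame S) :
    M.IsFrame S' := by
  have hc : M.LayerConn S' = M.LayerConn S := LayerConn.congr fun X hX => hS X (by omega)
  have hr : M.CodedRel S' 4 = M.CodedRel S 4 := by
    funext x y
    simp only [CodedRel, hc, hS 1 (by omega), hS 4 (by omega), hS 6 (by omega), hS 8 (by omega)]
  have hl : M.IsLink S' = M.IsLink S := by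
    funext D v x y
    simp only [IsLink, hc, hS 1 (by omega)]
  have h3 := hS 3 (by omega)
  constructor <;> rw [h3] <;> simp only [hc, hr, hl]
  · exact h.irrefl
  · exact h.trans
  · exact h.total
  · exact h.link
  · exact h.total_letter
  · exact h.functional_letter
  · exact h.mono_letter
  · exact h.initial_letter

theorem models_acceptance [Finite A] (hM : M.IsGraph) {N : ATM} {m d : ℕ} {w : List Bool}
    (ht : N.machine.TimeBounded d) (ha : N.AlternationBounded m)
    (h : M.ContainsPseudoWall (w.length ^ d) w) : M.Models (acceptance N m) ↔ N.Accepts w := by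
  have := h.nonempty
  obtain ⟨x, hx, n, hn, S₁, U, hk, hU, hxU⟩ := hasWordModel_of_containsPseudoWall hM h
  refine models_close_iff fun s S => ?_
  have hslot : ∀ {S S' : ℕ → Set A} {r : ℕ}, (∀ X, (∀ k < r, X ≠ slot 0 k) → S' X = S X) →
      ∀ X < 10, S' X = S X := fun h X hX => h X fun k _ => by simp only [slot]; omega
  rw [sat_exSets]
  constructor
  · rintro ⟨S₁, -, h1⟩
    rw [sat_and, sat_isFrame, sat_exSets] at h1
    obtain ⟨hf, S₂, hS₂, h2⟩ := h1
    -- This `n` is the size of the guessed domain, which may be smaller than the time bound.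
    obtain ⟨n, e, hE, hC⟩ := exists_isEnum hx hf
    have hE' := hE.congr (hslot hS₂)
    rw [sat_and, sat_and] at h2
    obtain ⟨h2, h3, h4⟩ := h2
    obtain ⟨ρ, T, hρ⟩ := exists_isTrace_of_sat hE' h2
    rw [hE'.sat_allDom] at h3
    simp only [sat_not, hρ.sat_isStep (Function.update_self ..)] at h3
    obtain rfl : T = 0 := by
      by_contra hT
      exact h3 ⟨0, by have := hρ.le; omega⟩ (Nat.pos_of_ne_zero hT)
    rw [expresses_rounds hE hC (m + 1) s S₂ ρ 0 (hslot hS₂) hρ] at h4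
    exact ATM.acceptsFrom_of_rounds (fun t ht => by omega) h4
  · intro hacc
    obtain ⟨S', e, hf, hE, hC⟩ := hU.exists_frame hx hn hxU
    -- The outer block of quantifiers may only change the first ten set variables, and a frame
    -- depends on no others.
    have hS₁ : ∀ X < 10, (fun X => if X < 10 then S' X else S X) X = S' X := fun X hX => if_pos hX
    refine ⟨fun X => if X < 10 then S' X else S X, fun X hX => if_neg fun h => hX X h rfl, ?_⟩
    rw [sat_and, sat_isFrame, sat_exSets]
    have hE₁ := hE.congr hS₁
    have hC₁ := hC.congr fun X hX => hS₁ X (by omega)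
    refine ⟨hf.congr hS₁, ?_⟩
    -- The game starts from the computation without steps; the values of `ρ` are immaterial.
    obtain ⟨S₂, hS₂, hρ⟩ := exists_isTrace (K := N.machine) (σ := 0) (T := 0) (ρ := fun _ => 0)
      hE₁ hC₁ (by omega) (by omega) (fun t ht => by omega)
    have hE₂ := hE₁.congr (hslot hS₂)
    refine ⟨S₂, hS₂, ?_⟩
    rw [sat_and, sat_and, hE₂.sat_allDom]
    refine ⟨hρ.sat_isTrace hE₂, fun t => ?_, ?_⟩
    · rw [sat_not, hρ.sat_isStep (Function.update_self ..)]
      exact Nat.not_lt_zero _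
    · rw [expresses_rounds hE₁ hC₁ (m + 1) s S₂ _ 0 (hslot hS₂) hρ]
      exact ATM.rounds_of_acceptsFrom (m := m)
        (fun ρ T hl => (ht w T _ hl.isRun).trans hk)
        (fun ρ T hl => ha w T _ hl.isRun) (fun t ht => by omega) hacc (by omega)

end ColStructure

/-- Without universal states, a derivation of acceptance is an accepting run read backwards from its
halting configuration. -/
theorem ATM.accepts_of_universal_nil {K : TM} {w : List Bool} :
    ATM.Accepts ⟨K, []⟩ w ↔ K.Accepts w := by
  constructor
  · intro h
    have key : ∀ c, ATM.AcceptsFrom ⟨K, []⟩ c → ∀ n r, K.IsRun w n r → r n = c → K.Accepts w := by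
      intro c hc
      induction hc with
      | halt c h1 h2 =>
        rintro n r hr rfl
        exact ⟨n, r, hr, h1, h2⟩
      | existential c c' _ h2 _ ih =>
        rintro n r hr rfl
        refine ih (n + 1) (fun t => if t ≤ n then r t else c') ⟨?_, fun t ht => ?_⟩ (by simp)
        · simpa using hr.1
        · rcases Nat.lt_succ_iff_lt_or_eq.1 ht with h | rfl
          · simpa [h.le, Nat.succ_le_of_lt h] using hr.2 t h
          · simpa using h2
      | forall_succ c h => simp at h
    exact key _ h 0 (fun _ => K.init w) ⟨rfl, fun t ht => by omega⟩ rfl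
  · rintro ⟨n, r, hr, h1, h2⟩
    have key : ∀ t ≤ n, ATM.AcceptsFrom ⟨K, []⟩ (r (n - t)) := by
      intro t
      induction t with
      | zero => exact fun _ => .halt _ h1 h2
      | succ t ih =>
        intro ht
        have h3 := hr.2 (n - (t + 1)) (by omega)
        rw [show n - (t + 1) + 1 = n - t by omega] at h3
        exact .existential _ _ (by simp) h3 (ih (by omega))
    have := key n le_rfl
    rwa [Nat.sub_self, hr.1] at this

/-! ### Computability of the sentences -/

section

variable {α : Type*} [Primcodable α] {K : α → TM} {N : α → ATM}

theorem TM.primrec_start : Primrec TM.start :=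
  Primrec.fst.comp (Primrec.of_equiv (e := TM.equiv))

theorem TM.primrec_accept : Primrec TM.accept :=
  (Primrec.fst.comp Primrec.snd).comp (Primrec.of_equiv (e := TM.equiv))

theorem TM.primrec_instr : Primrec TM.instr :=
  (Primrec.snd.comp Primrec.snd).comp (Primrec.of_equiv (e := TM.equiv))

theorem TM.primrec_length : Primrec fun K : TM => K.instr.length :=
  Primrec.list_length.comp TM.primrec_instr

theorem TM.primrec_ins : Primrec₂ TM.ins :=
  (Primrec.list_getD _).comp (TM.primrec_instr.comp Primrec.fst) Primrec.snd

theorem ATM.primrec_machine : Primrec ATM.machine :=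
  Primrec.fst.comp (Primrec.of_equiv (e := ATM.equiv))

theorem ATM.primrec_universal : Primrec ATM.universal :=
  Primrec.snd.comp (Primrec.of_equiv (e := ATM.equiv))

theorem ATM.primrec_mk_nil : Primrec fun K : TM => (⟨K, []⟩ : ATM) :=
  (Primrec.of_equiv_symm (e := ATM.equiv)).comp (Primrec.pair Primrec.id (Primrec.const []))

theorem primrecRel_mem_list {β : Type*} [Primcodable β] :
    PrimrecRel fun (l : List β) (b : β) => b ∈ l :=
  (PrimrecRel.exists_mem_list Primrec.eq).of_eq fun l b => by simp

namespace MSO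

theorem PrimFam.exDom (x : ℕ) {φ : α → MSO} (h : PrimFam φ) :
    PrimFam fun a => MSO.exDom x (φ a) :=
  ((PrimFam.const _).and h).ex x

theorem PrimFam.allDom (x : ℕ) {φ : α → MSO} (h : PrimFam φ) :
    PrimFam fun a => MSO.allDom x (φ a) :=
  ((PrimFam.const _).imp h).all x

theorem PrimFam.before (k x : ℕ) {F : α → Option ℕ → MSO} (h : ∀ τ, PrimFam fun a => F a τ) :
    PrimFam fun a => MSO.before k x (F a) :=
  ((PrimFam.const _).and (h none)).or (((PrimFam.const _).and (h (some k))).exDom k)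

theorem PrimFam.mem_slot (x σ : ℕ) {q : α → ℕ} (hq : Primrec q) :
    PrimFam fun a => MSO.mem x (24 + 2 * q a + σ) :=
  PrimFam.mem (Primrec.const x) (Primrec.nat_add.comp (Primrec.nat_add.comp (Primrec.const 24)
    (Primrec.nat_mul.comp (Primrec.const 2) hq)) (Primrec.const σ))

theorem PrimFam.select (hK : Primrec K) (σ : ℕ) {c : α → ℕ → Prop} [∀ a, DecidablePred (c a)]
    (hc : PrimrecPred fun p : α × ℕ => c p.1 p.2) (x : ℕ) :
    PrimFam fun a => MSO.select (K a) σ (c a) x :=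
  PrimFam.bigOr (TM.primrec_length.comp hK)
    (PrimFam.ite (c := fun p : α × ℕ => c p.1 p.2) hc (PrimFam.mem_slot x σ Primrec.snd)
      (PrimFam.const _))

theorem primrec_ins_of {q : α → ℕ} (hK : Primrec K) (hq : Primrec q) :
    Primrec fun a => (K a).ins (q a) := TM.primrec_ins.comp hK hq

theorem PrimFam.isStep (hK : Primrec K) (σ x : ℕ) : PrimFam fun a => MSO.isStep (K a) σ x :=
  PrimFam.select hK σ (c := fun _ _ => True) ⟨fun _ => .isTrue trivial, Primrec.const true⟩ x

theorem PrimFam.stateIn (hK : Primrec K) (σ : ℕ) {l : α → List ℕ} (hl : Primrec l) :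
    ∀ τ, PrimFam fun a => MSO.stateIn (K a) (l a) σ τ
  | none => PrimFam.ite (primrecRel_mem_list.comp hl (TM.primrec_start.comp hK))
      (PrimFam.const _) (PrimFam.const _)
  | some v => PrimFam.select hK σ (c := fun a q => ((K a).ins q).2.2.1 ∈ l a)
      (primrecRel_mem_list.comp (hl.comp Primrec.fst)
        (((Primrec.fst.comp Primrec.snd).comp Primrec.snd).comp
          (primrec_ins_of (hK.comp Primrec.fst) Primrec.snd))) v

theorem PrimFam.stateIs (hK : Primrec K) (σ : ℕ) {b : α → ℕ} (hb : Primrec b) :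
    ∀ τ, PrimFam fun a => MSO.stateIs (K a) σ (b a) τ
  | none => PrimFam.ite (Primrec.eq.comp (TM.primrec_start.comp hK) hb)
      (PrimFam.const _) (PrimFam.const _)
  | some v => PrimFam.select hK σ (c := fun a q => ((K a).ins q).2.2.1 = b a)
      (Primrec.eq.comp (((Primrec.fst.comp Primrec.snd).comp Primrec.snd).comp
          (primrec_ins_of (hK.comp Primrec.fst) Primrec.snd)) (hb.comp Primrec.fst)) v

theorem PrimFam.initSymbol (σ : ℕ) {b : α → ℕ} (hb : Primrec b) (τ : Option ℕ) :
    PrimFam fun a => MSO.initSymbol σ (b a) τ :=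
  PrimFam.ite (Primrec.eq.comp hb (Primrec.const 0)) (PrimFam.const _) <|
    PrimFam.ite (Primrec.eq.comp hb (Primrec.const 1)) (PrimFam.const _) <|
    PrimFam.ite (Primrec.eq.comp hb (Primrec.const 2)) (PrimFam.const _) (PrimFam.const _)

theorem PrimFam.symbolIs (hK : Primrec K) (σ : ℕ) {b : α → ℕ} (hb : Primrec b) (τ : Option ℕ) :
    PrimFam fun a => MSO.symbolIs (K a) σ (b a) τ :=
  PrimFam.or
    (PrimFam.exDom 22 ((PrimFam.const _).and ((PrimFam.const _).and ((PrimFam.const _).and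
      (PrimFam.select hK σ (c := fun a q => ((K a).ins q).2.2.2.1 = b a)
        (Primrec.eq.comp ((((Primrec.fst.comp Primrec.snd).comp Primrec.snd).comp Primrec.snd).comp
          (primrec_ins_of (hK.comp Primrec.fst) Primrec.snd)) (hb.comp Primrec.fst)) 22)))))
    ((PrimFam.const _).and (PrimFam.initSymbol σ hb τ))

theorem PrimFam.applicable (hK : Primrec K) (σ : ℕ) {q : α → ℕ} (hq : Primrec q) (τ : Option ℕ) :
    PrimFam fun a => MSO.applicable (K a) σ (q a) τ :=
  (PrimFam.stateIs hK σ (Primrec.fst.comp (primrec_ins_of hK hq)) τ).and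
    (PrimFam.symbolIs hK σ ((Primrec.fst.comp Primrec.snd).comp (primrec_ins_of hK hq)) τ)

theorem PrimFam.isTrace (hK : Primrec K) (σ : ℕ) : PrimFam fun a => MSO.isTrace (K a) σ := by
  have hmove : ∀ m : Option Bool,
      PrimFam fun a => MSO.select (K a) σ (fun q => ((K a).ins q).2.2.2.2 = m) 20 := fun m =>
    PrimFam.select hK σ (Primrec.eq.comp
      ((((Primrec.snd.comp Primrec.snd).comp Primrec.snd).comp Primrec.snd).comp
        (primrec_ins_of (hK.comp Primrec.fst) Primrec.snd)) (Primrec.const m)) 20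
  refine PrimFam.and (PrimFam.allDom 20 (PrimFam.bigAnd (TM.primrec_length.comp hK)
    (PrimFam.imp (PrimFam.mem_slot 20 σ Primrec.snd) (PrimFam.not
      (PrimFam.select (hK.comp Primrec.fst) σ
        (c := fun (a : α × ℕ) (q : ℕ) => q ≠ a.2) ?_ 20))))) <|
    PrimFam.and (PrimFam.allDom 20 ((PrimFam.isStep hK σ 20).imp
      (PrimFam.allDom 21 ((PrimFam.const _).imp (PrimFam.isStep hK σ 21))))) <|
    PrimFam.allDom 20 <| ((hmove none).imp (PrimFam.const _)).and <|
    ((hmove (some true)).imp (PrimFam.const _)).and ((hmove (some false)).imp (PrimFam.const _))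
  exact (Primrec.eq.comp Primrec.snd (Primrec.snd.comp Primrec.fst)).not

theorem PrimFam.isLegal (hK : Primrec K) (σ : ℕ) : PrimFam fun a => MSO.isLegal (K a) σ :=
  PrimFam.allDom 20 (PrimFam.bigAnd (TM.primrec_length.comp hK)
    (PrimFam.imp (PrimFam.mem_slot 20 σ Primrec.snd) (PrimFam.before 21 20
      (PrimFam.applicable (hK.comp Primrec.fst) σ Primrec.snd))))

theorem PrimFam.atEnd (hK : Primrec K) (σ : ℕ) {F : α → Option ℕ → MSO}
    (h : ∀ τ, PrimFam fun a => F a τ) : PrimFam fun a => MSO.atEnd (K a) σ (F a) :=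
  PrimFam.or (PrimFam.and (PrimFam.allDom 20 (PrimFam.isStep hK σ 20).not) (h none))
    (PrimFam.exDom 20 ((PrimFam.isStep hK σ 20).and ((PrimFam.allDom 21
      ((PrimFam.const _).imp (PrimFam.isStep hK σ 21).not)).and (h (some 20)))))

theorem PrimFam.isHalted (hK : Primrec K) (σ : ℕ) (τ : Option ℕ) :
    PrimFam fun a => MSO.isHalted (K a) σ τ :=
  PrimFam.bigAnd (TM.primrec_length.comp hK)
    (PrimFam.applicable (hK.comp Primrec.fst) σ Primrec.snd τ).not

theorem PrimFam.extension (hK : Primrec K) (σ σ' : ℕ) {F : α → Option ℕ → MSO}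
    (h : ∀ τ, PrimFam fun a => F a τ) : PrimFam fun a => MSO.extension (K a) σ σ' (F a) :=
  (PrimFam.isTrace hK σ').and <| (PrimFam.isLegal hK σ').and <|
    (PrimFam.bigAnd (TM.primrec_length.comp hK) (PrimFam.allDom 20
      (PrimFam.imp (PrimFam.mem_slot 20 σ Primrec.snd) (PrimFam.mem_slot 20 σ' Primrec.snd)))).and
    (PrimFam.allDom 20 ((PrimFam.isStep hK σ' 20).imp ((PrimFam.isStep hK σ 20).not.imp
      (PrimFam.before 21 20 h))))

theorem primrec_slot (σ : ℕ) : Primrec (slot σ) :=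
  Primrec.nat_add.comp (Primrec.nat_add.comp (Primrec.const 10)
    (Primrec.nat_mul.comp (Primrec.const 2) Primrec.id)) (Primrec.const σ)

theorem PrimFam.isUniversal (hN : Primrec N) (σ : ℕ) (τ : Option ℕ) :
    PrimFam fun a => MSO.isUniversal (N a) σ τ :=
  PrimFam.stateIn (ATM.primrec_machine.comp hN) σ (ATM.primrec_universal.comp hN) τ

theorem PrimFam.acceptingEnd (hN : Primrec N) (σ : ℕ) :
    PrimFam fun a => MSO.acceptingEnd (N a) σ :=
  have hK := ATM.primrec_machine.comp hN
  PrimFam.atEnd hK σ fun τ => (PrimFam.isHalted hK σ τ).and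
    (PrimFam.stateIn hK σ (TM.primrec_accept.comp hK) τ)

theorem PrimFam.round (hN : Primrec N) {ψ : α → MSO} (h : PrimFam ψ) :
    PrimFam fun a => MSO.round (N a) (ψ a) := by
  have hK := ATM.primrec_machine.comp hN
  have hr : Primrec fun a => 7 + (N a).machine.instr.length :=
    Primrec.nat_add.comp (Primrec.const 7) (TM.primrec_length.comp hK)
  refine PrimFam.exSets hr (primrec_slot 1) <|
    (PrimFam.extension hK 0 1 fun τ => (PrimFam.isUniversal hN 1 τ).not).and <|
    (PrimFam.acceptingEnd hN 1).or <|
    (PrimFam.atEnd hK 1 (PrimFam.isUniversal hN 1)).and <|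
    PrimFam.allSets hr (primrec_slot 0) <|
    (PrimFam.extension hK 1 0 (PrimFam.isUniversal hN 0)).imp <|
    (PrimFam.acceptingEnd hN 0).or <|
    PrimFam.or (PrimFam.and
      (PrimFam.atEnd hK 0 fun τ => (PrimFam.isUniversal hN 0 τ).and (PrimFam.isHalted hK 0 τ).not)
      (PrimFam.allDom 20 (PrimFam.isStep hK 0 20)).not) <|
    (PrimFam.atEnd hK 0 fun τ => (PrimFam.isUniversal hN 0 τ).not).and h

/-- The code of `F ψ` is obtained from that of `ψ` by putting a fixed word in front. -/
def IsPrefixing (F : MSO → MSO) : Prop := ∃ l, ∀ ψ, (F ψ).code = l ++ ψ.code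

namespace IsPrefixing

variable {F : MSO → MSO}

theorem id : IsPrefixing fun ψ => ψ := ⟨[], fun _ => rfl⟩

theorem and (φ : MSO) : IsPrefixing F → IsPrefixing fun ψ => MSO.and φ (F ψ) :=
  fun ⟨l, h⟩ => ⟨5 :: φ.code ++ l, fun ψ => by simp [code, h]⟩

theorem or (φ : MSO) : IsPrefixing F → IsPrefixing fun ψ => MSO.or φ (F ψ) :=
  fun ⟨l, h⟩ => ⟨6 :: φ.code ++ l, fun ψ => by simp [code, h]⟩

theorem exSets (r : ℕ) (g : ℕ → ℕ) : IsPrefixing F → IsPrefixing fun ψ => MSO.exSets r g (F ψ) :=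
  fun h => by
    induction r with
    | zero => exact h
    | succ r ih =>
      obtain ⟨l, h⟩ := ih
      exact ⟨9 :: g r :: l, fun ψ => congrArg (9 :: g r :: ·) (h ψ)⟩

theorem allSets (r : ℕ) (g : ℕ → ℕ) : IsPrefixing F → IsPrefixing fun ψ => MSO.allSets r g (F ψ) :=
  fun h => by
    induction r with
    | zero => exact h
    | succ r ih =>
      obtain ⟨l, h⟩ := ih
      exact ⟨10 :: g r :: l, fun ψ => congrArg (10 :: g r :: ·) (h ψ)⟩

/-- The prefix can be computed from a single sample `F φ` by cutting off the code of `φ` at its end.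
-/
theorem code_eq (hF : IsPrefixing F) (φ ψ : MSO) :
    (F ψ).code = (F φ).code.take ((F φ).code.length - φ.code.length) ++ ψ.code := by
  obtain ⟨l, h⟩ := hF
  simp [h]

end IsPrefixing

theorem isPrefixing_round (N : ATM) : IsPrefixing (MSO.round N) :=
  IsPrefixing.exSets _ _ <| .and _ <| .or _ <| .and _ <| .allSets _ _ <| .or _ <| .or _ <|
    .or _ <| .and _ .id

/-- The recursion on the number of rounds is carried out on codes; the prefix that is added in each
round is read off from the sample formula `falsum`. -/
theorem PrimFam.rounds (hN : Primrec N) {r : α → ℕ} (hr : Primrec r) :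
    PrimFam fun a => MSO.rounds (N a) (r a) := by
  have hround : Primrec fun a => (MSO.round (N a) falsum).code :=
    PrimFam.round hN (PrimFam.const falsum)
  have hpre : Primrec fun a => (MSO.round (N a) falsum).code.take
      ((MSO.round (N a) falsum).code.length - falsum.code.length) :=
    Primrec.list_take.comp (Primrec.nat_sub.comp (Primrec.list_length.comp hround)
      (Primrec.const _)) hround
  exact PrimFam.iterate (F := fun a => MSO.round (N a))
    (G := fun a l => (MSO.round (N a) falsum).code.take
      ((MSO.round (N a) falsum).code.length - falsum.code.length) ++ l) hr
    (Primrec.list_append.comp (hpre.comp Primrec.fst) Primrec.snd)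
    (fun a ψ => (isPrefixing_round (N a)).code_eq falsum ψ) (PrimFam.const falsum)

theorem PrimFam.acceptance : PrimFam fun p : ATM × ℕ => MSO.acceptance p.1 p.2 := by
  have hN : Primrec fun p : ATM × ℕ => p.1 := Primrec.fst
  have hK := ATM.primrec_machine.comp hN
  have hr : Primrec fun p : ATM × ℕ => 7 + p.1.machine.instr.length :=
    Primrec.nat_add.comp (Primrec.const 7) (TM.primrec_length.comp hK)
  exact PrimFam.close <| PrimFam.exSets (Primrec.const 10) Primrec.id <|
    (PrimFam.const isFrame).and <|
    PrimFam.exSets hr (primrec_slot 0) <| (PrimFam.isTrace hK 0).and <|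
    (PrimFam.allDom 20 (PrimFam.isStep hK 0 20).not).and
      (PrimFam.rounds hN (Primrec.succ.comp Primrec.snd))

end MSO

end

end PW

open PW

theorem corollary7 :
    (∃ φ : TM → MSO, Computable (fun M => (φ M).code) ∧
      ∀ M : TM, (φ M).IsSentence ∧
        ∀ d : ℕ, M.TimeBounded d →
          ∀ (w : List Bool) (A : Type u) [Finite A] (𝔄 : ColStructure A), 𝔄.IsGraph →
            𝔄.ContainsPseudoWall (w.length ^ d) w →
              (𝔄.Models (φ M) ↔ M.Accepts w)) ∧
    (∃ φ : ATM → ℕ → MSO, Computable (fun p : ATM × ℕ => (φ p.1 p.2).code) ∧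
      ∀ (N : ATM) (m : ℕ), (φ N m).IsSentence ∧
        ∀ d : ℕ, N.machine.TimeBounded d → N.AlternationBounded m →
          ∀ (w : List Bool) (A : Type u) [Finite A] (𝔄 : ColStructure A), 𝔄.IsGraph →
            𝔄.ContainsPseudoWall (w.length ^ d) w →
              (𝔄.Models (φ N m) ↔ N.Accepts w)) := by
  -- Without universal states there are no alternations, so the bound `0` is correct for every
  -- machine.
  refine ⟨⟨fun K => MSO.acceptance ⟨K, []⟩ 0, ?_, fun K => ⟨MSO.isSentence_close _, ?_⟩⟩,
    ⟨MSO.acceptance, MSO.PrimFam.acceptance.to_comp, fun N m => ⟨MSO.isSentence_close _, ?_⟩⟩⟩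
  · exact (MSO.PrimFam.acceptance.comp
      (Primrec.pair ATM.primrec_mk_nil (Primrec.const 0))).to_comp
  · intro d ht w A _ M hM h
    rw [← ATM.accepts_of_universal_nil]
    exact M.models_acceptance hM ht (fun w n r _ => by simp) h
  · intro d ht ha w A _ M hM h
    exact M.models_acceptance hM ht ha h
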